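/- Let $k\in\mathbf R$. In the Hilbert space $L_2(\mathbf R;\mathbf C^2)$, with elements written $f=(f_0,f_1)$, let $$T_k=\begin{bmatrix} k(\mathrm{sgn}(x)\partial_x-\partial_x\,\mathrm{sgn}(x)) & \partial_x\\ -\partial_x & 0\end{bmatrix},\qquad \mathsf D(T_k)=\{f:\ f_0\in H^1(\mathbf R),\ f_1-k\,\mathrm{sgn}(x)f_0\in H^1(\mathbf R)\},$$ with derivatives in the weak sense, i.e. $T_kf=\big(k\,\mathrm{sgn}(x)\,\partial_xf_0+\partial_x(f_1-k\,\mathrm{sgn}(x)f_0),\,-\partial_xf_0\big)$. Then $T_k$ is self-adjoint, so it has a spectral measure $E$, and for bounded Borel functions $b$ on $\mathbf R$ we write $b(T_k)=\int b\,dE$. Let $\chi_+$ be the characteristic function of $(0,\infty)$ and let $\mathrm{sgn}$ be the sign function with $\mathrm{sgn}(0)=0$. For every $f\in L_2(\mathbf R;\mathbf C^2)$ and almost every $x\in\mathbf R$, $$\mathrm{sgn}(T_k)f(x)=\frac1\pi\begin{bmatrix}-\mathrm{p.v.}\!\int\frac{f_1(y)}{x-y}\,dy\\[2pt] \mathrm{p.v.}\!\int\frac{f_0(y)}{x-y}\,dy\end{bmatrix}-\frac1\pi\,\frac{k}{1+k^2}\begin{bmatrix}\int\frac{f_0(y)+k\,\mathrm{sgn}(y)f_1(y)}{|x|+|y|}\,dy\\[2pt]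 \mathrm{sgn}(x)\int\frac{kf_0(y)-\mathrm{sgn}(y)f_1(y)}{|x|+|y|}\,dy\end{bmatrix},$$ where $\mathrm{p.v.}\!\int=\lim_{\varepsilon\to0^+}\int_{|x-y|>\varepsilon}$ exists for almost every $x$. Moreover, for every $f\in L_2(\mathbf R;\mathbf C^2)$, every $t>0$ and almost every $x\in\mathbf R$, the operator $e^{-t|T_k|}\chi_+(T_k)=b(T_k)$ with $b(s)=e^{-t|s|}\chi_+(s)$ is given by $$\begin{aligned}e^{-t|T_k|}\chi_+(T_k)f(x)={}&\frac1{2\pi}\begin{bmatrix}\int\frac{tf_0(y)-(x-y)f_1(y)}{t^2+(x-y)^2}\,dy\\[2pt] \int\frac{tf_1(y)+(x-y)f_0(y)}{t^2+(x-y)^2}\,dy\end{bmatrix}\\ &+\frac1{2\pi}\,\frac{k}{1+k^2}\begin{bmatrix}-\int\frac{t(kf_0(y)-\mathrm{sgn}(y)f_1(y))+(|x|+|y|)(f_0(y)+k\,\mathrm{sgn}(y)f_1(y))}{t^2+(|x|+|y|)^2}\,dy\\[2pt] \mathrm{sgn}(x)\int\frac{t(f_0(y)+k\,\mathrm{sgn}(y)f_1(y))+(|x|+|y|)(-kf_0(y)+\mathrm{sgn}(y)f_1(y))}{t^2+(|x|+|y|)^2}\,dy\end{bmatrix}.\end{aligned}$$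 All integrals other than the principal values converge absolutely for almost every $x$. -/

import Mathlib

open MeasureTheory Filter Topology Set
open scoped ContDiff ENNReal InnerProductSpace

noncomputable section

section SpectralCalculus

variable {H : Type*} [NormedAddCommGroup H] [InnerProductSpace ℂ H] [CompleteSpace H]

variable (H) in
/-- A projection-valued measure on the Borel sets of `ℝ` (a resolution of the identity). The values
of `proj` on non-measurable sets play no role. -/
structure SpectralMeasure where
  proj : Set ℝ → H →L[ℂ] H
  isStarProjection : ∀ s, MeasurableSet s → IsStarProjection (proj s)
  proj_univ : proj univ = 1
  proj_inter : ∀ s t, MeasurableSet s → MeasurableSet t → proj (s ∩ t) = proj s * proj t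
  hasSum_proj : ∀ s : ℕ → Set ℝ, (∀ n, MeasurableSet (s n)) → Pairwise (Function.onFun Disjoint s) →
    ∀ f : H, HasSum (fun n => proj (s n) f) (proj (⋃ n, s n) f)

namespace SpectralMeasure

variable (E : SpectralMeasure H)

theorem inner_proj (s : Set ℝ) (hs : MeasurableSet s) (f : H) :
    ⟪f, E.proj s f⟫_ℂ = ((‖E.proj s f‖ ^ 2 : ℝ) : ℂ) := by
  have h := E.isStarProjection s hs
  have h1 : E.proj s (E.proj s f) = E.proj s f := congrArg (fun A => A f) h.isIdempotentElem
  have h2 := ContinuousLinearMap.isSelfAdjoint_iff_isSymmetric.1 h.isSelfAdjoint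
  calc ⟪f, E.proj s f⟫_ℂ = ⟪f, E.proj s (E.proj s f)⟫_ℂ := by rw [h1]
    _ = ⟪E.proj s f, E.proj s f⟫_ℂ := (h2 f (E.proj s f)).symm
    _ = _ := by rw [inner_self_eq_norm_sq_to_K]; push_cast; rfl

theorem proj_empty : E.proj ∅ = 0 := by
  ext f
  have h := E.hasSum_proj (fun _ => ∅) (fun _ => MeasurableSet.empty) (fun _ _ _ => by simp) f
  have h2 : Tendsto (fun _ : ℕ => E.proj ∅ f) atTop (𝓝 0) := h.summable.tendsto_atTop_zero
  simpa using tendsto_nhds_unique tendsto_const_nhds h2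

/-- The scalar spectral measure `μ_f(s) = ‖E(s) f‖² = ⟪f, E(s) f⟫` of a vector `f`. -/
def measure (f : H) : Measure ℝ :=
  Measure.ofMeasurable (fun s _ => ENNReal.ofReal (‖E.proj s f‖ ^ 2)) (by simp [E.proj_empty])
    (by
      intro s hs hd
      have h := (E.hasSum_proj s hs hd f).mapL (innerSL ℂ f)
      simp only [innerSL_apply_apply, E.inner_proj _ (hs _),
        E.inner_proj _ (MeasurableSet.iUnion hs)] at h
      have h' : HasSum (fun n => ‖E.proj (s n) f‖ ^ 2) (‖E.proj (⋃ n, s n) f‖ ^ 2) := by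
        exact_mod_cast h
      rw [← h'.tsum_eq, ENNReal.ofReal_tsum_of_nonneg (fun n => by positivity) h'.summable])

theorem measure_apply (f : H) (s : Set ℝ) (hs : MeasurableSet s) :
    E.measure f s = ENNReal.ofReal (‖E.proj s f‖ ^ 2) :=
  Measure.ofMeasurable_apply s hs

instance (f : H) : IsFiniteMeasure (E.measure f) :=
  ⟨by rw [E.measure_apply f univ MeasurableSet.univ]; exact ENNReal.ofReal_lt_top⟩

theorem measure_real_univ (f : H) : (E.measure f).real univ = ‖f‖ ^ 2 := by
  rw [Measure.real, E.measure_apply f univ MeasurableSet.univ, E.proj_univ,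
    ENNReal.toReal_ofReal (by positivity)]
  rfl

/-- `A = ∫ b dE` for a bounded operator `A`, in the weak sense `⟪f, A f⟫ = ∫ b dμ_f`. -/
def IsIntegral (b : ℝ → ℂ) (A : H →L[ℂ] H) : Prop :=
  ∀ f : H, ⟪f, A f⟫_ℂ = ∫ x, b x ∂E.measure f

theorem IsIntegral.unique {b : ℝ → ℂ} {A B : H →L[ℂ] H} (hA : E.IsIntegral b A)
    (hB : E.IsIntegral b B) : A = B := by
  have h : (A : H →ₗ[ℂ] H) = B := by
    rw [← ext_inner_map]
    intro x
    have := congrArg (starRingEnd ℂ) ((hA x).trans (hB x).symm)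
    rwa [inner_conj_symm, inner_conj_symm] at this
  ext x
  exact congrArg (fun T : H →ₗ[ℂ] H => T x) h

theorem isIntegral_simpleFunc (s : SimpleFunc ℝ ℂ) :
    E.IsIntegral s (∑ z ∈ s.range, z • E.proj (s ⁻¹' {z})) := by
  intro f
  have hm : ∀ z, MeasurableSet (s ⁻¹' {z}) := fun z => s.measurableSet_fiber z
  rw [SimpleFunc.integral_eq_sum s (s.integrable_of_isFiniteMeasure)]
  simp only [sum_apply, smul_apply, inner_sum,
    inner_smul_right, E.inner_proj _ (hm _), Measure.real, E.measure_apply f _ (hm _)]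
  refine Finset.sum_congr rfl fun z _ => ?_
  rw [ENNReal.toReal_ofReal (by positivity), Complex.real_smul, mul_comm]

/-- Every bounded Borel function can be integrated against a projection-valued measure. -/
theorem exists_isIntegral (b : ℝ → ℂ) (hb : Measurable b) (C : ℝ) (hC : ∀ x, ‖b x‖ ≤ C) :
    ∃ A, E.IsIntegral b A := by
  let s : ℕ → SimpleFunc ℝ ℂ := fun n => SimpleFunc.approxOn b hb univ 0 (mem_univ _) n
  let A : ℕ → H →L[ℂ] H := fun n => ∑ z ∈ (s n).range, z • E.proj (s n ⁻¹' {z})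
  let q : H → ℂ := fun f => ∫ x, b x ∂E.measure f
  have hq : ∀ f, ‖q f‖ ≤ C * ‖f‖ ^ 2 := fun f => by
    rw [← E.measure_real_univ f]
    exact norm_integral_le_of_norm_le_const (Eventually.of_forall hC)
  have hlim : ∀ f, Tendsto (fun n => ⟪A n f, f⟫_ℂ) atTop (𝓝 ((starRingEnd ℂ) (q f))) := by
    intro f
    have h : Tendsto (fun n => ∫ x, s n x ∂E.measure f) atTop (𝓝 (q f)) := by
      refine tendsto_integral_of_dominated_convergence (fun _ => C + C)
        (fun n => (s n).aestronglyMeasurable) (integrable_const _) (fun n => ?_) ?_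
      · exact Eventually.of_forall fun x =>
          (SimpleFunc.norm_approxOn_zero_le hb (mem_univ _) x n).trans (add_le_add (hC x) (hC x))
      · exact Eventually.of_forall fun x =>
          SimpleFunc.tendsto_approxOn hb (mem_univ _) (by simp)
    refine ((Complex.continuous_conj.tendsto _).comp h).congr fun n => ?_
    rw [Function.comp_apply, ← E.isIntegral_simpleFunc (s n) f, inner_conj_symm]
  let B : H → H → ℂ := fun f g => ((starRingEnd ℂ) (q (g + f)) - (starRingEnd ℂ) (q (g - f)) +
    Complex.I * (starRingEnd ℂ) (q (g + Complex.I • f)) -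
    Complex.I * (starRingEnd ℂ) (q (g - Complex.I • f))) / 4
  have hB : ∀ f g, Tendsto (fun n => ⟪A n f, g⟫_ℂ) atTop (𝓝 (B f g)) := by
    intro f g
    have h := ((((hlim (g + f)).sub (hlim (g - f))).add ((hlim (g + Complex.I • f)).const_mul
      Complex.I)).sub ((hlim (g - Complex.I • f)).const_mul Complex.I)).div_const 4
    refine h.congr fun n => ?_
    exact (inner_map_polarization (A n : H →ₗ[ℂ] H) g f).symm
  have hBq : ∀ f, B f f = (starRingEnd ℂ) (q f) := fun f =>
    tendsto_nhds_unique (hB f f) (hlim f)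
  have hbd : ∀ f g, ‖B f g‖ ≤ C * (‖f‖ ^ 2 + ‖g‖ ^ 2) := by
    intro f g
    have h1 := parallelogram_law_with_norm ℂ g f
    have h2 := parallelogram_law_with_norm ℂ g (Complex.I • f)
    rw [norm_smul, Complex.norm_I, one_mul] at h2
    have a1 := hq (g + f)
    have a2 := hq (g - f)
    have a3 := hq (g + Complex.I • f)
    have a4 := hq (g - Complex.I • f)
    have h : ‖B f g‖ ≤ (‖q (g + f)‖ + ‖q (g - f)‖ + ‖q (g + Complex.I • f)‖ +
        ‖q (g - Complex.I • f)‖) / 4 := by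
      simp only [B, norm_div, RCLike.norm_ofNat]
      gcongr
      refine (norm_sub_le _ _).trans (add_le_add ((norm_add_le _ _).trans (add_le_add
        ((norm_sub_le _ _).trans ?_) ?_)) ?_) <;> simp
    have e : C * ‖g + f‖ ^ 2 + C * ‖g - f‖ ^ 2 + C * ‖g + Complex.I • f‖ ^ 2 +
        C * ‖g - Complex.I • f‖ ^ 2 = 4 * (C * (‖f‖ ^ 2 + ‖g‖ ^ 2)) := by
      linear_combination C * h1 + C * h2
    linarith
  have hsmul : ∀ (c : ℂ) f g, B (c • f) g = (starRingEnd ℂ) c * B f g := fun c f g =>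
    tendsto_nhds_unique (hB _ _) (((hB f g).const_mul _).congr fun n => by
      rw [map_smul, inner_smul_left])
  have hsmul' : ∀ (c : ℂ) f g, B f (c • g) = c * B f g := fun c f g =>
    tendsto_nhds_unique (hB _ _) (((hB f g).const_mul _).congr fun n => by
      rw [inner_smul_right])
  have hadd : ∀ f f' g, B (f + f') g = B f g + B f' g := fun f f' g =>
    tendsto_nhds_unique (hB _ _) (((hB f g).add (hB f' g)).congr fun n => by
      rw [map_add, inner_add_left])
  have hadd' : ∀ f g g', B f (g + g') = B f g + B f g' := fun f g g' =>
    tendsto_nhds_unique (hB _ _) (((hB f g).add (hB f g')).congr fun n => by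
      rw [inner_add_right])
  let Bl : H →ₗ⋆[ℂ] H →ₗ[ℂ] ℂ :=
    LinearMap.mk₂'ₛₗ (starRingEnd ℂ) (RingHom.id ℂ) B hadd hsmul hadd' hsmul'
  have hbd2 : ∀ f g, ‖Bl f g‖ ≤ (2 * C) * ‖f‖ * ‖g‖ := by
    intro f g
    change ‖B f g‖ ≤ _
    rcases eq_or_ne f 0 with rfl | hf
    · have : B 0 g = 0 := by simpa using hsmul 0 0 g
      simp [this]
    rcases eq_or_ne g 0 with rfl | hg
    · have : B f 0 = 0 := by simpa using hsmul' 0 f 0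
      simp [this]
    have hf' : ‖f‖ ≠ 0 := norm_ne_zero_iff.2 hf
    have hg' : ‖g‖ ≠ 0 := norm_ne_zero_iff.2 hg
    have h := hbd ((‖f‖⁻¹ : ℂ) • f) ((‖g‖⁻¹ : ℂ) • g)
    rw [hsmul, hsmul'] at h
    simp only [norm_smul, norm_mul, norm_inv, RCLike.norm_conj, Complex.norm_real, norm_norm,
      inv_mul_cancel₀ hf', inv_mul_cancel₀ hg'] at h
    have h3 : ‖B f g‖ = (‖f‖⁻¹ * (‖g‖⁻¹ * ‖B f g‖)) * (‖f‖ * ‖g‖) := by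
      field_simp
    rw [h3]
    nlinarith [mul_nonneg (norm_nonneg f) (norm_nonneg g)]
  let Bc : H →L⋆[ℂ] H →L[ℂ] ℂ := Bl.mkContinuous₂ (2 * C) hbd2
  refine ⟨InnerProductSpace.continuousLinearMapOfBilin Bc, fun f => ?_⟩
  rw [← inner_conj_symm, InnerProductSpace.continuousLinearMapOfBilin_apply]
  change (starRingEnd ℂ) (B f f) = _
  rw [hBq, Complex.conj_conj]

open Classical in
/-- The operator `∫ b dE`, for a bounded Borel function `b` on `ℝ`. -/
def integral (b : ℝ → ℂ) : H →L[ℂ] H :=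
  if h : ∃ A, E.IsIntegral b A then h.choose else 0

theorem isIntegral_integral (b : ℝ → ℂ) (hb : Measurable b) (C : ℝ) (hC : ∀ x, ‖b x‖ ≤ C) :
    E.IsIntegral b (E.integral b) := by
  have h := E.exists_isIntegral b hb C hC
  rw [integral, dif_pos h]
  exact h.choose_spec

/-- `E` is the spectral measure of the (unbounded) operator `T`, that is `T = ∫ x dE(x)`:
the domain of `T` is `{f | ∫ x² dμ_f < ∞}`, and `⟪f, T f⟫ = ∫ x dμ_f` there. By polarization and
density of the domain this determines `T` from `E`. -/
def IsSpectralMeasureOf (T : H →ₗ.[ℂ] H) : Prop :=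
  (∀ f : H, f ∈ T.domain ↔ Integrable (fun x : ℝ => x ^ 2) (E.measure f)) ∧
  ∀ f : T.domain, ⟪(f : H), T f⟫_ℂ = ∫ x, (x : ℂ) ∂E.measure (f : H)

end SpectralMeasure

end SpectralCalculus

section Operator

/-- `v` is the weak derivative of `u` on `ℝ`. -/
def IsWeakDeriv (u v : ℝ → ℂ) : Prop :=
  ∀ φ : ℝ → ℝ, ContDiff ℝ ∞ φ → HasCompactSupport φ →
    ∫ x, deriv φ x • u x = -∫ x, φ x • v x

/-- The Sobolev space `H¹(ℝ)`. -/
def MemH1 (u : ℝ → ℂ) : Prop :=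
  MemLp u 2 ∧ ∃ v, MemLp v 2 ∧ IsWeakDeriv u v

open Classical in
/-- The weak derivative of a function in `H¹(ℝ)`. -/
def weakDeriv (u : ℝ → ℂ) : ℝ → ℂ :=
  if h : MemH1 u then h.2.choose else 0

theorem MemH1.memLp_weakDeriv {u : ℝ → ℂ} (h : MemH1 u) : MemLp (weakDeriv u) 2 := by
  rw [weakDeriv, dif_pos h]
  exact h.2.choose_spec.1

theorem MemH1.isWeakDeriv {u : ℝ → ℂ} (h : MemH1 u) : IsWeakDeriv u (weakDeriv u) := by
  rw [weakDeriv, dif_pos h]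
  exact h.2.choose_spec.2

theorem integrable_testFunction_smul {φ : ℝ → ℝ} (hφ : Continuous φ) (hc : HasCompactSupport φ)
    {u : ℝ → ℂ} (hu : MemLp u 2) : Integrable (fun x => φ x • u x) :=
  (hu.locallyIntegrable (by norm_num)).integrable_smul_left_of_hasCompactSupport hφ hc

theorem IsWeakDeriv.add {u u' v v' : ℝ → ℂ} (h : IsWeakDeriv u v) (h' : IsWeakDeriv u' v')
    (hu : MemLp u 2) (hu' : MemLp u' 2) (hv : MemLp v 2) (hv' : MemLp v' 2) :
    IsWeakDeriv (u + u') (v + v') := by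
  intro φ hφ hc
  have hd : Continuous (deriv φ) := hφ.continuous_deriv (by simp)
  simp only [Pi.add_apply, smul_add]
  rw [integral_add (integrable_testFunction_smul hd hc.deriv hu)
      (integrable_testFunction_smul hd hc.deriv hu'),
    integral_add (integrable_testFunction_smul hφ.continuous hc hv)
      (integrable_testFunction_smul hφ.continuous hc hv'), h φ hφ hc, h' φ hφ hc, neg_add]

theorem IsWeakDeriv.const_smul {u v : ℝ → ℂ} (h : IsWeakDeriv u v) (c : ℂ) :
    IsWeakDeriv (c • u) (c • v) := by
  intro φ hφ hc
  simp only [Pi.smul_apply, smul_comm _ c]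
  rw [integral_smul, integral_smul, h φ hφ hc, smul_neg]

theorem IsWeakDeriv.congr {u u' v : ℝ → ℂ} (h : IsWeakDeriv u v) (hu : u =ᵐ[volume] u') :
    IsWeakDeriv u' v := by
  intro φ hφ hc
  rw [← h φ hφ hc]
  exact integral_congr_ae (hu.mono fun x hx => by simp only [hx])

theorem MemH1.weakDeriv_ae_eq {u v : ℝ → ℂ} (h : MemH1 u) (hv : MemLp v 2)
    (huv : IsWeakDeriv u v) : weakDeriv u =ᵐ[volume] v := by
  refine ae_eq_of_integral_contDiff_smul_eq (h.memLp_weakDeriv.locallyIntegrable (by norm_num))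
    (hv.locallyIntegrable (by norm_num)) fun φ hφ hc => ?_
  rw [← neg_inj, ← huv φ hφ hc, ← h.isWeakDeriv φ hφ hc]

theorem MemH1.congr {u u' : ℝ → ℂ} (h : MemH1 u) (hu : u =ᵐ[volume] u') : MemH1 u' :=
  ⟨h.1.ae_eq hu, h.2.imp fun _ hv => ⟨hv.1, hv.2.congr hu⟩⟩

theorem MemH1.add {u u' : ℝ → ℂ} (h : MemH1 u) (h' : MemH1 u') : MemH1 (u + u') :=
  ⟨h.1.add h'.1, _, h.memLp_weakDeriv.add h'.memLp_weakDeriv,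
    h.isWeakDeriv.add h'.isWeakDeriv h.1 h'.1 h.memLp_weakDeriv h'.memLp_weakDeriv⟩

theorem MemH1.const_smul {u : ℝ → ℂ} (h : MemH1 u) (c : ℂ) : MemH1 (c • u) :=
  ⟨h.1.const_smul c, _, h.memLp_weakDeriv.const_smul c, h.isWeakDeriv.const_smul c⟩

theorem MemH1.zero : MemH1 0 :=
  ⟨MemLp.zero, 0, MemLp.zero, fun φ _ _ => by simp⟩

theorem weakDeriv_add {u u' w : ℝ → ℂ} (h : MemH1 u) (h' : MemH1 u')
    (hw : w =ᵐ[volume] u + u') :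
    weakDeriv w =ᵐ[volume] weakDeriv u + weakDeriv u' :=
  ((h.add h').congr hw.symm).weakDeriv_ae_eq (h.memLp_weakDeriv.add h'.memLp_weakDeriv)
    ((h.isWeakDeriv.add h'.isWeakDeriv h.1 h'.1 h.memLp_weakDeriv h'.memLp_weakDeriv).congr hw.symm)

theorem weakDeriv_const_smul {u w : ℝ → ℂ} (h : MemH1 u) (c : ℂ) (hw : w =ᵐ[volume] c • u) :
    weakDeriv w =ᵐ[volume] c • weakDeriv u :=
  ((h.const_smul c).congr hw.symm).weakDeriv_ae_eq (h.memLp_weakDeriv.const_smul c)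
    ((h.isWeakDeriv.const_smul c).congr hw.symm)

/-- The Hilbert space `L₂(ℝ; ℂ²)`. -/
abbrev L2C2 : Type := Lp (EuclideanSpace ℂ (Fin 2)) 2 (volume : Measure ℝ)

/-- The sign function of a real number, as a complex number. -/
def sgn (x : ℝ) : ℂ := (Real.sign x : ℂ)

/-- The function `f₁ - k sgn(x) f₀`. -/
def jumpPart (k : ℝ) (f : L2C2) : ℝ → ℂ := fun x => f x 1 - k * sgn x * f x 0

theorem measurable_sgn : Measurable sgn := by
  unfold sgn Real.sign
  refine Complex.measurable_ofReal.comp ?_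
  exact Measurable.ite measurableSet_Iio measurable_const
    (Measurable.ite measurableSet_Ioi measurable_const measurable_const)

theorem norm_sgn_le (x : ℝ) : ‖sgn x‖ ≤ 1 := by
  unfold sgn
  rcases Real.sign_apply_eq x with h | h | h <;> simp [h]

theorem memLp_sgn_mul {u : ℝ → ℂ} (hu : MemLp u 2) : MemLp (fun x => sgn x * u x) 2 :=
  hu.of_le (measurable_sgn.aestronglyMeasurable.mul hu.1) (Eventually.of_forall fun x => by
    rw [norm_mul]
    exact mul_le_of_le_one_left (norm_nonneg _) (norm_sgn_le x))

theorem coord_add (f g : L2C2) (i : Fin 2) :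
    (fun x => (f + g : L2C2) x i) =ᵐ[volume] (fun x => f x i) + fun x => g x i :=
  (Lp.coeFn_add f g).mono fun x hx => by
    simp only [hx, Pi.add_apply, PiLp.add_apply]

theorem coord_smul (c : ℂ) (f : L2C2) (i : Fin 2) :
    (fun x => (c • f : L2C2) x i) =ᵐ[volume] c • fun x => f x i :=
  (Lp.coeFn_smul c f).mono fun x hx => by
    simp only [hx, Pi.smul_apply, PiLp.smul_apply]

theorem jumpPart_add (k : ℝ) (f g : L2C2) :
    jumpPart k (f + g) =ᵐ[volume] jumpPart k f + jumpPart k g :=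
  (Lp.coeFn_add f g).mono fun x hx => by
    simp only [jumpPart, hx, Pi.add_apply, PiLp.add_apply]
    ring

theorem jumpPart_smul (k : ℝ) (c : ℂ) (f : L2C2) :
    jumpPart k (c • f) =ᵐ[volume] c • jumpPart k f :=
  (Lp.coeFn_smul c f).mono fun x hx => by
    simp only [jumpPart, hx, Pi.smul_apply, PiLp.smul_apply, smul_eq_mul]
    ring

/-- The domain `{f | f₀ ∈ H¹(ℝ), f₁ - k sgn(x) f₀ ∈ H¹(ℝ)}` of `T_k`. -/
def opTDomain (k : ℝ) : Submodule ℂ L2C2 where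
  carrier := {f | MemH1 (fun x => f x 0) ∧ MemH1 (jumpPart k f)}
  add_mem' := fun {f g} hf hg =>
    ⟨(hf.1.add hg.1).congr (coord_add f g 0).symm, (hf.2.add hg.2).congr (jumpPart_add k f g).symm⟩
  zero_mem' := by
    have h0 : ∀ᵐ x : ℝ, (0 : L2C2) x = 0 := Lp.coeFn_zero _ _ _
    exact ⟨MemH1.zero.congr (h0.mono fun x hx => by simp only [hx]; rfl),
      MemH1.zero.congr (h0.mono fun x hx => by simp [jumpPart])⟩
  smul_mem' := fun c f hf =>
    ⟨(hf.1.const_smul c).congr (coord_smul c f 0).symm,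
      (hf.2.const_smul c).congr (jumpPart_smul k c f).symm⟩

/-- The function `(k sgn ∂f₀ + ∂(f₁ - k sgn f₀), -∂f₀)`, which is
`(k (sgn ∂ - ∂ sgn) f₀ + ∂f₁, -∂f₀)` written so that only derivatives of `H¹` functions occur. -/
def opTFun (k : ℝ) (f : L2C2) : ℝ → EuclideanSpace ℂ (Fin 2) := fun x =>
  !₂[k * (sgn x * weakDeriv (fun y => f y 0) x) + weakDeriv (jumpPart k f) x,
    -weakDeriv (fun y => f y 0) x]

theorem memLp_opTFun {k : ℝ} {f : L2C2} (hf : f ∈ opTDomain k) : MemLp (opTFun k f) 2 := by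
  rw [memLp_piLp_iff]
  intro i
  fin_cases i
  · exact ((memLp_sgn_mul hf.1.memLp_weakDeriv).const_mul (k : ℂ)).add hf.2.memLp_weakDeriv
  · exact hf.1.memLp_weakDeriv.neg

/-- The operator `T_k = [k (sgn ∂ - ∂ sgn), ∂; -∂, 0]` in `L₂(ℝ; ℂ²)`. -/
def opT (k : ℝ) : L2C2 →ₗ.[ℂ] L2C2 where
  domain := opTDomain k
  toFun :=
    { toFun := fun f => (memLp_opTFun f.2).toLp (opTFun k f)
      map_add' := fun f g => by
        rw [← MemLp.toLp_add, MemLp.toLp_eq_toLp_iff]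
        filter_upwards [weakDeriv_add f.2.1 g.2.1 (coord_add f g 0),
          weakDeriv_add f.2.2 g.2.2 (jumpPart_add k f g)] with x h0 h1
        simp only [Pi.add_apply] at h0 h1
        simp only [opTFun, Submodule.coe_add, h0, h1, Pi.add_apply]
        ext i
        fin_cases i
        · simp; ring
        · simp; ring
      map_smul' := fun c f => by
        rw [RingHom.id_apply, ← MemLp.toLp_const_smul, MemLp.toLp_eq_toLp_iff]
        filter_upwards [weakDeriv_const_smul f.2.1 c (coord_smul c f 0),
          weakDeriv_const_smul f.2.2 c (jumpPart_smul k c f)] with x h0 h1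
        ext i
        fin_cases i
        · simp [opTFun, h0, h1]; ring
        · simp [opTFun, h0] }

end Operator

section Kernels

/-- The characteristic function of the right half line, `χ₊`. -/
def chiPlus (s : ℝ) : ℂ := (Ioi (0 : ℝ)).indicator 1 s

/-- The principal value integral `p.v. ∫ h(y) / (x - y) dy` exists and equals `L`. -/
def HasPV (h : ℝ → ℂ) (x : ℝ) (L : ℂ) : Prop :=
  (∀ ε > 0, IntegrableOn (fun y => h y / (x - y)) {y | ε < |x - y|}) ∧
  Tendsto (fun ε : ℝ => ∫ y in {y | ε < |x - y|}, h y / (x - y)) (𝓝[>] 0) (𝓝 L)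

/-- The integral of `g` over `ℝ` converges absolutely and equals `I`. -/
def HasIntegral (g : ℝ → ℂ) (I : ℂ) : Prop := Integrable g ∧ ∫ y, g y = I

end Kernels

end

/-! The operator $T_k$ is $-i\,d/dx$ in disguise. Put $p=f_0+if_1$, $m=f_0-if_1$ and $Rm(x)=m(-x)$.
Away from the origin $T_k$ acts as $-i\partial$ on $p$ and as $i\partial$ on $m$, hence as
$-i\partial$ on $Rm$. The domain makes $f_0$ continuous at $0$ and lets $f_1$ jump there by
$2kf_0(0)$. Then $p-Rm$ is continuous at $0$, while $p+Rm$ takes the one-sided values $2(1\pm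
ik)f_0(0)$. Multiplication by the unimodular function `phase`
$=(1-ik\,\mathrm{sgn}\,x)/\sqrt{1+k^2}$ removes this jump. So `unfold`,
$f\mapsto\frac12(\mathrm{phase}\cdot(p+Rm),\,p-Rm)$, is unitary and carries $T_k$, domain included,
to $-i\,d/dx$ on $H^1(\mathbf R;\mathbf C^2)$. No boundary values are used: all functions involved
are combinations of $H^1$ functions, their reflections, and $\mathrm{sgn}$ times odd $H^1$
functions, which are again in $H^1$ (`IsH1Pair.sgn_mul_odd`). The inverse Fourier transform
diagonalizes $-i\,d/dx$ as multiplication by $-2\pi\xi$; this gives a spectral measure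
(`opTSpectralMeasure_isSpectralMeasureOf`).

The existence of a spectral measure implies self-adjointness, by solving $(T-z)f=h$ for nonreal $z$.
The scalar measures $\mu_f$ are determined by $T$, because the star algebra generated by one
resolvent function separates points (`IsSpectralMeasureOf.measure_eq`). Hence $b(T_k)$ is the
conjugate of $b(-i\,d/dx)$ by `unfold`, for every spectral measure of $T_k$ (`integral_apply_eq`).

For integrable $b$, $b(-i\,d/dx)$ is a convolution. The symbols $e^{-t|s|}$ and
$e^{-t|s|}\mathrm{sgn}(s)$ give $1/\pi$ times the Poisson kernel $t/(t^2+u^2)$ and $i/\pi$ times the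
conjugate kernel $u/(t^2+u^2)$; since $\chi_+=(1+\mathrm{sgn})/2$ off $0$, this settles
$e^{-t|T_k|}\chi_+(T_k)$ up to algebra. The symbol $\mathrm{sgn}$ is not integrable. There the
conjugate Poisson integral of $h$ is a Poisson integral of $\mathrm{sgn}(-i\,d/dx)h$, so it
converges at Lebesgue points as $t\to0$; it differs from the integral truncated at distance $t$ by
an amount that vanishes at Lebesgue points of $h$. This yields the principal values and identifies
the limit.

The algebra is in the `hasIntegral_foldFun_even_*` and `hasIntegral_foldFun_odd_*` lemmas. Undoing
`unfold` produces the kernels $\kappa(x-y)$ and $\kappa(x+y)$ with products of phases as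
coefficients. In each quadrant of $(x,y)$ these combine, by the parity of $\kappa$, into
$\kappa(x-y)$ and $\kappa(|x|+|y|)$. -/

noncomputable section

set_option linter.unusedSectionVars false

/-! ### Multiplicative functional calculus of a projection-valued measure. -/

namespace SpectralMeasure

/-- By polarization each matrix element is a fixed combination of four quadratic values. Integrals
against `E` are defined by their quadratic forms alone, and this is how dominated convergence
becomes weak operator convergence. -/
theorem tendsto_inner_of_tendsto_quadratic {H : Type*} [NormedAddCommGroup H]
    [InnerProductSpace ℂ H] {A : ℕ → H →L[ℂ] H} {B : H →L[ℂ] H}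
    (h : ∀ f, Tendsto (fun n => ⟪f, A n f⟫_ℂ) atTop (𝓝 ⟪f, B f⟫_ℂ)) (f g : H) :
    Tendsto (fun n => ⟪g, A n f⟫_ℂ) atTop (𝓝 ⟪g, B f⟫_ℂ) := by
  have h' : ∀ f, Tendsto (fun n => ⟪A n f, f⟫_ℂ) atTop (𝓝 ⟪B f, f⟫_ℂ) := fun f => by
    have := (Complex.continuous_conj.tendsto _).comp (h f)
    simpa only [Function.comp_def, inner_conj_symm] using this
  have key : Tendsto (fun n => ⟪A n f, g⟫_ℂ) atTop (𝓝 ⟪B f, g⟫_ℂ) := by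
    have h4 := ((((h' (g + f)).sub (h' (g - f))).add ((h' (g + Complex.I • f)).const_mul
      Complex.I)).sub ((h' (g - Complex.I • f)).const_mul Complex.I)).div_const 4
    have e := inner_map_polarization (B : H →ₗ[ℂ] H) g f
    simp only [ContinuousLinearMap.coe_coe] at e
    rw [e]
    refine h4.congr fun n => ?_
    exact (inner_map_polarization (A n : H →ₗ[ℂ] H) g f).symm
  have := (Complex.continuous_conj.tendsto _).comp key
  simpa only [Function.comp_def, inner_conj_symm] using this

variable {H : Type*} [NormedAddCommGroup H] [InnerProductSpace ℂ H] [CompleteSpace H]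
variable (E : SpectralMeasure H)

/-- Bounded Borel functions. -/
def IsBddBorel (b : ℝ → ℂ) : Prop := Measurable b ∧ ∃ C : ℝ, ∀ x, ‖b x‖ ≤ C

theorem IsBddBorel.integrable {b : ℝ → ℂ} (hb : IsBddBorel b) (μ : Measure ℝ)
    [IsFiniteMeasure μ] : Integrable b μ := by
  obtain ⟨hm, C, hC⟩ := hb
  exact Integrable.of_bound hm.aestronglyMeasurable C (Eventually.of_forall hC)

theorem IsBddBorel.mul {b c : ℝ → ℂ} (hb : IsBddBorel b) (hc : IsBddBorel c) :
    IsBddBorel (b * c) := by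
  obtain ⟨hm, C, hC⟩ := hb
  obtain ⟨hm', C', hC'⟩ := hc
  refine ⟨hm.mul hm', C * C', fun x => ?_⟩
  rw [Pi.mul_apply, norm_mul]
  exact mul_le_mul (hC x) (hC' x) (norm_nonneg _) ((norm_nonneg _).trans (hC x))

theorem IsBddBorel.add {b c : ℝ → ℂ} (hb : IsBddBorel b) (hc : IsBddBorel c) :
    IsBddBorel (b + c) := by
  obtain ⟨hm, C, hC⟩ := hb
  obtain ⟨hm', C', hC'⟩ := hc
  exact ⟨hm.add hm', C + C', fun x => (norm_add_le _ _).trans (add_le_add (hC x) (hC' x))⟩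

theorem IsBddBorel.const (z : ℂ) : IsBddBorel (fun _ => z) :=
  ⟨measurable_const, ‖z‖, fun _ => le_rfl⟩

theorem IsBddBorel.indicator {b : ℝ → ℂ} (hb : IsBddBorel b) {s : Set ℝ} (hs : MeasurableSet s) :
    IsBddBorel (s.indicator b) := by
  obtain ⟨hm, C, hC⟩ := hb
  refine ⟨hm.indicator hs, C, fun x => (norm_indicator_le_norm_self _ _).trans (hC x)⟩

theorem IsBddBorel.star {b : ℝ → ℂ} (hb : IsBddBorel b) :
    IsBddBorel (fun x => (starRingEnd ℂ) (b x)) := by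
  obtain ⟨hm, C, hC⟩ := hb
  exact ⟨Complex.continuous_conj.measurable.comp hm, C, fun x => by simpa using hC x⟩

variable {E}

theorem IsIntegral.add {b c : ℝ → ℂ} {A B : H →L[ℂ] H} (hA : E.IsIntegral b A)
    (hB : E.IsIntegral c B) (hb : IsBddBorel b) (hc : IsBddBorel c) :
    E.IsIntegral (b + c) (A + B) := by
  intro f
  have := integral_add (hb.integrable (E.measure f)) (hc.integrable (E.measure f))
  simp only [add_apply, inner_add_right, hA f, hB f, Pi.add_apply, this]

theorem IsIntegral.smul {b : ℝ → ℂ} {A : H →L[ℂ] H} (hA : E.IsIntegral b A) (z : ℂ) :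
    E.IsIntegral (z • b) (z • A) := by
  intro f
  simp only [smul_apply, inner_smul_right, hA f, Pi.smul_apply, smul_eq_mul]
  rw [integral_const_mul]

theorem IsIntegral.adjoint {b : ℝ → ℂ} {A : H →L[ℂ] H} (hA : E.IsIntegral b A) :
    E.IsIntegral (fun x => (starRingEnd ℂ) (b x)) A.adjoint := by
  intro f
  rw [ContinuousLinearMap.adjoint_inner_right, ← inner_conj_symm, hA f, ← integral_conj]

variable (E)

theorem isIntegral_indicator {s : Set ℝ} (hs : MeasurableSet s) (z : ℂ) :
    E.IsIntegral (s.indicator fun _ => z) (z • E.proj s) := by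
  intro f
  rw [integral_indicator hs, setIntegral_const, smul_apply, inner_smul_right, E.inner_proj s hs,
    Measure.real, E.measure_apply f s hs, ENNReal.toReal_ofReal (by positivity), Complex.real_smul,
    mul_comm]

theorem isIntegral_const (z : ℂ) : E.IsIntegral (fun _ => z) (z • 1) := by
  have := E.isIntegral_indicator MeasurableSet.univ z
  rwa [indicator_univ, E.proj_univ] at this

/-- Simple functions are dense in bounded Borel functions for bounded pointwise convergence, and
under such convergence the operators converge weakly to the given `A`. The property is therefore
tested on pairs of a symbol and its operator. -/
theorem IsIntegral.induction {P : (ℝ → ℂ) → (H →L[ℂ] H) → Prop}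
    (ind : ∀ s, MeasurableSet s → ∀ z : ℂ, P (s.indicator fun _ => z) (z • E.proj s))
    (add : ∀ b c A B, IsBddBorel b → IsBddBorel c → P b A → P c B → P (b + c) (A + B))
    (lim : ∀ (b : ℕ → ℝ → ℂ) (c : ℝ → ℂ) (A : ℕ → H →L[ℂ] H) (B : H →L[ℂ] H) (C : ℝ),
      (∀ n, Measurable (b n)) → (∀ n x, ‖b n x‖ ≤ C) →
      (∀ x, Tendsto (fun n => b n x) atTop (𝓝 (c x))) →
      (∀ f g, Tendsto (fun n => ⟪g, A n f⟫_ℂ) atTop (𝓝 ⟪g, B f⟫_ℂ)) →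
      (∀ n, P (b n) (A n)) → P c B)
    {b : ℝ → ℂ} {A : H →L[ℂ] H} (hb : IsBddBorel b) (hA : E.IsIntegral b A) : P b A := by
  obtain ⟨hm, C, hC⟩ := hb
  have simple : ∀ s : SimpleFunc ℝ ℂ, IsBddBorel s ∧ ∃ B, E.IsIntegral s B ∧ P s B := by
    intro s
    induction s using SimpleFunc.induction with
    | @const z s hs =>
      have e : ⇑(SimpleFunc.piecewise s hs (SimpleFunc.const ℝ z) (SimpleFunc.const ℝ 0)) =
          s.indicator fun _ => z := by
        ext x
        simp [SimpleFunc.coe_piecewise, Set.piecewise, Set.indicator]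
      rw [e]
      exact ⟨(IsBddBorel.const z).indicator hs, _, E.isIntegral_indicator hs z, ind s hs z⟩
    | @add f g hfg hf hg =>
      obtain ⟨hf, B, hB, hPB⟩ := hf
      obtain ⟨hg, B', hB', hPB'⟩ := hg
      rw [SimpleFunc.coe_add]
      exact ⟨hf.add hg, _, hB.add hB' hf hg, add _ _ _ _ hf hg hPB hPB'⟩
  let s : ℕ → SimpleFunc ℝ ℂ := fun n => SimpleFunc.approxOn b hm univ 0 (mem_univ _) n
  choose B hB hP using fun n => (simple (s n)).2
  have hbd : ∀ n x, ‖s n x‖ ≤ C + C := fun n x =>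
    (SimpleFunc.norm_approxOn_zero_le hm (mem_univ _) x n).trans (add_le_add (hC x) (hC x))
  have hl : ∀ x, Tendsto (fun n => s n x) atTop (𝓝 (b x)) := fun x =>
    SimpleFunc.tendsto_approxOn hm (mem_univ _) (by simp)
  refine lim (fun n => s n) b B A (C + C) (fun n => (s n).measurable) hbd hl ?_ hP
  refine tendsto_inner_of_tendsto_quadratic fun f => ?_
  rw [hA f]
  simp only [fun n => hB n f]
  exact tendsto_integral_of_dominated_convergence (fun _ => C + C)
    (fun n => (s n).aestronglyMeasurable) (integrable_const _)
    (fun n => Eventually.of_forall (hbd n)) (Eventually.of_forall hl)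

variable {E}

/-- The first half of multiplicativity: for indicators it is `proj_inter`. In the limit step the
vectors $E(t)f$ and $f$ differ, so weak convergence is needed and not only convergence of quadratic
forms. -/
theorem IsIntegral.mul_proj {b : ℝ → ℂ} {A : H →L[ℂ] H} (hA : E.IsIntegral b A)
    (hb : IsBddBorel b) {t : Set ℝ} (ht : MeasurableSet t) :
    E.IsIntegral (t.indicator b) (A * E.proj t) := by
  refine IsIntegral.induction E (P := fun b A => E.IsIntegral (t.indicator b) (A * E.proj t))
    ?_ ?_ ?_ hb hA
  · intro s hs z
    rw [indicator_indicator, inter_comm, smul_mul_assoc, ← E.proj_inter s t hs ht]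
    exact E.isIntegral_indicator (hs.inter ht) z
  · intro b c A B hb hc h1 h2
    rw [indicator_add', add_mul]
    exact h1.add h2 (hb.indicator ht) (hc.indicator ht)
  · intro b c A B C hm hC hl hw h f
    refine tendsto_nhds_unique (hw (E.proj t f) f) ?_
    simp only [ContinuousLinearMap.mul_def, IsIntegral, ContinuousLinearMap.comp_apply] at h
    simp only [fun n => h n f]
    refine tendsto_integral_of_dominated_convergence (fun _ => C)
      (fun n => ((hm n).indicator ht).aestronglyMeasurable) (integrable_const _)
      (fun n => Eventually.of_forall fun x => (norm_indicator_le_norm_self _ _).trans (hC n x))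
      (Eventually.of_forall fun x => ?_)
    by_cases hx : x ∈ t
    · simpa [hx] using hl x
    · simp [hx]

/-- The integral with respect to a projection-valued measure is multiplicative. -/
theorem IsIntegral.mul {b c : ℝ → ℂ} {A B : H →L[ℂ] H} (hA : E.IsIntegral b A)
    (hB : E.IsIntegral c B) (hb : IsBddBorel b) (hc : IsBddBorel c) :
    E.IsIntegral (b * c) (A * B) := by
  refine IsIntegral.induction E (P := fun c B => E.IsIntegral (b * c) (A * B))
    ?_ ?_ ?_ hc hB
  · intro s hs z
    have := (hA.mul_proj hb hs).smul z
    rw [mul_smul_comm]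
    convert this using 1
    ext x
    by_cases hx : x ∈ s <;> simp [hx, mul_comm]
  · intro c d B D hc hd h1 h2
    rw [mul_add, mul_add]
    exact h1.add h2 (hb.mul hc) (hb.mul hd)
  · intro c d B D C hm hC hl hw h f
    -- The adjoint moves the fixed factor `A` to the other vector, so that weak convergence applies
    -- to the varying factor alone.
    rw [ContinuousLinearMap.mul_def, ContinuousLinearMap.comp_apply,
      ← ContinuousLinearMap.adjoint_inner_left]
    refine tendsto_nhds_unique (hw f (A.adjoint f)) ?_
    simp only [ContinuousLinearMap.adjoint_inner_left]
    simp only [ContinuousLinearMap.mul_def, IsIntegral, ContinuousLinearMap.comp_apply] at h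
    simp only [fun n => h n f]
    obtain ⟨hbm, K, hK⟩ := hb
    refine tendsto_integral_of_dominated_convergence (fun _ => K * C)
      (fun n => (hbm.mul (hm n)).aestronglyMeasurable) (integrable_const _)
      (fun n => Eventually.of_forall fun x => ?_)
      (Eventually.of_forall fun x => ?_)
    · rw [Pi.mul_apply, norm_mul]
      exact mul_le_mul (hK x) (hC n x) (norm_nonneg _) ((norm_nonneg _).trans (hK x))
    · exact (hl x).const_mul _

/-- The scalar spectral measure of `A f` for `A = ∫ b dE`. -/
theorem IsIntegral.measure_apply {b : ℝ → ℂ} {A : H →L[ℂ] H} (hA : E.IsIntegral b A)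
    (hb : IsBddBorel b) (f : H) :
    E.measure (A f) = (E.measure f).withDensity fun x => ENNReal.ofReal (‖b x‖ ^ 2) := by
  ext s hs
  -- $\|E(s)Af\|^2=\langle f,A^*E(s)Af\rangle$, and $A^*E(s)A$ is the integral of $\bar
  -- b\,1_s\,b=1_s|b|^2$.
  have h2 := (hA.adjoint.mul ((E.isIntegral_indicator hs 1).mul hA
    ((IsBddBorel.const 1).indicator hs) hb) hb.star (((IsBddBorel.const 1).indicator hs).mul hb)) f
  rw [one_smul, ContinuousLinearMap.mul_def, ContinuousLinearMap.comp_apply,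
    ContinuousLinearMap.adjoint_inner_right, ContinuousLinearMap.mul_def,
    ContinuousLinearMap.comp_apply, E.inner_proj s hs] at h2
  have hint : Integrable (fun x => s.indicator (fun x => ‖b x‖ ^ 2) x) (E.measure f) := by
    obtain ⟨hm, C, hC⟩ := hb
    refine Integrable.of_bound ((hm.norm.pow_const 2).indicator hs).aestronglyMeasurable (C ^ 2)
      (Eventually.of_forall fun x => (norm_indicator_le_norm_self _ _).trans ?_)
    rw [norm_pow, norm_norm]
    exact pow_le_pow_left₀ (norm_nonneg _) (hC x) 2
  have e : ∀ x, ((fun x => (starRingEnd ℂ) (b x)) * ((s.indicator fun _ => (1 : ℂ)) * b)) x =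
      ((s.indicator (fun x => ‖b x‖ ^ 2) x : ℝ) : ℂ) := by
    intro x
    by_cases hx : x ∈ s
    · simp [hx, ← Complex.conj_mul']
    · simp [hx]
  simp only [e] at h2
  rw [integral_complex_ofReal] at h2
  have h3 : ‖E.proj s (A f)‖ ^ 2 = ∫ x, s.indicator (fun x => ‖b x‖ ^ 2) x ∂E.measure f := by
    exact_mod_cast h2
  rw [E.measure_apply _ s hs, h3, withDensity_apply _ hs, ← lintegral_indicator hs,
    ofReal_integral_eq_lintegral_ofReal hint
      (Eventually.of_forall fun x => indicator_nonneg (fun _ _ => by positivity) x)]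
  congr 1
  ext x
  by_cases hx : x ∈ s <;> simp [hx]

end SpectralMeasure

/-! ### Resolvents, self-adjointness and uniqueness of the scalar spectral measures. -/

namespace SpectralMeasure

variable {H : Type*} [NormedAddCommGroup H] [InnerProductSpace ℂ H] [CompleteSpace H]
variable {E : SpectralMeasure H}

/-- The resolvent function `s ↦ (s - z)⁻¹`. -/
def resolventFun (z : ℂ) (s : ℝ) : ℂ := ((s : ℂ) - z)⁻¹

theorem ofReal_sub_ne_zero {z : ℂ} (hz : z.im ≠ 0) (s : ℝ) : (s : ℂ) - z ≠ 0 := by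
  intro h
  apply hz
  have := congrArg Complex.im h
  simpa using this

theorem isBddBorel_resolventFun {z : ℂ} (hz : z.im ≠ 0) : IsBddBorel (resolventFun z) := by
  refine ⟨by unfold resolventFun; fun_prop, |z.im|⁻¹, fun s => ?_⟩
  rw [resolventFun, norm_inv]
  refine inv_anti₀ (abs_pos.2 hz) ?_
  have := Complex.abs_im_le_norm ((s : ℂ) - z)
  simpa using this

theorem ofReal_mul_resolventFun {z : ℂ} (hz : z.im ≠ 0) (s : ℝ) :
    (s : ℂ) * resolventFun z s = 1 + z * resolventFun z s := by
  have := ofReal_sub_ne_zero hz s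
  rw [resolventFun]
  field_simp
  ring

/-- $\|Ah\|^2=\int|s-z|^{-2}\,d\mu_h$ with a strictly positive integrand, so $Ah=0$ forces
$\mu_h=0$, and the total mass of $\mu_h$ is $\|h\|^2$. -/
theorem eq_zero_of_resolvent_apply_eq_zero {z : ℂ} (hz : z.im ≠ 0) {A : H →L[ℂ] H}
    (hA : E.IsIntegral (resolventFun z) A) {h : H} (h0 : A h = 0) : h = 0 := by
  have h1 := hA.measure_apply (isBddBorel_resolventFun hz) h
  have h2 : E.measure (A h) univ = 0 := by
    rw [E.measure_apply _ _ MeasurableSet.univ, h0]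
    simp
  have hmeas : Measurable fun x => ENNReal.ofReal (‖resolventFun z x‖ ^ 2) :=
    ((isBddBorel_resolventFun hz).1.norm.pow_const 2).ennreal_ofReal
  rw [h1, withDensity_apply _ MeasurableSet.univ, Measure.restrict_univ,
    lintegral_eq_zero_iff hmeas] at h2
  have h3 : ∀ᵐ x ∂E.measure h, False := h2.mono fun x hx => by
    have : 0 < ‖resolventFun z x‖ ^ 2 := by
      have := norm_pos_iff.2 (inv_ne_zero (ofReal_sub_ne_zero hz x))
      rw [resolventFun]
      positivity
    simp only [Pi.zero_apply, ENNReal.ofReal_eq_zero] at hx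
    linarith
  have h4 : E.measure h univ = 0 := by
    simpa [ae_iff] using h3
  have h5 := E.measure_real_univ h
  rw [Measure.real, h4] at h5
  simpa using h5.symm

variable {T : H →ₗ.[ℂ] H}

/-- $\mu_{Af}$ has density $|s-z|^{-2}$ with respect to $\mu_f$, and $s/(s-z)=1+z/(s-z)$ is bounded,
so the second moment is finite. -/
theorem IsSpectralMeasureOf.resolvent_mem (hE : E.IsSpectralMeasureOf T) {z : ℂ} (hz : z.im ≠ 0)
    {A : H →L[ℂ] H} (hA : E.IsIntegral (resolventFun z) A) (f : H) : A f ∈ T.domain := by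
  have hb := isBddBorel_resolventFun hz
  have hmeas : Measurable fun x => ENNReal.ofReal (‖resolventFun z x‖ ^ 2) :=
    (hb.1.norm.pow_const 2).ennreal_ofReal
  rw [hE.1, hA.measure_apply hb, integrable_withDensity_iff hmeas (by simp)]
  obtain ⟨hm, C, hC⟩ := (IsBddBorel.const 1).add ((IsBddBorel.const z).mul hb)
  refine Integrable.of_bound ?_ (C ^ 2) (Eventually.of_forall fun x => ?_)
  · exact ((measurable_id.pow_const 2).mul hmeas.ennreal_toReal).aestronglyMeasurable
  · have e : x ^ 2 * (ENNReal.ofReal (‖resolventFun z x‖ ^ 2)).toReal =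
        ‖(1 : ℂ) + z * resolventFun z x‖ ^ 2 := by
      rw [ENNReal.toReal_ofReal (by positivity), ← ofReal_mul_resolventFun hz, norm_mul, mul_pow,
        Complex.norm_real, Real.norm_eq_abs, sq_abs]
    rw [e, norm_pow, norm_norm]
    exact pow_le_pow_left₀ (norm_nonneg _) (hC x) 2

/-- The integral of `(s - z)⁻¹` inverts `T - z`. -/
theorem IsSpectralMeasureOf.apply_resolvent (hE : E.IsSpectralMeasureOf T) {z : ℂ} (hz : z.im ≠ 0)
    {A : H →L[ℂ] H} (hA : E.IsIntegral (resolventFun z) A) (f : H) :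
    T ⟨A f, hE.resolvent_mem hz hA f⟩ = f + z • A f := by
  have hb := isBddBorel_resolventFun hz
  have hmeas : Measurable fun x => ENNReal.ofReal (‖resolventFun z x‖ ^ 2) :=
    (hb.1.norm.pow_const 2).ennreal_ofReal
  have hB : E.IsIntegral ((fun _ => 1) + z • resolventFun z) ((1 : ℂ) • 1 + z • A) :=
    (E.isIntegral_const 1).add (hA.smul z) (IsBddBorel.const 1) ((IsBddBorel.const z).mul hb)
  have hAB := hA.adjoint.mul hB hb.star
    ((IsBddBorel.const 1).add ((IsBddBorel.const z).mul hb))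
  let R : H →ₗ[ℂ] T.domain := (A : H →ₗ[ℂ] H).codRestrict T.domain (hE.resolvent_mem hz hA)
  let L : H →ₗ[ℂ] H := (A.adjoint : H →ₗ[ℂ] H) ∘ₗ T.toFun ∘ₗ R
  -- Only the quadratic form of $T$ is known, so it is sandwiched: the forms of $A^*TA$ and
  -- $A^*(1+zA)$ agree, hence the operators agree. The factor $A^*$ is then cancelled, since it is
  -- the resolvent integral at $\bar z$ and therefore injective.
  have hL : L = ((A.adjoint * ((1 : ℂ) • 1 + z • A) : H →L[ℂ] H) : H →ₗ[ℂ] H) := by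
    rw [← ext_inner_map]
    intro g
    rw [← inner_conj_symm, ← inner_conj_symm (_ : H) g]
    congr 1
    have e1 : ⟪g, L g⟫_ℂ = ⟪A g, T ⟨A g, hE.resolvent_mem hz hA g⟩⟫_ℂ :=
      ContinuousLinearMap.adjoint_inner_right A g _
    have e2 := hE.2 ⟨A g, hE.resolvent_mem hz hA g⟩
    rw [ContinuousLinearMap.coe_coe, e1, e2, hAB g, hA.measure_apply hb,
      integral_withDensity_eq_integral_toReal_smul hmeas (by simp)]
    refine integral_congr_ae (Eventually.of_forall fun x => ?_)
    simp only [Pi.mul_apply, Pi.add_apply, Pi.smul_apply, smul_eq_mul]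
    rw [ENNReal.toReal_ofReal (by positivity), ← ofReal_mul_resolventFun hz, Complex.real_smul,
      Complex.ofReal_pow, ← Complex.conj_mul']
    ring
  have h1 : A.adjoint (T ⟨A f, hE.resolvent_mem hz hA f⟩) = A.adjoint (f + z • A f) := by
    refine (congrArg (fun S : H →ₗ[ℂ] H => S f) hL).trans ?_
    simp
  have hA' : E.IsIntegral (resolventFun ((starRingEnd ℂ) z)) A.adjoint := by
    convert hA.adjoint using 1
    ext s
    simp [resolventFun]
  have h2 := eq_zero_of_resolvent_apply_eq_zero (by simpa using hz) hA'
    (h := T ⟨A f, hE.resolvent_mem hz hA f⟩ - (f + z • A f)) (by rw [map_sub, h1, sub_self])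
  exact sub_eq_zero.1 h2

theorem exists_isIntegral_resolventFun (E : SpectralMeasure H) {z : ℂ} (hz : z.im ≠ 0) :
    ∃ A, E.IsIntegral (resolventFun z) A := by
  obtain ⟨hm, C, hC⟩ := isBddBorel_resolventFun hz
  exact E.exists_isIntegral _ hm C hC

/-- The range of the resolvent integral lies in the domain, and a vector orthogonal to that range is
in the kernel of its adjoint, which is again an injective resolvent integral. -/
theorem IsSpectralMeasureOf.dense_domain (hE : E.IsSpectralMeasureOf T) :
    Dense (T.domain : Set H) := by
  obtain ⟨A, hA⟩ := E.exists_isIntegral_resolventFun (z := Complex.I) (by simp)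
  rw [Submodule.dense_iff_topologicalClosure_eq_top, Submodule.topologicalClosure_eq_top_iff,
    Submodule.eq_bot_iff]
  intro h hh
  have hA' : E.IsIntegral (resolventFun ((starRingEnd ℂ) Complex.I)) A.adjoint := by
    convert hA.adjoint using 1
    ext s
    simp [resolventFun]
  refine eq_zero_of_resolvent_apply_eq_zero (by simp) hA' ?_
  refine ext_inner_left ℂ fun v => ?_
  rw [ContinuousLinearMap.adjoint_inner_right, inner_zero_right]
  exact hh _ (hE.resolvent_mem (by simp) hA v)

/-- The quadratic form is the integral of a real function, hence real; polarization with `f + g` and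
`f + I • g` gives symmetry. -/
theorem IsSpectralMeasureOf.symm (hE : E.IsSpectralMeasureOf T) : T.IsFormalAdjoint T := by
  have hreal : ∀ f : T.domain, ⟪T f, (f : H)⟫_ℂ = ⟪(f : H), T f⟫_ℂ := fun f => by
    rw [← inner_conj_symm, hE.2 f, ← integral_conj]
    simp
  intro f g
  have h1 := hreal (f + g)
  have h2 := hreal (f + Complex.I • g)
  have hf := hreal f
  have hg := hreal g
  simp only [T.map_add, T.map_smul, Submodule.coe_add, Submodule.coe_smul,
    inner_add_left, inner_add_right, inner_smul_left, inner_smul_right, Complex.conj_I] at h1 h2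
  have hI := Complex.I_mul_I
  have e : 2 * Complex.I * (⟪T f, (g : H)⟫_ℂ - ⟪(f : H), T g⟫_ℂ) = 0 := by
    linear_combination Complex.I * h1 + h2 - (Complex.I + 1) * hf - (Complex.I + 1) * hg +
      (⟪T g, (g : H)⟫_ℂ - ⟪(g : H), T g⟫_ℂ) * hI
  have h3 := (mul_eq_zero.1 e).resolve_left (by simp)
  exact sub_eq_zero.1 h3

theorem IsSpectralMeasureOf.exists_sub_smul_eq (hE : E.IsSpectralMeasureOf T) {z : ℂ}
    (hz : z.im ≠ 0) (h : H) : ∃ f : T.domain, T f - z • (f : H) = h := by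
  obtain ⟨A, hA⟩ := E.exists_isIntegral_resolventFun hz
  exact ⟨⟨A h, hE.resolvent_mem hz hA h⟩, by rw [hE.apply_resolvent hz hA, add_sub_cancel_right]⟩

/-- An operator with a spectral measure is self-adjoint. -/
theorem IsSpectralMeasureOf.isSelfAdjoint (hE : E.IsSpectralMeasureOf T) : IsSelfAdjoint T := by
  rw [LinearPMap.isSelfAdjoint_def]
  have hd := hE.dense_domain
  have hle : T ≤ T.adjoint := hE.symm.le_adjoint hd
  refine (LinearPMap.eq_of_le_of_domain_eq hle (le_antisymm hle.1 fun y hy => ?_)).symm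
  -- With $(T-i)x=(T^*-i)y$, the difference $y-x$ is orthogonal to the range of $T+i$, which is the
  -- whole space; hence $y=x$ is in the domain of $T$.
  obtain ⟨x, hx⟩ := hE.exists_sub_smul_eq (z := Complex.I) (by simp)
    (T.adjoint ⟨y, hy⟩ - Complex.I • y)
  obtain ⟨w, hw⟩ := hE.exists_sub_smul_eq (z := -Complex.I) (by simp) (y - x)
  have h1 := LinearPMap.adjoint_isFormalAdjoint hd ⟨y, hy⟩ w
  have h2 := hE.symm x w
  have h3 : ⟪y - x, y - x⟫_ℂ = 0 := by
    nth_rewrite 2 [← hw]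
    have e : T.adjoint ⟨y, hy⟩ = (T x - Complex.I • (x : H)) + Complex.I • y := by
      rw [hx]; simp
    rw [e] at h1
    simp only [inner_sub_left, inner_sub_right, inner_add_left, inner_smul_left, inner_smul_right,
      Complex.conj_I, neg_mul, neg_smul, inner_neg_right] at h1 h2 ⊢
    linear_combination h2 - h1
  have h4 : y - x = 0 := by simpa using h3
  rw [sub_eq_zero.1 h4]
  exact x.2

/-- Two spectral measures of the same operator have the same scalar spectral measures. -/
theorem IsSpectralMeasureOf.measure_eq {E' : SpectralMeasure H} (hE : E.IsSpectralMeasureOf T)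
    (hE' : E'.IsSpectralMeasureOf T) (f : H) : E.measure f = E'.measure f := by
  have hI : Complex.I.im ≠ 0 := by simp
  obtain ⟨A, hA⟩ := E.exists_isIntegral_resolventFun hI
  obtain ⟨A', hA'⟩ := E'.exists_isIntegral_resolventFun hI
  -- Both $Ag$ and $A'g$ solve $(T-i)v=g$; by symmetry their difference is orthogonal to the range
  -- of $T+i$, that is, to everything.
  have hAA : A = A' := by
    ext g
    have h1 := hE.apply_resolvent hI hA g
    have h2 := hE'.apply_resolvent hI hA' g
    obtain ⟨w, hw⟩ := hE.exists_sub_smul_eq (z := -Complex.I) (by simp) (A g - A' g)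
    have s1 := hE.symm ⟨A g, hE.resolvent_mem hI hA g⟩ w
    have s2 := hE.symm ⟨A' g, hE'.resolvent_mem hI hA' g⟩ w
    rw [h1] at s1
    rw [h2] at s2
    have h3 : ⟪A g - A' g, A g - A' g⟫_ℂ = 0 := by
      nth_rewrite 2 [← hw]
      simp only [inner_sub_left, inner_sub_right, inner_add_left, inner_smul_left,
        inner_smul_right, Complex.conj_I, neg_mul, neg_smul, inner_neg_right] at s1 s2 ⊢
      linear_combination s2 - s1
    exact sub_eq_zero.1 (by simpa using h3)
  rw [← hAA] at hA'
  have hb := isBddBorel_resolventFun hI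
  have hcont : Continuous (resolventFun Complex.I) := by
    unfold resolventFun
    exact (by fun_prop : Continuous fun s : ℝ => (s : ℂ) - Complex.I).inv₀
      (ofReal_sub_ne_zero hI)
  obtain ⟨C, hC⟩ := hb.2
  let r : BoundedContinuousFunction ℝ ℂ :=
    BoundedContinuousFunction.ofNormedAddCommGroup (resolventFun Complex.I) hcont C hC
  have hbdd : ∀ g : BoundedContinuousFunction ℝ ℂ, IsBddBorel g := fun g =>
    ⟨g.continuous.measurable, ‖g‖, g.norm_coe_le_norm⟩
  -- The star algebra contains the constants and separates points because $s\mapsto(s-i)^{-1}$ is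
  -- injective; the integrals of its elements determine a finite measure on a Polish space.
  have key : ∀ g ∈ StarAlgebra.adjoin ℂ {r}, ∃ B, E.IsIntegral g B ∧ E'.IsIntegral g B := by
    intro g hg
    induction hg using StarAlgebra.adjoin_induction with
    | mem x hx =>
      rw [Set.mem_singleton_iff] at hx
      subst hx
      exact ⟨A, hA, hA'⟩
    | algebraMap z =>
      exact ⟨z • 1, E.isIntegral_const z, E'.isIntegral_const z⟩
    | add x y hx hy h1 h2 =>
      obtain ⟨B, hB, hB'⟩ := h1
      obtain ⟨D, hD, hD'⟩ := h2
      exact ⟨B + D, hB.add hD (hbdd x) (hbdd y), hB'.add hD' (hbdd x) (hbdd y)⟩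
    | mul x y hx hy h1 h2 =>
      obtain ⟨B, hB, hB'⟩ := h1
      obtain ⟨D, hD, hD'⟩ := h2
      exact ⟨B * D, hB.mul hD (hbdd x) (hbdd y), hB'.mul hD' (hbdd x) (hbdd y)⟩
    | star x hx h1 =>
      obtain ⟨B, hB, hB'⟩ := h1
      exact ⟨B.adjoint, hB.adjoint, hB'.adjoint⟩
  refine ext_of_forall_mem_subalgebra_integral_eq_of_polish (𝕜 := ℂ)
    (A := StarAlgebra.adjoin ℂ {r}) ?_ fun g hg => ?_
  · intro x y hxy
    refine ⟨r, ⟨BoundedContinuousFunction.toContinuousMapStarₐ ℂ r,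
      ⟨r, StarAlgebra.subset_adjoin ℂ {r} rfl, rfl⟩, rfl⟩, ?_⟩
    intro h
    apply hxy
    have h' : resolventFun Complex.I x = resolventFun Complex.I y := h
    rw [resolventFun, resolventFun, inv_inj, sub_left_inj] at h'
    exact_mod_cast h'
  · obtain ⟨B, hB, hB'⟩ := key g hg
    rw [← hB f, ← hB' f]

end SpectralMeasure

/-! ### Multiplication operators and their spectral measures. -/

section Multiplication

open SpectralMeasure

variable {F : Type*} [NormedAddCommGroup F] [InnerProductSpace ℂ F]

theorem SpectralMeasure.IsBddBorel.memLp_smul {m : ℝ → ℂ} (hm : IsBddBorel m) {f : ℝ → F}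
    (hf : MemLp f 2) : MemLp (fun x => m x • f x) 2 := by
  obtain ⟨hmm, C, hC⟩ := hm
  refine MemLp.of_le_mul (c := C) hf (hmm.aestronglyMeasurable.smul hf.1)
    (Eventually.of_forall fun x => ?_)
  rw [norm_smul]
  exact mul_le_mul_of_nonneg_right (hC x) (norm_nonneg _)

/-- Multiplication by a bounded Borel function on `L²(ℝ; F)`. -/
def mulOp (m : ℝ → ℂ) (hm : IsBddBorel m) :
    Lp F 2 (volume : Measure ℝ) →L[ℂ] Lp F 2 (volume : Measure ℝ) :=
  LinearMap.mkContinuousOfExistsBound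
    { toFun := fun f => (hm.memLp_smul (Lp.memLp f)).toLp
      map_add' := fun f g => by
        rw [← MemLp.toLp_add, MemLp.toLp_eq_toLp_iff]
        filter_upwards [Lp.coeFn_add f g] with x hx
        simp only [Pi.add_apply, hx, smul_add]
      map_smul' := fun c f => by
        rw [RingHom.id_apply, ← MemLp.toLp_const_smul, MemLp.toLp_eq_toLp_iff]
        filter_upwards [Lp.coeFn_smul c f] with x hx
        simp only [Pi.smul_apply, hx, smul_comm c] }
    (by
      obtain ⟨hmm, C, hC⟩ := id hm
      refine ⟨C, fun f => Lp.norm_le_mul_norm_of_ae_le_mul ?_⟩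
      filter_upwards [(hm.memLp_smul (Lp.memLp f)).coeFn_toLp] with x hx
      simp only [LinearMap.coe_mk, AddHom.coe_mk, hx, norm_smul]
      exact mul_le_mul_of_nonneg_right (hC x) (norm_nonneg _))

theorem coeFn_mulOp {m : ℝ → ℂ} (hm : IsBddBorel m) (f : Lp F 2 (volume : Measure ℝ)) :
    mulOp m hm f =ᵐ[volume] fun x => m x • f x :=
  (hm.memLp_smul (Lp.memLp f)).coeFn_toLp

theorem norm_sq_eq_integral (f : Lp F 2 (volume : Measure ℝ)) : ‖f‖ ^ 2 = ∫ x, ‖f x‖ ^ 2 := by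
  have h := L2.inner_def (𝕜 := ℂ) f f
  simp only [inner_self_eq_norm_sq_to_K] at h
  have : ((‖f‖ ^ 2 : ℝ) : ℂ) = ((∫ x, ‖f x‖ ^ 2 : ℝ) : ℂ) := by
    rw [← integral_complex_ofReal]
    simpa using h
  exact_mod_cast this

theorem integrable_norm_sq (f : Lp F 2 (volume : Measure ℝ)) : Integrable fun x => ‖f x‖ ^ 2 :=
  (Lp.memLp f).integrable_norm_pow (by simp)

theorem mulOp_mulOp {m m' : ℝ → ℂ} (hm : IsBddBorel m) (hm' : IsBddBorel m')
    (f : Lp F 2 (volume : Measure ℝ)) : mulOp m hm (mulOp m' hm' f) = mulOp _ (hm.mul hm') f := by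
  apply Lp.ext
  filter_upwards [coeFn_mulOp hm (mulOp m' hm' f), coeFn_mulOp hm' f,
    coeFn_mulOp (hm.mul hm') f] with x h1 h2 h3
  rw [h1, h2, h3, smul_smul, Pi.mul_apply]

theorem mulOp_congr {m m' : ℝ → ℂ} (hm : IsBddBorel m) (hm' : IsBddBorel m')
    (h : m =ᵐ[volume] m') :
    (mulOp m hm : Lp F 2 (volume : Measure ℝ) →L[ℂ] _) = mulOp m' hm' := by
  ext1 f
  apply Lp.ext
  filter_upwards [coeFn_mulOp hm f, coeFn_mulOp hm' f, h] with x h1 h2 h3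
  rw [h1, h2, h3]

theorem inner_mulOp_left {m : ℝ → ℂ} (hm : IsBddBorel m) (f g : Lp F 2 (volume : Measure ℝ)) :
    ⟪mulOp m hm f, g⟫_ℂ = ⟪f, mulOp _ hm.star g⟫_ℂ := by
  rw [L2.inner_def, L2.inner_def]
  refine integral_congr_ae ?_
  filter_upwards [coeFn_mulOp hm f, coeFn_mulOp hm.star g] with x h1 h2
  rw [h1, h2, inner_smul_left, inner_smul_right]

theorem inner_mulOp_self {m : ℝ → ℂ} (hm : IsBddBorel m) (f : Lp F 2 (volume : Measure ℝ)) :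
    ⟪f, mulOp m hm f⟫_ℂ = ∫ x, m x * ((‖f x‖ ^ 2 : ℝ) : ℂ) := by
  rw [L2.inner_def]
  refine integral_congr_ae ?_
  filter_upwards [coeFn_mulOp hm f] with x h1
  rw [h1, inner_smul_right, inner_self_eq_norm_sq_to_K]
  simp

theorem isBddBorel_indicator_one {s : Set ℝ} (hs : MeasurableSet s) :
    IsBddBorel (s.indicator fun _ => 1) :=
  (IsBddBorel.const 1).indicator hs

theorem norm_sq_mulOp_indicator {s : Set ℝ} (hs : MeasurableSet s)
    (f : Lp F 2 (volume : Measure ℝ)) :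
    ‖mulOp _ (isBddBorel_indicator_one hs) f‖ ^ 2 = ∫ x in s, ‖f x‖ ^ 2 := by
  rw [norm_sq_eq_integral, ← integral_indicator hs]
  refine integral_congr_ae ?_
  filter_upwards [coeFn_mulOp (isBddBorel_indicator_one hs) f] with x h1
  rw [h1]
  by_cases hx : x ∈ s <;> simp [hx]

theorem mulOp_indicator_union {s t : Set ℝ} (hs : MeasurableSet s) (ht : MeasurableSet t)
    (hst : Disjoint s t) (f : Lp F 2 (volume : Measure ℝ)) :
    mulOp _ (isBddBorel_indicator_one (hs.union ht)) f =
      mulOp _ (isBddBorel_indicator_one hs) f + mulOp _ (isBddBorel_indicator_one ht) f := by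
  apply Lp.ext
  filter_upwards [coeFn_mulOp (isBddBorel_indicator_one (hs.union ht)) f,
    coeFn_mulOp (isBddBorel_indicator_one hs) f, coeFn_mulOp (isBddBorel_indicator_one ht) f,
    Lp.coeFn_add (mulOp _ (isBddBorel_indicator_one hs) f)
      (mulOp _ (isBddBorel_indicator_one ht) f)] with x h1 h2 h3 h4
  rw [h1, h4, Pi.add_apply, h2, h3, ← add_smul, indicator_union_of_disjoint hst]

theorem sum_mulOp_indicator {s : ℕ → Set ℝ} (hs : ∀ n, MeasurableSet (s n))
    (hd : Pairwise (Function.onFun Disjoint s)) (f : Lp F 2 (volume : Measure ℝ))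
    (t : Finset ℕ) :
    ∑ n ∈ t, mulOp _ (isBddBorel_indicator_one (hs n)) f =
      mulOp _ (isBddBorel_indicator_one (t.measurableSet_biUnion fun n _ => hs n)) f := by
  induction t using Finset.induction_on with
  | empty =>
    symm
    apply Lp.ext
    filter_upwards [coeFn_mulOp (isBddBorel_indicator_one
      ((∅ : Finset ℕ).measurableSet_biUnion fun n _ => hs n)) f,
      Lp.coeFn_zero F 2 (volume : Measure ℝ)] with x h1 h2
    rw [h1, Finset.sum_empty, h2]
    simp
  | insert a t ha ih =>
    rw [Finset.sum_insert ha, ih, ← mulOp_indicator_union]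
    · congr 2
      simp
    · exact hs a
    · exact t.measurableSet_biUnion fun n _ => hs n
    · rw [Set.disjoint_iUnion₂_right]
      intro n hn
      exact hd fun h => ha (h ▸ hn)

/-- The squared norm of the remainder after finitely many terms is the integral of $\|f\|^2$ over
the part not yet covered, so strong convergence reduces to countable additivity of that integral. -/
theorem hasSum_mulOp_indicator {s : ℕ → Set ℝ} (hs : ∀ n, MeasurableSet (s n))
    (hd : Pairwise (Function.onFun Disjoint s)) (f : Lp F 2 (volume : Measure ℝ)) :
    HasSum (fun n => mulOp _ (isBddBorel_indicator_one (hs n)) f)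
      (mulOp _ (isBddBorel_indicator_one (MeasurableSet.iUnion hs)) f) := by
  have h1 : HasSum (fun n => ∫ x in s n, ‖f x‖ ^ 2) (∫ x in ⋃ n, s n, ‖f x‖ ^ 2) :=
    hasSum_integral_iUnion hs hd (integrable_norm_sq f).integrableOn
  have h2 : ∀ t : Finset ℕ, ‖∑ n ∈ t, mulOp _ (isBddBorel_indicator_one (hs n)) f -
      mulOp _ (isBddBorel_indicator_one (MeasurableSet.iUnion hs)) f‖ =
      √((∫ x in ⋃ n, s n, ‖f x‖ ^ 2) - ∑ n ∈ t, ∫ x in s n, ‖f x‖ ^ 2) := by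
    intro t
    have ht := t.measurableSet_biUnion fun n _ => hs n
    have hsub : (⋃ n ∈ t, s n) ⊆ ⋃ n, s n := iUnion₂_subset fun n _ => subset_iUnion s n
    have h3 := mulOp_indicator_union ht ((MeasurableSet.iUnion hs).diff ht)
      disjoint_sdiff_right f
    simp only [union_sdiff_cancel hsub] at h3
    rw [sum_mulOp_indicator hs hd, h3, sub_add_cancel_left, norm_neg, eq_comm,
      Real.sqrt_eq_iff_eq_sq _ (norm_nonneg _), norm_sq_mulOp_indicator,
      setIntegral_sdiff ht (integrable_norm_sq f).integrableOn hsub,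
      integral_biUnion_finset t (fun n _ => hs n) (fun i _ j _ hij => hd hij)
        (fun n _ => (integrable_norm_sq f).integrableOn)]
    · exact (MeasurableSet.iUnion hs).diff ht
    · rw [sub_nonneg]
      exact sum_le_hasSum t (fun n _ => integral_nonneg fun x => by positivity) h1
  rw [HasSum, tendsto_iff_norm_sub_tendsto_zero]
  simp only [SummationFilter.unconditional_filter, h2]
  have := (tendsto_const_nhds (x := ∫ x in ⋃ n, s n, ‖f x‖ ^ 2)).sub h1
  rw [sub_self] at this
  simpa [Function.comp_def] using (Real.continuous_sqrt.tendsto 0).comp this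

variable {H : Type*} [NormedAddCommGroup H] [InnerProductSpace ℂ H] [CompleteSpace H]
variable [CompleteSpace F]

/-- The operator on `H` which becomes multiplication by `m` under `W`. -/
def conjMulOp (W : H ≃ₗᵢ[ℂ] Lp F 2 (volume : Measure ℝ)) (m : ℝ → ℂ) (hm : IsBddBorel m) :
    H →L[ℂ] H :=
  (W.symm.toContinuousLinearEquiv : Lp F 2 (volume : Measure ℝ) →L[ℂ] H) ∘L mulOp m hm ∘L
    (W.toContinuousLinearEquiv : H →L[ℂ] Lp F 2 (volume : Measure ℝ))

theorem conjMulOp_apply (W : H ≃ₗᵢ[ℂ] Lp F 2 (volume : Measure ℝ)) {m : ℝ → ℂ}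
    (hm : IsBddBorel m) (f : H) : conjMulOp W m hm f = W.symm (mulOp m hm (W f)) := rfl

theorem inner_conjMulOp_self (W : H ≃ₗᵢ[ℂ] Lp F 2 (volume : Measure ℝ)) {m : ℝ → ℂ}
    (hm : IsBddBorel m) (f : H) :
    ⟪f, conjMulOp W m hm f⟫_ℂ = ∫ x, m x * ((‖W f x‖ ^ 2 : ℝ) : ℂ) := by
  rw [conjMulOp_apply, ← W.inner_map_map, W.apply_symm_apply, inner_mulOp_self]

open Classical in
/-- The spectral measure of the operator which becomes multiplication by `φ` under `W`. -/
def mulSpectralMeasure (W : H ≃ₗᵢ[ℂ] Lp F 2 (volume : Measure ℝ)) (φ : ℝ → ℝ)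
    (hφ : Measurable φ) : SpectralMeasure H where
  proj s := if hs : MeasurableSet s then
    conjMulOp W _ (isBddBorel_indicator_one (hφ hs)) else 0
  isStarProjection s hs := by
    rw [dif_pos hs]
    constructor
    · ext f
      rw [ContinuousLinearMap.mul_def, ContinuousLinearMap.comp_apply, conjMulOp_apply,
        conjMulOp_apply, W.apply_symm_apply, mulOp_mulOp]
      congr 2
      rw [mulOp_congr]
      refine Eventually.of_forall fun x => ?_
      by_cases hx : x ∈ φ ⁻¹' s <;> simp [hx]
    · rw [ContinuousLinearMap.isSelfAdjoint_iff_isSymmetric]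
      intro f g
      simp only [ContinuousLinearMap.coe_coe, conjMulOp_apply]
      rw [← W.inner_map_map, W.apply_symm_apply, inner_mulOp_left, ← W.inner_map_map f,
        W.apply_symm_apply]
      congr 2
      rw [mulOp_congr]
      refine Eventually.of_forall fun x => ?_
      by_cases hx : x ∈ φ ⁻¹' s <;> simp [hx]
  proj_univ := by
    rw [dif_pos MeasurableSet.univ]
    ext f
    rw [conjMulOp_apply, one_apply_eq_self, W.symm_apply_eq]
    apply Lp.ext
    filter_upwards [coeFn_mulOp (isBddBorel_indicator_one (hφ MeasurableSet.univ)) (W f)] with x hx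
    rw [hx]
    simp
  proj_inter s t hs ht := by
    rw [dif_pos hs, dif_pos ht, dif_pos (hs.inter ht)]
    ext f
    rw [ContinuousLinearMap.mul_def, ContinuousLinearMap.comp_apply, conjMulOp_apply,
      conjMulOp_apply, conjMulOp_apply, W.apply_symm_apply, mulOp_mulOp]
    congr 2
    rw [mulOp_congr]
    refine Eventually.of_forall fun x => ?_
    by_cases hx : φ x ∈ s <;> by_cases hx' : φ x ∈ t <;> simp [hx, hx', indicator]
  hasSum_proj s hs hd f := by
    simp only [dif_pos (hs _), dif_pos (MeasurableSet.iUnion hs)]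
    have h := (hasSum_mulOp_indicator (fun n => hφ (hs n))
      (fun i j hij => (hd hij).preimage φ) (W f)).mapL
      (W.symm.toContinuousLinearEquiv : Lp F 2 (volume : Measure ℝ) →L[ℂ] H)
    simp only [← preimage_iUnion] at h
    exact h

theorem mulSpectralMeasure_measure (W : H ≃ₗᵢ[ℂ] Lp F 2 (volume : Measure ℝ)) {φ : ℝ → ℝ}
    (hφ : Measurable φ) (f : H) :
    (mulSpectralMeasure W φ hφ).measure f =
      (volume.withDensity fun x => ENNReal.ofReal (‖W f x‖ ^ 2)).map φ := by
  ext s hs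
  rw [measure_apply _ _ _ hs, Measure.map_apply hφ hs, withDensity_apply _ (hφ hs)]
  have : (mulSpectralMeasure W φ hφ).proj s = conjMulOp W _ (isBddBorel_indicator_one (hφ hs)) :=
    dif_pos hs
  rw [this, conjMulOp_apply, W.symm.norm_map, norm_sq_mulOp_indicator,
    ofReal_integral_eq_lintegral_ofReal (integrable_norm_sq (W f)).integrableOn
      (Eventually.of_forall fun x => by positivity)]
  exact hφ hs

theorem aemeasurable_ofReal_norm_sq (f : Lp F 2 (volume : Measure ℝ)) :
    AEMeasurable fun x => ENNReal.ofReal (‖f x‖ ^ 2) :=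
  ((Lp.aestronglyMeasurable f).norm.aemeasurable.pow_const 2).ennreal_ofReal

theorem integral_mulSpectralMeasure (W : H ≃ₗᵢ[ℂ] Lp F 2 (volume : Measure ℝ)) {φ : ℝ → ℝ}
    (hφ : Measurable φ) (f : H) {b : ℝ → ℂ} (hb : Measurable b) :
    ∫ x, b x ∂(mulSpectralMeasure W φ hφ).measure f =
      ∫ x, b (φ x) * ((‖W f x‖ ^ 2 : ℝ) : ℂ) := by
  rw [mulSpectralMeasure_measure, integral_map hφ.aemeasurable hb.aestronglyMeasurable,
    integral_withDensity_eq_integral_toReal_smul₀ (aemeasurable_ofReal_norm_sq _) (by simp)]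
  refine integral_congr_ae (Eventually.of_forall fun x => ?_)
  simp only
  rw [ENNReal.toReal_ofReal (by positivity), Complex.real_smul, mul_comm]

theorem integrable_mulSpectralMeasure_iff (W : H ≃ₗᵢ[ℂ] Lp F 2 (volume : Measure ℝ)) {φ : ℝ → ℝ}
    (hφ : Measurable φ) (f : H) {b : ℝ → ℝ} (hb : Measurable b) :
    Integrable b ((mulSpectralMeasure W φ hφ).measure f) ↔
      Integrable fun x => b (φ x) * ‖W f x‖ ^ 2 := by
  rw [mulSpectralMeasure_measure, integrable_map_measure hb.aestronglyMeasurable hφ.aemeasurable,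
    integrable_withDensity_iff_integrable_smul₀' (aemeasurable_ofReal_norm_sq _) (by simp)]
  refine integrable_congr (Eventually.of_forall fun x => ?_)
  simp only [Function.comp_apply, smul_eq_mul]
  rw [ENNReal.toReal_ofReal (by positivity), mul_comm]

theorem mulSpectralMeasure_isIntegral (W : H ≃ₗᵢ[ℂ] Lp F 2 (volume : Measure ℝ)) {φ : ℝ → ℝ}
    (hφ : Measurable φ) {b : ℝ → ℂ} (hb : Measurable b) (hm : IsBddBorel fun x => b (φ x)) :
    (mulSpectralMeasure W φ hφ).IsIntegral b (conjMulOp W _ hm) := by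
  intro f
  rw [inner_conjMulOp_self, integral_mulSpectralMeasure W hφ f hb]

end Multiplication

/-! ### Fourier multipliers on $L^2$ as convolutions. -/

section FourierL2

open SpectralMeasure SchwartzMap FourierTransform

variable {F : Type*} [NormedAddCommGroup F] [InnerProductSpace ℂ F]

theorem integrable_smul_of_memLp_two {f : ℝ → ℂ} {g : ℝ → F} (hf : MemLp f 2) (hg : MemLp g 2) :
    Integrable fun x => f x • g x :=
  memLp_one_iff_integrable.1 (MemLp.smul (r := 1) hg hf)

variable [CompleteSpace F]

/-- The $L^2$ transform agrees with the distributional one, which is defined by this duality. -/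
theorem integral_fourier_schwartz_smul (ψ : 𝓢(ℝ, ℂ)) (h : Lp F 2 (volume : Measure ℝ)) :
    ∫ x, (𝓕 ψ) x • h x = ∫ x, ψ x • (𝓕 h : Lp F 2 (volume : Measure ℝ)) x := by
  have e := congrArg (fun T => T ψ) (Lp.fourier_toTemperedDistribution_eq h)
  simpa [TemperedDistribution.fourier_apply] using e

theorem integral_fourierInv_schwartz_smul (ψ : 𝓢(ℝ, ℂ)) (h : Lp F 2 (volume : Measure ℝ)) :
    ∫ x, (𝓕⁻ ψ) x • h x = ∫ x, ψ x • (𝓕⁻ h : Lp F 2 (volume : Measure ℝ)) x := by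
  have e := congrArg (fun T => T ψ) (Lp.fourierInv_toTemperedDistribution_eq h)
  simpa [TemperedDistribution.fourierInv_apply] using e

/-- Both sides are continuous in `ψ`, so density of Schwartz functions suffices. The extension is
needed because the symbols used below are not smooth. -/
theorem integral_fourierInv_smul (ψ : Lp ℂ 2 (volume : Measure ℝ))
    (h : Lp F 2 (volume : Measure ℝ)) :
    ∫ x, (𝓕⁻ ψ : Lp ℂ 2 (volume : Measure ℝ)) x • h x =
      ∫ x, ψ x • (𝓕⁻ h : Lp F 2 (volume : Measure ℝ)) x := by
  let B := (ContinuousLinearMap.lsmul ℂ ℂ : ℂ →L[ℂ] F →L[ℂ] F).lpPairing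
    (volume : Measure ℝ) 2 2
  have hB : ∀ ψ h, B ψ h = ∫ x, ψ x • h x := fun ψ h => by
    simp [B, ContinuousLinearMap.lpPairing_eq_integral]
  rw [← hB, ← hB]
  refine DenseRange.induction_on (p := fun ψ => B (𝓕⁻ ψ) h = B ψ (𝓕⁻ h))
    (SchwartzMap.denseRange_toLpCLM (E := ℝ) (F := ℂ) (μ := volume) (p := 2)
      ENNReal.ofNat_ne_top) ψ ?_ fun φ => ?_
  · refine isClosed_eq ?_ ?_
    · exact (B.flip h).continuous.comp (Lp.fourierTransformₗᵢ ℝ ℂ).symm.continuous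
    · exact (B.flip (𝓕⁻ h)).continuous
  · rw [SchwartzMap.toLpCLM_apply, SchwartzMap.toLp_fourierInv_eq, hB, hB]
    have := integral_fourierInv_schwartz_smul φ h
    rw [integral_congr_ae (g := fun x => (𝓕⁻ φ) x • h x), this]
    · refine integral_congr_ae ?_
      filter_upwards [φ.coeFn_toLp 2 (volume : Measure ℝ)] with x hx
      rw [hx]
    · filter_upwards [(𝓕⁻ φ).coeFn_toLp 2 (volume : Measure ℝ)] with x hx
      rw [hx]

/-- A compactly supported smooth real function as a complex Schwartz function. -/
def testToSchwartz (φ : ℝ → ℝ) (hφ : ContDiff ℝ ∞ φ) (hc : HasCompactSupport φ) : 𝓢(ℝ, ℂ) :=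
  (hc.comp_left (g := fun x : ℝ => (x : ℂ)) (by simp)).toSchwartzMap
    (Complex.ofRealCLM.contDiff.comp hφ)

theorem testToSchwartz_apply (φ : ℝ → ℝ) (hφ : ContDiff ℝ ∞ φ) (hc : HasCompactSupport φ) (x : ℝ) :
    testToSchwartz φ hφ hc x = (φ x : ℂ) := rfl

theorem continuous_fourier_of_integrable {u : ℝ → F} (hu : Integrable u) : Continuous (𝓕 u) :=
  VectorFourier.fourierIntegral_continuous Real.continuous_fourierChar
    (by exact continuous_inner) hu

/-- On `L¹ ∩ L²` the `L²` Fourier transform is given by the Fourier integral. -/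
theorem fourier_toLp_ae_eq {u : ℝ → F} (hu : MemLp u 2) (hu1 : Integrable u) :
    (𝓕 (hu.toLp u) : Lp F 2 (volume : Measure ℝ)) =ᵐ[volume] 𝓕 u := by
  refine ae_eq_of_integral_contDiff_smul_eq
    ((Lp.memLp _).locallyIntegrable (by norm_num))
    (continuous_fourier_of_integrable hu1).locallyIntegrable fun φ hφ hc => ?_
  have h1 := integral_fourier_schwartz_smul (testToSchwartz φ hφ hc) (hu.toLp u)
  have h2 := VectorFourier.integral_fourierIntegral_smul_eq_flip (μ := (volume : Measure ℝ))
    (ν := (volume : Measure ℝ)) (L := innerₗ ℝ) (e := Real.fourierChar)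
    Real.continuous_fourierChar (by exact continuous_inner)
    (testToSchwartz φ hφ hc).integrable hu1
  rw [flip_innerₗ] at h2
  have e1 : ∫ x, φ x • (𝓕 (hu.toLp u) : Lp F 2 (volume : Measure ℝ)) x =
      ∫ x, testToSchwartz φ hφ hc x • (𝓕 (hu.toLp u) : Lp F 2 (volume : Measure ℝ)) x := by
    simp [testToSchwartz_apply]
  have e2 : ∫ x, φ x • 𝓕 u x = ∫ x, testToSchwartz φ hφ hc x • 𝓕 u x := by
    simp [testToSchwartz_apply]
  rw [e1, e2, ← h1]
  refine Eq.trans ?_ h2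
  refine integral_congr_ae ?_
  filter_upwards [hu.coeFn_toLp] with x hx
  rw [hx]
  rfl

theorem fourierInv_toLp_ae_eq {u : ℝ → F} (hu : MemLp u 2) (hu1 : Integrable u) :
    (𝓕⁻ (hu.toLp u) : Lp F 2 (volume : Measure ℝ)) =ᵐ[volume] 𝓕⁻ u := by
  have hcont : Continuous (𝓕⁻ u) := by
    rw [Real.fourierInv_eq_fourier_comp_neg]
    exact continuous_fourier_of_integrable hu1.comp_neg
  refine ae_eq_of_integral_contDiff_smul_eq
    ((Lp.memLp _).locallyIntegrable (by norm_num)) hcont.locallyIntegrable fun φ hφ hc => ?_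
  have h1 := integral_fourierInv_schwartz_smul (testToSchwartz φ hφ hc) (hu.toLp u)
  have h2 := VectorFourier.integral_fourierIntegral_smul_eq_flip (μ := (volume : Measure ℝ))
    (ν := (volume : Measure ℝ)) (L := -innerₗ ℝ) (e := Real.fourierChar)
    Real.continuous_fourierChar (by
      change Continuous fun p : ℝ × ℝ => -(inner ℝ p.1 p.2)
      exact continuous_inner.neg)
    (testToSchwartz φ hφ hc).integrable hu1
  have e0 : (-innerₗ ℝ : ℝ →ₗ[ℝ] ℝ →ₗ[ℝ] ℝ).flip = -innerₗ ℝ := by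
    ext; simp
  rw [e0] at h2
  have e1 : ∫ x, φ x • (𝓕⁻ (hu.toLp u) : Lp F 2 (volume : Measure ℝ)) x =
      ∫ x, testToSchwartz φ hφ hc x • (𝓕⁻ (hu.toLp u) : Lp F 2 (volume : Measure ℝ)) x := by
    simp [testToSchwartz_apply]
  have e2 : ∫ x, φ x • 𝓕⁻ u x = ∫ x, testToSchwartz φ hφ hc x • 𝓕⁻ u x := by
    simp [testToSchwartz_apply]
  rw [e1, e2, ← h1]
  refine Eq.trans ?_ h2
  refine integral_congr_ae ?_
  filter_upwards [hu.coeFn_toLp] with x hx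
  rw [hx, SchwartzMap.fourierInv_coe]
  rfl

/-- The convolution kernel `(2π)⁻¹ ∫ b(s) e^{izs} ds` of the function `b` of `-i d/dx`. -/
def invFourierKernel (b : ℝ → ℂ) (z : ℝ) : ℂ :=
  (1 / (2 * Real.pi) : ℂ) * ∫ s : ℝ, b s * Complex.exp (Complex.I * z * s)

theorem IsBddBorel.comp_mul {b : ℝ → ℂ} (hb : IsBddBorel b) (c : ℝ) :
    IsBddBorel fun ξ => b (c * ξ) := by
  obtain ⟨hm, C, hC⟩ := hb
  exact ⟨hm.comp (measurable_const_mul c), C, fun ξ => hC _⟩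

theorem SpectralMeasure.IsBddBorel.memLp_two {b : ℝ → ℂ} (hb : IsBddBorel b) (hi : Integrable b) :
    MemLp b 2 := by
  obtain ⟨hm, C, hC⟩ := hb
  refine (memLp_two_iff_integrable_sq_norm hm.aestronglyMeasurable).2
    ((hi.norm.const_mul C).mono' (hm.norm.pow_const 2).aestronglyMeasurable
      (Eventually.of_forall fun x => ?_))
  rw [norm_pow, norm_norm, sq]
  exact mul_le_mul_of_nonneg_right (hC x) (norm_nonneg _)

/-- The function of `-2πξ` which represents `b(-i d/dx)` on the Fourier side, modulated by `x`. -/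
def modulation (b : ℝ → ℂ) (x ξ : ℝ) : ℂ :=
  b (-(2 * Real.pi) * ξ) * Complex.exp (↑(-2 * Real.pi * ξ * x) * Complex.I)

theorem norm_modulation (b : ℝ → ℂ) (x ξ : ℝ) :
    ‖modulation b x ξ‖ = ‖b (-(2 * Real.pi) * ξ)‖ := by
  rw [modulation, norm_mul, Complex.norm_exp_ofReal_mul_I, mul_one]

theorem IsBddBorel.modulation {b : ℝ → ℂ} (hb : IsBddBorel b) (x : ℝ) :
    IsBddBorel (modulation b x) := by
  obtain ⟨hm, C, hC⟩ := hb
  refine ⟨?_, C, fun ξ => (norm_modulation b x ξ).trans_le (hC _)⟩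
  unfold _root_.modulation
  exact (hm.comp (measurable_const_mul _)).mul (by fun_prop)

theorem integrable_modulation {b : ℝ → ℂ} (hb : IsBddBorel b) (hi : Integrable b) (x : ℝ) :
    Integrable (modulation b x) := by
  have h : Integrable fun ξ => b (-(2 * Real.pi) * ξ) :=
    hi.comp_mul_left' (neg_ne_zero.2 (by positivity))
  exact h.mono (IsBddBorel.modulation hb x).1.aestronglyMeasurable
    (Eventually.of_forall fun ξ => (norm_modulation b x ξ).le)

/-- Substitution $s=-2\pi\xi$; the minus sign is there because `𝓕⁻`, rather than `𝓕`, is the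
diagonalizing transform. -/
theorem fourierInv_modulation (b : ℝ → ℂ) (x y : ℝ) :
    𝓕⁻ (modulation b x) y = invFourierKernel b (x - y) := by
  have h := Measure.integral_comp_mul_left
    (fun s : ℝ => b s * Complex.exp (Complex.I * ↑(x - y) * s)) (-(2 * Real.pi))
  rw [Real.fourierInv_eq', invFourierKernel]
  have e : (1 / (2 * Real.pi) : ℂ) = ((|(-(2 * Real.pi))⁻¹| : ℝ) : ℂ) := by
    rw [abs_inv, abs_neg, abs_of_pos (by positivity)]
    push_cast
    ring
  rw [e, ← Complex.real_smul, ← h]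
  refine integral_congr_ae (Eventually.of_forall fun ξ => ?_)
  simp only [_root_.modulation, smul_eq_mul, RCLike.inner_apply, conj_trivial]
  rw [mul_left_comm, ← Complex.exp_add]
  congr 2
  push_cast
  ring

/-- Duality against the $L^2$ function `modulation b x`. The identity holds at every `x`, so
convolutions with different symbols can later be compared without exceptional sets depending on the
symbol. -/
theorem integral_invFourierKernel_smul {b : ℝ → ℂ} (hb : IsBddBorel b) (hi : Integrable b)
    (h : Lp F 2 (volume : Measure ℝ)) (x : ℝ) :
    ∫ y, invFourierKernel b (x - y) • h y =
      ∫ ξ, modulation b x ξ • (𝓕⁻ h : Lp F 2 (volume : Measure ℝ)) ξ := by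
  have hψi := integrable_modulation hb hi x
  have hψ := (IsBddBorel.modulation hb x).memLp_two hψi
  have h1 := integral_fourierInv_smul (hψ.toLp _) h
  calc _ = ∫ y, (𝓕⁻ (hψ.toLp _) : Lp ℂ 2 (volume : Measure ℝ)) y • h y := by
        refine integral_congr_ae ?_
        filter_upwards [fourierInv_toLp_ae_eq hψ hψi] with y hy
        rw [hy, fourierInv_modulation]
    _ = _ := h1
    _ = _ := by
        refine integral_congr_ae ?_
        filter_upwards [hψ.coeFn_toLp] with ξ hξ
        rw [hξ]

/-- The operator `b(-i d/dx)` on `L²(ℝ; F)`. -/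
def fourierMul (b : ℝ → ℂ) (hb : IsBddBorel b) :
    Lp F 2 (volume : Measure ℝ) →L[ℂ] Lp F 2 (volume : Measure ℝ) :=
  conjMulOp (Lp.fourierTransformₗᵢ ℝ F).symm _ (IsBddBorel.comp_mul hb (-(2 * Real.pi)))

theorem fourierMul_apply {b : ℝ → ℂ} (hb : IsBddBorel b) (h : Lp F 2 (volume : Measure ℝ)) :
    fourierMul b hb h = 𝓕 (mulOp _ (IsBddBorel.comp_mul hb (-(2 * Real.pi))) (𝓕⁻ h)) := rfl

theorem fourierInv_fourierMul {b : ℝ → ℂ} (hb : IsBddBorel b) (h : Lp F 2 (volume : Measure ℝ)) :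
    𝓕⁻ (fourierMul b hb h) = mulOp _ (IsBddBorel.comp_mul hb (-(2 * Real.pi))) (𝓕⁻ h) := by
  rw [fourierMul_apply, fourierInv_fourier_eq]

/-- A bounded integrable symbol is in $L^2$, so its product with $\mathcal F^{-1}h$ is integrable
and the outer $L^2$ transform is given by the Fourier integral. -/
theorem fourierMul_ae_eq {b : ℝ → ℂ} (hb : IsBddBorel b) (hi : Integrable b)
    (h : Lp F 2 (volume : Measure ℝ)) :
    fourierMul b hb h =ᵐ[volume] fun x => ∫ y, invFourierKernel b (x - y) • h y := by
  have hm := coeFn_mulOp (IsBddBorel.comp_mul hb (-(2 * Real.pi))) (𝓕⁻ h)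
  have hi' : Integrable fun ξ => b (-(2 * Real.pi) * ξ) :=
    hi.comp_mul_left' (neg_ne_zero.2 (by positivity))
  have hu : Integrable
      (mulOp _ (IsBddBorel.comp_mul hb (-(2 * Real.pi))) (𝓕⁻ h) : Lp F 2 (volume : Measure ℝ)) := by
    rw [integrable_congr hm]
    exact integrable_smul_of_memLp_two
      ((IsBddBorel.comp_mul hb (-(2 * Real.pi))).memLp_two hi') (Lp.memLp _)
  have h1 := fourier_toLp_ae_eq (Lp.memLp _) hu
  rw [Lp.toLp_coeFn, ← fourierMul_apply hb] at h1
  filter_upwards [h1] with x hx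
  rw [hx, integral_invFourierKernel_smul hb hi, Real.fourier_real_eq_integral_exp_smul]
  refine integral_congr_ae ?_
  filter_upwards [hm] with ξ hξ
  rw [hξ, smul_smul, modulation, mul_comm]

/-- Convolution with the kernel of `b c` is convolution with the kernel of `b` after
`c(-i d/dx)`, at every point. -/
theorem integral_invFourierKernel_mul_smul {b c : ℝ → ℂ} (hb : IsBddBorel b) (hi : Integrable b)
    (hc : IsBddBorel c) (h : Lp F 2 (volume : Measure ℝ)) (x : ℝ) :
    ∫ y, invFourierKernel (b * c) (x - y) • h y =
      ∫ y, invFourierKernel b (x - y) • (fourierMul c hc h) y := by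
  have hbc : Integrable (b * c) := by
    obtain ⟨hm, C, hC⟩ := hc
    exact hi.mul_bdd (c := C) hm.aestronglyMeasurable (Eventually.of_forall hC)
  rw [integral_invFourierKernel_smul (hb.mul hc) hbc, integral_invFourierKernel_smul hb hi,
    fourierInv_fourierMul]
  refine integral_congr_ae ?_
  filter_upwards [coeFn_mulOp (IsBddBorel.comp_mul hc (-(2 * Real.pi))) (𝓕⁻ h)] with ξ hξ
  rw [hξ, smul_smul, modulation, modulation, Pi.mul_apply]
  congr 1
  ring

end FourierL2

/-! ### The convolution kernels of $e^{-t|s|}$ and $e^{-t|s|}\,\mathrm{sgn}(s)$. -/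

section PoissonKernels

open SpectralMeasure

/-- `e^{-t|s|}`. -/
def poissonSymbol (t s : ℝ) : ℂ := (Real.exp (-t * |s|) : ℂ)

theorem norm_poissonSymbol (t s : ℝ) : ‖poissonSymbol t s‖ = Real.exp (-t * |s|) := by
  rw [poissonSymbol, Complex.norm_real, Real.norm_eq_abs, abs_of_pos (Real.exp_pos _)]

theorem isBddBorel_poissonSymbol {t : ℝ} (ht : 0 < t) : IsBddBorel (poissonSymbol t) := by
  refine ⟨by unfold poissonSymbol; fun_prop, 1, fun s => ?_⟩
  rw [norm_poissonSymbol, Real.exp_le_one_iff]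
  have := mul_nonneg ht.le (abs_nonneg s)
  linarith

theorem isBddBorel_sgn : IsBddBorel sgn := ⟨measurable_sgn, 1, norm_sgn_le⟩

theorem sgn_of_pos {x : ℝ} (hx : 0 < x) : sgn x = 1 := by simp [sgn, Real.sign_of_pos hx]

theorem sgn_of_neg {x : ℝ} (hx : x < 0) : sgn x = -1 := by simp [sgn, Real.sign_of_neg hx]

theorem poissonSymbol_mul_exp_Ioi (t z : ℝ) :
    EqOn (fun s : ℝ => Complex.exp ((-t + Complex.I * z) * s))
      (fun s => poissonSymbol t s * Complex.exp (Complex.I * z * s)) (Ioi 0) := by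
  intro s hs
  simp only [poissonSymbol, abs_of_pos (mem_Ioi.1 hs)]
  rw [Complex.ofReal_exp, ← Complex.exp_add]
  congr 1
  push_cast
  ring

theorem poissonSymbol_mul_exp_Iic (t z : ℝ) :
    EqOn (fun s : ℝ => Complex.exp ((t + Complex.I * z) * s))
      (fun s => poissonSymbol t s * Complex.exp (Complex.I * z * s)) (Iic 0) := by
  intro s hs
  simp only [poissonSymbol, abs_of_nonpos (mem_Iic.1 hs)]
  rw [Complex.ofReal_exp, ← Complex.exp_add]
  congr 1
  push_cast
  ring

theorem integrableOn_poissonSymbol_mul_exp_Ioi {t : ℝ} (ht : 0 < t) (z : ℝ) :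
    IntegrableOn (fun s : ℝ => poissonSymbol t s * Complex.exp (Complex.I * z * s)) (Ioi 0) :=
  (integrableOn_congr_fun (poissonSymbol_mul_exp_Ioi t z) measurableSet_Ioi).1
    (integrableOn_exp_mul_complex_Ioi (by simpa using ht) 0)

theorem integrableOn_poissonSymbol_mul_exp_Iic {t : ℝ} (ht : 0 < t) (z : ℝ) :
    IntegrableOn (fun s : ℝ => poissonSymbol t s * Complex.exp (Complex.I * z * s)) (Iic 0) :=
  (integrableOn_congr_fun (poissonSymbol_mul_exp_Iic t z) measurableSet_Iic).1
    (integrableOn_exp_mul_complex_Iic (by simpa using ht) 0)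

theorem setIntegral_poissonSymbol_mul_exp_Ioi {t : ℝ} (ht : 0 < t) (z : ℝ) :
    ∫ s in Ioi 0, poissonSymbol t s * Complex.exp (Complex.I * z * s) =
      1 / (t - Complex.I * z) := by
  rw [← setIntegral_congr_fun measurableSet_Ioi (poissonSymbol_mul_exp_Ioi t z),
    integral_exp_mul_complex_Ioi (by simpa using ht)]
  simp only [Complex.ofReal_zero, mul_zero, Complex.exp_zero]
  rw [neg_div, ← div_neg]
  congr 1
  ring

theorem setIntegral_poissonSymbol_mul_exp_Iic {t : ℝ} (ht : 0 < t) (z : ℝ) :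
    ∫ s in Iic 0, poissonSymbol t s * Complex.exp (Complex.I * z * s) =
      1 / (t + Complex.I * z) := by
  rw [← setIntegral_congr_fun measurableSet_Iic (poissonSymbol_mul_exp_Iic t z),
    integral_exp_mul_complex_Iic (by simpa using ht)]
  simp

theorem integrable_poissonSymbol_mul_exp {t : ℝ} (ht : 0 < t) (z : ℝ) :
    Integrable fun s : ℝ => poissonSymbol t s * Complex.exp (Complex.I * z * s) := by
  rw [← integrableOn_univ, ← Iic_union_Ioi (a := (0 : ℝ))]
  exact (integrableOn_poissonSymbol_mul_exp_Iic ht z).union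
    (integrableOn_poissonSymbol_mul_exp_Ioi ht z)

theorem integrable_poissonSymbol {t : ℝ} (ht : 0 < t) : Integrable (poissonSymbol t) := by
  simpa using integrable_poissonSymbol_mul_exp ht 0

theorem ofReal_add_I_mul_ne_zero {t : ℝ} (ht : 0 < t) (z : ℝ) : (t : ℂ) + Complex.I * z ≠ 0 := by
  intro h
  have := congrArg Complex.re h
  simp at this
  exact ht.ne' this

theorem sq_add_sq_eq (t z : ℝ) :
    ((t ^ 2 + z ^ 2 : ℝ) : ℂ) = (t + Complex.I * z) * (t - Complex.I * z) := by
  push_cast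
  linear_combination (z : ℂ) ^ 2 * Complex.I_sq

theorem ofReal_sub_I_mul_ne_zero {t : ℝ} (ht : 0 < t) (z : ℝ) : (t : ℂ) - Complex.I * z ≠ 0 := by
  have := ofReal_add_I_mul_ne_zero ht (-z)
  push_cast at this
  rwa [mul_neg, ← sub_eq_add_neg] at this

theorem invFourierKernel_poissonSymbol {t : ℝ} (ht : 0 < t) (z : ℝ) :
    invFourierKernel (poissonSymbol t) z = (1 / Real.pi : ℂ) * ((t / (t ^ 2 + z ^ 2) : ℝ) : ℂ) := by
  rw [invFourierKernel, ← setIntegral_univ, ← Iic_union_Ioi (a := (0 : ℝ)),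
    setIntegral_union (Iic_disjoint_Ioi le_rfl) measurableSet_Ioi
      (integrableOn_poissonSymbol_mul_exp_Iic ht z) (integrableOn_poissonSymbol_mul_exp_Ioi ht z),
    setIntegral_poissonSymbol_mul_exp_Iic ht, setIntegral_poissonSymbol_mul_exp_Ioi ht,
    Complex.ofReal_div, sq_add_sq_eq]
  have h1 := ofReal_add_I_mul_ne_zero ht z
  have h2 := ofReal_sub_I_mul_ne_zero ht z
  have h3 : (Real.pi : ℂ) ≠ 0 := by exact_mod_cast Real.pi_ne_zero
  field_simp
  ring

theorem integrable_poissonSymbol_mul_sgn_mul_exp {t : ℝ} (ht : 0 < t) (z : ℝ) :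
    Integrable fun s : ℝ => (poissonSymbol t * sgn) s * Complex.exp (Complex.I * z * s) := by
  refine (integrable_poissonSymbol_mul_exp ht z).mono ?_ (Eventually.of_forall fun s => ?_)
  · exact (((isBddBorel_poissonSymbol ht).mul isBddBorel_sgn).1.mul
      (by fun_prop)).aestronglyMeasurable
  · rw [Pi.mul_apply, norm_mul, norm_mul, norm_mul]
    gcongr
    exact mul_le_of_le_one_right (norm_nonneg _) (norm_sgn_le s)

/-- The half-line integrals $1/(t-iz)$ and $1/(t+iz)$ are now subtracted, giving $2iz/(t^2+z^2)$ in
place of $2t/(t^2+z^2)$. -/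
theorem invFourierKernel_poissonSymbol_mul_sgn {t : ℝ} (ht : 0 < t) (z : ℝ) :
    invFourierKernel (poissonSymbol t * sgn) z =
      (Complex.I / Real.pi : ℂ) * ((z / (t ^ 2 + z ^ 2) : ℝ) : ℂ) := by
  have e1 : ∫ s in Ioi 0, (poissonSymbol t * sgn) s * Complex.exp (Complex.I * z * s) =
      1 / (t - Complex.I * z) := by
    rw [← setIntegral_poissonSymbol_mul_exp_Ioi ht]
    refine setIntegral_congr_fun measurableSet_Ioi fun s hs => ?_
    simp [sgn_of_pos (mem_Ioi.1 hs)]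
  have e2 : ∫ s in Iic 0, (poissonSymbol t * sgn) s * Complex.exp (Complex.I * z * s) =
      -(1 / (t + Complex.I * z)) := by
    rw [← setIntegral_poissonSymbol_mul_exp_Iic ht, ← integral_neg, integral_Iic_eq_integral_Iio,
      integral_Iic_eq_integral_Iio]
    refine setIntegral_congr_fun measurableSet_Iio fun s hs => ?_
    simp [sgn_of_neg (mem_Iio.1 hs)]
  have hi := integrable_poissonSymbol_mul_sgn_mul_exp ht z
  rw [invFourierKernel, ← setIntegral_univ, ← Iic_union_Ioi (a := (0 : ℝ)),
    setIntegral_union (Iic_disjoint_Ioi le_rfl) measurableSet_Ioi hi.integrableOn hi.integrableOn,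
    e1, e2, Complex.ofReal_div, sq_add_sq_eq]
  have h1 := ofReal_add_I_mul_ne_zero ht z
  have h2 := ofReal_sub_I_mul_ne_zero ht z
  have h3 : (Real.pi : ℂ) ≠ 0 := by exact_mod_cast Real.pi_ne_zero
  field_simp
  ring

end PoissonKernels

/-! ### Weak derivatives in $L^2$ on the Fourier side. -/

section WeakDerivative

open SpectralMeasure SchwartzMap FourierTransform

variable {F : Type*} [NormedAddCommGroup F] [InnerProductSpace ℂ F]

/-- `v` is the weak derivative of the vector-valued function `u`. -/
def IsVectorWeakDeriv (u v : ℝ → F) : Prop :=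
  ∀ φ : ℝ → ℝ, ContDiff ℝ ∞ φ → HasCompactSupport φ →
    ∫ x, deriv φ x • u x = -∫ x, φ x • v x

theorem integrable_test_smul {φ : ℝ → ℝ} (hφ : Continuous φ) (hc : HasCompactSupport φ)
    {u : ℝ → F} (hu : MemLp u 2) : Integrable (fun x => φ x • u x) :=
  (hu.locallyIntegrable (by norm_num)).integrable_smul_left_of_hasCompactSupport hφ hc

variable [CompleteSpace F]

theorem IsVectorWeakDeriv.complex_test {u v : ℝ → F} (h : IsVectorWeakDeriv u v) (hu : MemLp u 2)
    (hv : MemLp v 2) {φ : ℝ → ℂ} (hφ : ContDiff ℝ ∞ φ) (hc : HasCompactSupport φ) :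
    ∫ x, deriv φ x • u x = -∫ x, φ x • v x := by
  have hre : ContDiff ℝ ∞ fun x => (φ x).re := Complex.reCLM.contDiff.comp hφ
  have him : ContDiff ℝ ∞ fun x => (φ x).im := Complex.imCLM.contDiff.comp hφ
  have cre : HasCompactSupport fun x => (φ x).re := hc.comp_left (g := Complex.re) rfl
  have cim : HasCompactSupport fun x => (φ x).im := hc.comp_left (g := Complex.im) rfl
  have hd : ∀ x, deriv φ x = ((deriv (fun x => (φ x).re) x : ℝ) : ℂ) +
      ((deriv (fun x => (φ x).im) x : ℝ) : ℂ) * Complex.I := by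
    intro x
    have h0 := (hφ.differentiable (by simp) x).hasDerivAt
    have h1 : HasDerivAt (fun x => (φ x).re) (deriv φ x).re x :=
      (Complex.reCLM.hasFDerivAt.comp_hasDerivAt x h0)
    have h2 : HasDerivAt (fun x => (φ x).im) (deriv φ x).im x :=
      (Complex.imCLM.hasFDerivAt.comp_hasDerivAt x h0)
    rw [h1.deriv, h2.deriv, Complex.re_add_im]
  have dre : Continuous (deriv fun x => (φ x).re) := hre.continuous_deriv (by simp)
  have dim : Continuous (deriv fun x => (φ x).im) := him.continuous_deriv (by simp)
  have e1 : ∀ x, deriv φ x • u x = deriv (fun x => (φ x).re) x • u x +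
      Complex.I • (deriv (fun x => (φ x).im) x • u x) := by
    intro x
    rw [hd, add_smul, mul_comm, mul_smul, Complex.coe_smul, Complex.coe_smul]
  have e2 : ∀ x, φ x • v x = (φ x).re • v x + Complex.I • ((φ x).im • v x) := by
    intro x
    nth_rewrite 1 [← Complex.re_add_im (φ x)]
    rw [add_smul, mul_comm, mul_smul, Complex.coe_smul, Complex.coe_smul]
  simp only [e1, e2]
  have i1 : Integrable fun x => Complex.I • (deriv (fun x => (φ x).im) x • u x) :=
    (integrable_test_smul dim cim.deriv hu).smul Complex.I
  have i2 : Integrable fun x => Complex.I • ((φ x).im • v x) :=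
    (integrable_test_smul him.continuous cim hv).smul Complex.I
  rw [integral_add (integrable_test_smul dre cre.deriv hu) i1,
    integral_add (integrable_test_smul hre.continuous cre hv) i2,
    integral_smul, integral_smul, h _ hre cre, h _ him cim, smul_neg, neg_add]

/-- Schwartz functions may be used as test functions for weak derivatives in `L²`. -/
theorem IsVectorWeakDeriv.schwartz_test {u v : ℝ → F} (h : IsVectorWeakDeriv u v) (hu : MemLp u 2)
    (hv : MemLp v 2) (ψ : 𝓢(ℝ, ℂ)) :
    ∫ x, deriv ψ x • u x = -∫ x, ψ x • v x := by
  -- The cutoffs $\chi(c_nx)$ with $c_n=1/(n+1)$ tend to $1$ pointwise, and their derivatives are at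
  -- most $c_nK$; $c_n\le1$ gives a dominating function independent of $n$.
  let χ : ContDiffBump (0 : ℝ) := ⟨1, 2, one_pos, one_lt_two⟩
  let c : ℕ → ℝ := fun n => ((n : ℝ) + 1)⁻¹
  have hc0 : Tendsto c atTop (𝓝 0) := tendsto_inv_atTop_nhds_zero_nat.comp
    (tendsto_add_atTop_nat 1) |>.congr fun n => by simp [c]
  have hcpos : ∀ n, 0 < c n := fun n => by positivity
  have hcle : ∀ n, c n ≤ 1 := fun n => inv_le_one_of_one_le₀ (by simp)
  have hχd : Continuous (deriv χ) := χ.contDiff.continuous_deriv (n := 1) le_rfl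
  obtain ⟨K, hK⟩ := χ.hasCompactSupport.deriv.exists_bound_of_continuous hχd
  let φ : ℕ → ℝ → ℂ := fun n x => (χ (c n * x) : ℂ) * ψ x
  have hφ : ∀ n, ContDiff ℝ ∞ (φ n) := fun n => by
    refine (Complex.ofRealCLM.contDiff.comp (χ.contDiff.comp
      (contDiff_const.mul contDiff_id))).mul (ψ.smooth ⊤)
  have hcs : ∀ n, HasCompactSupport (φ n) := fun n => by
    have h1 : HasCompactSupport fun x => χ (c n * x) :=
      χ.hasCompactSupport.comp_homeomorph (Homeomorph.mulLeft₀ (c n) (hcpos n).ne')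
    exact (h1.comp_left (g := fun x : ℝ => (x : ℂ)) (by simp)).mul_right
  have hderiv : ∀ n x, deriv (φ n) x = ((c n * deriv χ (c n * x) : ℝ) : ℂ) * ψ x +
      (χ (c n * x) : ℂ) * deriv ψ x := by
    intro n x
    have h1 : HasDerivAt (fun x => χ (c n * x)) (c n * deriv χ (c n * x)) x := by
      have h2 := (χ.contDiff (n := 1)).differentiable (by simp) (c n * x) |>.hasDerivAt
      have h3 : HasDerivAt (fun x => c n * x) (c n) x := by
        simpa using (hasDerivAt_id x).const_mul (c n)
      rw [mul_comm (c n) (deriv _ _)]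
      exact h2.comp x h3
    exact (h1.ofReal_comp.mul (ψ.differentiableAt (x := x)).hasDerivAt).deriv
  have hn : ∀ n, ∫ x, deriv (φ n) x • u x = -∫ x, φ n x • v x := fun n =>
    h.complex_test hu hv (hφ n) (hcs n)
  have hψ' : MemLp (deriv ψ) 2 := by
    exact (SchwartzMap.derivCLM ℂ ℂ ψ).memLp 2 volume
  have hχ1 : ∀ x, Tendsto (fun n => (χ (c n * x) : ℂ)) atTop (𝓝 1) := by
    intro x
    have h1 : Tendsto (fun n => c n * x) atTop (𝓝 0) := by simpa using hc0.mul_const x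
    have h2 := (χ.continuous.tendsto 0).comp h1
    rw [χ.one_of_mem_closedBall (by simp [χ])] at h2
    exact (Complex.continuous_ofReal.tendsto 1).comp h2
  have hχle : ∀ y, ‖(χ y : ℂ)‖ ≤ 1 := fun y => by
    rw [Complex.norm_real, Real.norm_eq_abs, abs_of_nonneg χ.nonneg]
    exact χ.le_one
  have lim1 : Tendsto (fun n => ∫ x, deriv (φ n) x • u x) atTop (𝓝 (∫ x, deriv ψ x • u x)) := by
    refine tendsto_integral_of_dominated_convergence
      (fun x => K * ‖ψ x • u x‖ + ‖deriv ψ x • u x‖) (fun n => ?_) ?_ (fun n => ?_) ?_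
    · exact ((hφ n).continuous_deriv (by simp)).aestronglyMeasurable.smul hu.1
    · exact ((integrable_smul_of_memLp_two (ψ.memLp 2) hu).norm.const_mul K).add
        (integrable_smul_of_memLp_two hψ' hu).norm
    · refine Eventually.of_forall fun x => ?_
      rw [hderiv, add_smul, mul_smul, mul_smul]
      refine (norm_add_le _ _).trans (add_le_add ?_ ?_)
      · rw [norm_smul]
        refine mul_le_mul_of_nonneg_right ?_ (norm_nonneg _)
        rw [Complex.norm_real, norm_mul, Real.norm_eq_abs, abs_of_pos (hcpos n)]
        exact (mul_le_of_le_one_left (norm_nonneg _) (hcle n)).trans (hK _)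
      · rw [norm_smul]
        exact mul_le_of_le_one_left (norm_nonneg _) (hχle _)
    · refine Eventually.of_forall fun x => ?_
      simp only [hderiv]
      have h1 : Tendsto (fun n => ((c n * deriv χ (c n * x) : ℝ) : ℂ)) atTop (𝓝 0) := by
        rw [tendsto_zero_iff_norm_tendsto_zero]
        refine squeeze_zero (fun n => norm_nonneg _) (fun n => ?_)
          (by simpa using hc0.mul_const K)
        rw [Complex.norm_real, norm_mul, Real.norm_eq_abs, abs_of_pos (hcpos n)]
        exact mul_le_mul_of_nonneg_left (hK _) (hcpos n).le
      have h2 := ((h1.mul_const (ψ x)).add ((hχ1 x).mul_const (deriv ψ x))).smul_const (u x)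
      simpa using h2
  have lim2 : Tendsto (fun n => ∫ x, φ n x • v x) atTop (𝓝 (∫ x, ψ x • v x)) := by
    refine tendsto_integral_of_dominated_convergence
      (fun x => ‖ψ x • v x‖) (fun n => ?_) ?_ (fun n => ?_) ?_
    · exact (hφ n).continuous.aestronglyMeasurable.smul hv.1
    · exact (integrable_smul_of_memLp_two (ψ.memLp 2) hv).norm
    · refine Eventually.of_forall fun x => ?_
      rw [mul_smul, norm_smul]
      exact mul_le_of_le_one_left (norm_nonneg _) (hχle _)
    · refine Eventually.of_forall fun x => ?_
      simpa using ((hχ1 x).mul_const (ψ x)).smul_const (v x)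
  exact tendsto_nhds_unique (lim1.congr hn) lim2.neg

theorem integral_schwartz_smul_eq_fourier (ψ : 𝓢(ℝ, ℂ)) (h : Lp F 2 (volume : Measure ℝ)) :
    ∫ x, ψ x • h x = ∫ ξ, (𝓕 ψ) ξ • (𝓕⁻ h : Lp F 2 (volume : Measure ℝ)) ξ := by
  rw [← integral_fourierInv_schwartz_smul, fourierInv_fourier_eq]

theorem fourier_derivCLM_apply (ψ : 𝓢(ℝ, ℂ)) (ξ : ℝ) :
    (𝓕 (SchwartzMap.derivCLM ℂ ℂ ψ)) ξ = (2 * Real.pi * Complex.I * ξ) * (𝓕 ψ) ξ := by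
  have := congrFun (Real.fourier_deriv (f := ψ) ψ.integrable ψ.differentiable
    (SchwartzMap.derivCLM ℂ ℂ ψ).integrable) ξ
  rw [smul_eq_mul] at this
  exact this

theorem integral_deriv_schwartz_smul (ψ : 𝓢(ℝ, ℂ)) (h : Lp F 2 (volume : Measure ℝ)) :
    ∫ x, deriv ψ x • h x = ∫ ξ : ℝ, (𝓕 ψ) ξ •
      ((2 * Real.pi * Complex.I * ξ : ℂ) • (𝓕⁻ h : Lp F 2 (volume : Measure ℝ)) ξ) := by
  have h1 := integral_schwartz_smul_eq_fourier (SchwartzMap.derivCLM ℂ ℂ ψ) h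
  simp only [fourier_derivCLM_apply, SchwartzMap.derivCLM_apply] at h1
  rw [h1]
  refine integral_congr_ae (Eventually.of_forall fun ξ => ?_)
  simp only
  rw [smul_smul, mul_comm]

/-- Weak derivatives in `L²` on the Fourier side. -/
theorem isVectorWeakDeriv_iff (h v : Lp F 2 (volume : Measure ℝ)) :
    IsVectorWeakDeriv h v ↔ (𝓕⁻ v : Lp F 2 (volume : Measure ℝ)) =ᵐ[volume]
      fun ξ => (-(2 * Real.pi * Complex.I * ξ) : ℂ) • (𝓕⁻ h : Lp F 2 (volume : Measure ℝ)) ξ := by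
  constructor
  · intro hw
    have hl : LocallyIntegrable (fun ξ : ℝ => (-(2 * Real.pi * Complex.I * ξ) : ℂ) •
        (𝓕⁻ h : Lp F 2 (volume : Measure ℝ)) ξ) volume := by
      have h1 : LocallyIntegrable (𝓕⁻ h : Lp F 2 (volume : Measure ℝ)) volume :=
        (Lp.memLp (𝓕⁻ h : Lp F 2 (volume : Measure ℝ))).locallyIntegrable (by norm_num)
      have h2 : ContinuousOn (fun ξ : ℝ => (-(2 * Real.pi * Complex.I * ξ) : ℂ)) univ := by
        fun_prop
      rw [← locallyIntegrableOn_univ] at h1 ⊢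
      exact h1.continuousOn_smul isClosed_univ.isLocallyClosed h2
    refine ae_eq_of_integral_contDiff_smul_eq
      ((Lp.memLp _).locallyIntegrable (by norm_num)) hl fun φ hφ hc => ?_
    -- The test function is compactly supported on the frequency side, so its inverse transform is
    -- in general only Schwartz in `x`.
    have h1 := hw.schwartz_test (Lp.memLp h) (Lp.memLp v) (𝓕⁻ (testToSchwartz φ hφ hc))
    rw [integral_deriv_schwartz_smul, integral_schwartz_smul_eq_fourier _ v,
      fourier_fourierInv_eq] at h1
    simp only [testToSchwartz_apply, Complex.coe_smul] at h1
    rw [← neg_inj, ← h1, ← integral_neg]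
    simp
  · intro he φ hφ hc
    have h1 := integral_deriv_schwartz_smul (testToSchwartz φ hφ hc) h
    have h2 := integral_schwartz_smul_eq_fourier (testToSchwartz φ hφ hc) v
    have e1 : ∫ x, deriv φ x • h x = ∫ x, deriv (testToSchwartz φ hφ hc) x • h x := by
      refine integral_congr_ae (Eventually.of_forall fun x => ?_)
      have : deriv (testToSchwartz φ hφ hc) x = ((deriv φ x : ℝ) : ℂ) :=
        ((hφ.differentiable (by simp) x).hasDerivAt.ofReal_comp).deriv
      simp only [this, Complex.coe_smul]
    have e2 : ∫ x, φ x • v x = ∫ x, testToSchwartz φ hφ hc x • v x := by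
      simp [testToSchwartz_apply]
    rw [e1, e2, h1, h2, ← integral_neg]
    refine integral_congr_ae ?_
    filter_upwards [he] with ξ hξ
    rw [hξ, neg_smul, smul_neg, neg_neg]

end WeakDerivative

/-! ### Poisson integrals and truncated Hilbert kernels at Lebesgue points. -/

section LebesguePoints

variable {F : Type*} [NormedAddCommGroup F]

/-- `x` is a Lebesgue point of `g`. -/
def IsLebesguePoint (g : ℝ → F) (x : ℝ) : Prop :=
  Tendsto (fun r => ⨍ y in Metric.closedBall x r, ‖g y - g x‖) (𝓝[>] 0) (𝓝 0)

theorem ae_isLebesguePoint {g : ℝ → F} (hg : LocallyIntegrable g) :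
    ∀ᵐ x, IsLebesguePoint g x := by
  filter_upwards [(Besicovitch.vitaliFamily (volume : Measure ℝ)).ae_tendsto_average_norm_sub hg]
    with x hx
  exact hx.comp (Besicovitch.tendsto_filterAt volume x)

/-- The kernel `t / (t² + u²)`, which is `π` times the Poisson kernel. -/
def poissonKer (t u : ℝ) : ℝ := t / (t ^ 2 + u ^ 2)

theorem poissonKer_nonneg {t : ℝ} (ht : 0 < t) (u : ℝ) : 0 ≤ poissonKer t u := by
  unfold poissonKer; positivity

theorem poissonKer_eq {t : ℝ} (ht : 0 < t) (u : ℝ) :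
    poissonKer t u = t⁻¹ * (1 + (t⁻¹ * u) ^ 2)⁻¹ := by
  unfold poissonKer
  field_simp

theorem integrable_poissonKer {t : ℝ} (ht : 0 < t) : Integrable (poissonKer t) := by
  have h := (integrable_inv_one_add_sq.comp_mul_left' (inv_ne_zero ht.ne')).const_mul t⁻¹
  exact h.congr (Eventually.of_forall fun u => (poissonKer_eq ht u).symm)

theorem integral_poissonKer {t : ℝ} (ht : 0 < t) : ∫ u, poissonKer t u = Real.pi := by
  simp_rw [poissonKer_eq ht]
  rw [integral_const_mul, Measure.integral_comp_mul_left (fun u : ℝ => (1 + u ^ 2)⁻¹),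
    integral_univ_inv_one_add_sq, inv_inv, abs_of_pos ht, smul_eq_mul,
    inv_mul_cancel_left₀ ht.ne']

theorem integrable_poissonKer_sub {t : ℝ} (ht : 0 < t) (x : ℝ) :
    Integrable fun y => poissonKer t (x - y) :=
  (integrable_poissonKer ht).comp_sub_left x

theorem integral_poissonKer_sub {t : ℝ} (ht : 0 < t) (x : ℝ) :
    ∫ y, poissonKer t (x - y) = Real.pi := by
  rw [integral_sub_left_eq_self (poissonKer t) volume x, integral_poissonKer ht]

theorem continuous_poissonKer {t : ℝ} (ht : 0 < t) : Continuous (poissonKer t) := by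
  unfold poissonKer
  exact continuous_const.div (by fun_prop) fun u => by positivity

theorem poissonKer_le {t : ℝ} (ht : 0 < t) (u : ℝ) : poissonKer t u ≤ t⁻¹ := by
  rw [poissonKer, div_le_iff₀ (by positivity)]
  have : t⁻¹ * (t ^ 2 + u ^ 2) = t + t⁻¹ * u ^ 2 := by field_simp
  rw [this]
  have : 0 ≤ t⁻¹ * u ^ 2 := by positivity
  linarith

theorem memLp_poissonKer_sub {t : ℝ} (ht : 0 < t) (x : ℝ) :
    MemLp (fun y => poissonKer t (x - y)) 2 := by
  have hm : AEStronglyMeasurable (fun y => poissonKer t (x - y)) volume :=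
    ((continuous_poissonKer ht).comp (continuous_sub_left x)).aestronglyMeasurable
  refine (memLp_two_iff_integrable_sq hm).2
    (((integrable_poissonKer_sub ht x).const_mul t⁻¹).mono' (hm.pow 2)
      (Eventually.of_forall fun y => ?_))
  have h0 := poissonKer_nonneg ht (x - y)
  rw [Real.norm_eq_abs, abs_of_nonneg (by positivity), sq]
  exact mul_le_mul_of_nonneg_right (poissonKer_le ht _) h0

theorem integrable_poissonKer_mul_norm_sub {g : ℝ → F} (hg : MemLp g 2) {t : ℝ} (ht : 0 < t)
    (x : ℝ) : Integrable fun y => poissonKer t (x - y) * ‖g y - g x‖ := by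
  have h1 : Integrable fun y => poissonKer t (x - y) * ‖g y‖ :=
    memLp_one_iff_integrable.1 (MemLp.smul (r := 1) hg.norm (memLp_poissonKer_sub ht x))
  refine (h1.add ((integrable_poissonKer_sub ht x).mul_const ‖g x‖)).mono'
    ((memLp_poissonKer_sub ht x).1.mul (hg.1.sub aestronglyMeasurable_const).norm)
    (Eventually.of_forall fun y => ?_)
  have h0 := poissonKer_nonneg ht (x - y)
  rw [norm_mul, norm_norm, Real.norm_eq_abs, abs_of_nonneg h0, Pi.add_apply, ← mul_add]
  exact mul_le_mul_of_nonneg_left (norm_sub_le _ _) h0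

/-- A radially decreasing kernel against a measure which is small on centred balls. -/
theorem lintegral_poissonKer_le {t : ℝ} (ht : 0 < t) (x : ℝ) {μ : Measure ℝ} {ε : ℝ≥0∞}
    (hε : ε ≠ ⊤)
    (hμ : ∀ ρ, μ (Metric.ball x ρ) ≤ ε * volume (Metric.ball x ρ)) :
    ∫⁻ y, ENNReal.ofReal (poissonKer t (x - y)) ∂μ ≤ ε * ENNReal.ofReal Real.pi := by
  have hc : Continuous fun y => poissonKer t (x - y) :=
    (continuous_poissonKer ht).comp (continuous_sub_left x)
  have hn : ∀ y, 0 ≤ poissonKer t (x - y) := fun y => poissonKer_nonneg ht _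
  -- Superlevel sets of a radially decreasing kernel are centred balls, so the layer-cake formula
  -- turns the bound on balls into the claim. For $s\ge1/t$ the argument of the square root is at
  -- most $0$, the root is $0$, and both sets are empty.
  have hball : ∀ s, 0 < s → {y | s < poissonKer t (x - y)} =
      Metric.ball x √(t / s - t ^ 2) := by
    intro s hs
    ext y
    rw [mem_ofPred_eq, Metric.mem_ball, Real.dist_eq, Real.lt_sqrt (abs_nonneg _), sq_abs,
      poissonKer, lt_div_iff₀ (by positivity), lt_sub_iff_add_lt, lt_div_iff₀ hs]
    constructor <;> intro h <;> nlinarith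
  rw [lintegral_eq_lintegral_meas_lt μ (Eventually.of_forall hn) hc.aemeasurable,
    ← integral_poissonKer_sub ht x, ofReal_integral_eq_lintegral_ofReal
      (integrable_poissonKer_sub ht x) (Eventually.of_forall hn),
    lintegral_eq_lintegral_meas_lt volume (Eventually.of_forall hn) hc.aemeasurable]
  calc _ ≤ ∫⁻ s in Ioi 0, ε * volume {y | s < poissonKer t (x - y)} := by
        refine setLIntegral_mono' measurableSet_Ioi fun s hs => ?_
        rw [hball s hs]
        exact hμ _
    _ = _ := lintegral_const_mul' _ _ hε

theorem IsLebesguePoint.exists_forall_le {g : ℝ → F} {x : ℝ} (h : IsLebesguePoint g x) {ε : ℝ}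
    (hε : 0 < ε) : ∃ δ > 0, ∀ r, 0 < r → r ≤ δ →
      ∫ y in Metric.closedBall x r, ‖g y - g x‖ ≤ ε * (2 * r) := by
  have h1 := h.eventually (gt_mem_nhds hε)
  rw [eventually_nhdsWithin_iff, Metric.eventually_nhds_iff] at h1
  obtain ⟨δ, hδ, h1⟩ := h1
  refine ⟨δ / 2, by positivity, fun r hr hrδ => ?_⟩
  have h2 := h1 (y := r) (by rw [Real.dist_eq, sub_zero, abs_of_pos hr]; linarith) hr
  rw [setAverage_eq, Measure.real, Real.volume_closedBall, ENNReal.toReal_ofReal (by positivity),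
    smul_eq_mul, inv_mul_lt_iff₀ (by positivity)] at h2
  linarith

/-- Convolution of `‖g - g x‖` with the Poisson kernel tends to `0` at Lebesgue points. -/
theorem IsLebesguePoint.tendsto_integral_poissonKer {g : ℝ → F} (hg : MemLp g 2) {x : ℝ}
    (h : IsLebesguePoint g x) :
    Tendsto (fun t => ∫ y, poissonKer t (x - y) * ‖g y - g x‖) (𝓝[>] 0) (𝓝 0) := by
  have hloc : LocallyIntegrable (fun y => ‖g y - g x‖) volume :=
    fun z => ((hg.locallyIntegrable (by norm_num)).sub (locallyIntegrable_const (g x)) z).norm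
  rw [Metric.tendsto_nhds]
  intro η hη
  obtain ⟨δ, hδ, hε⟩ := h.exists_forall_le (ε := η / 2 / (Real.pi + 1))
    (by have := Real.pi_pos; positivity)
  set ε := η / 2 / (Real.pi + 1) with hεdef
  have hεpos : 0 < ε := by have := Real.pi_pos; positivity
  set M := ∫ y, poissonKer 1 (x - y) * ‖g y - g x‖ with hM
  have hM0 : 0 ≤ M := integral_nonneg fun y =>
    mul_nonneg (poissonKer_nonneg one_pos _) (norm_nonneg _)
  -- For $|u|>\delta$ one has $1+u^2\le C(t^2+u^2)$, so the kernel at `t` is at most $tC$ times the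
  -- kernel at $1$: the far part is at most $tCM$.
  set C := 1 + (δ ^ 2)⁻¹ with hC
  have hCpos : 0 < C := by positivity
  have hev : ∀ᶠ t : ℝ in 𝓝[>] 0, t * (C * M) < η / 2 := by
    have : Tendsto (fun t : ℝ => t * (C * M)) (𝓝[>] 0) (𝓝 0) := by
      have := (tendsto_id (α := ℝ) (x := 𝓝 0)).mul_const (C * M)
      rw [zero_mul] at this
      exact this.mono_left nhdsWithin_le_nhds
    exact this.eventually (gt_mem_nhds (by positivity))
  filter_upwards [hev, self_mem_nhdsWithin] with t htη ht
  replace ht : 0 < t := ht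
  have hint := integrable_poissonKer_mul_norm_sub hg ht x
  have hnn : ∀ y, 0 ≤ poissonKer t (x - y) * ‖g y - g x‖ := fun y =>
    mul_nonneg (poissonKer_nonneg ht _) (norm_nonneg _)
  have hB : MeasurableSet (Metric.closedBall x δ) := Metric.isClosed_closedBall.measurableSet
  have near : ∫ y in Metric.closedBall x δ, poissonKer t (x - y) * ‖g y - g x‖ ≤
      ε * Real.pi := by
    -- The averages are small only for radii up to `δ`. Restricting the measure to that ball makes
    -- the bound hold for all radii, with `min ρ δ` as effective radius.
    let μ := (volume.restrict (Metric.closedBall x δ)).withDensity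
      fun y => ENNReal.ofReal ‖g y - g x‖
    have hGm : AEMeasurable (fun y => ENNReal.ofReal ‖g y - g x‖)
        (volume.restrict (Metric.closedBall x δ)) :=
      (hloc.aestronglyMeasurable.aemeasurable.ennreal_ofReal).restrict
    have hμ : ∀ ρ, μ (Metric.ball x ρ) ≤ ENNReal.ofReal ε * volume (Metric.ball x ρ) := by
      intro ρ
      rcases le_or_gt ρ 0 with hρ | hρ
      · simp [Metric.ball_eq_empty.2 hρ]
      have hr : 0 < min ρ δ := lt_min hρ hδ
      rw [withDensity_apply _ Metric.isOpen_ball.measurableSet,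
        Measure.restrict_restrict Metric.isOpen_ball.measurableSet]
      calc _ ≤ ∫⁻ y in Metric.closedBall x (min ρ δ), ENNReal.ofReal ‖g y - g x‖ := by
            refine lintegral_mono_set fun y hy => ?_
            exact Metric.mem_closedBall.2 (le_min (Metric.mem_ball.1 hy.1).le
              (Metric.mem_closedBall.1 hy.2))
        _ = ENNReal.ofReal (∫ y in Metric.closedBall x (min ρ δ), ‖g y - g x‖) := by
            rw [ofReal_integral_eq_lintegral_ofReal
              (hloc.integrableOn_isCompact (isCompact_closedBall x _))
              (Eventually.of_forall fun y => norm_nonneg _)]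
        _ ≤ ENNReal.ofReal (ε * (2 * ρ)) := by
            refine ENNReal.ofReal_le_ofReal ((hε _ hr (min_le_right _ _)).trans ?_)
            have := min_le_left ρ δ
            gcongr
        _ = _ := by rw [Real.volume_ball, ENNReal.ofReal_mul hεpos.le]
    have h1 := lintegral_poissonKer_le ht x ENNReal.ofReal_ne_top hμ
    have hcm : AEMeasurable (fun y => ENNReal.ofReal (poissonKer t (x - y)))
        (volume.restrict (Metric.closedBall x δ)) :=
      ((continuous_poissonKer ht).comp (continuous_sub_left x)).aemeasurable.ennreal_ofReal
    rw [lintegral_withDensity_eq_lintegral_mul₀ hGm hcm] at h1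
    rw [← ENNReal.ofReal_le_ofReal_iff (by have := Real.pi_pos; positivity),
      ofReal_integral_eq_lintegral_ofReal hint.integrableOn (Eventually.of_forall hnn),
      ENNReal.ofReal_mul hεpos.le]
    refine le_trans (le_of_eq (lintegral_congr fun y => ?_)) h1
    rw [Pi.mul_apply, mul_comm, ENNReal.ofReal_mul (norm_nonneg _)]
  have far : ∫ y in (Metric.closedBall x δ)ᶜ, poissonKer t (x - y) * ‖g y - g x‖ ≤
      t * (C * M) := by
    have hint1 := ((integrable_poissonKer_mul_norm_sub hg one_pos x).const_mul C).const_mul t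
    calc _ ≤ ∫ y in (Metric.closedBall x δ)ᶜ,
          t * (C * (poissonKer 1 (x - y) * ‖g y - g x‖)) := by
          refine setIntegral_mono_on hint.integrableOn hint1.integrableOn hB.compl fun y hy => ?_
          rw [← mul_assoc, ← mul_assoc]
          refine mul_le_mul_of_nonneg_right ?_ (norm_nonneg _)
          have hu : δ ^ 2 < (x - y) ^ 2 := by
            rw [mem_compl_iff, Metric.mem_closedBall, not_le, dist_comm, Real.dist_eq] at hy
            rw [← sq_abs (x - y)]
            exact pow_lt_pow_left₀ hy hδ.le two_ne_zero
          unfold poissonKer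
          rw [mul_assoc, div_eq_mul_inv]
          refine mul_le_mul_of_nonneg_left ?_ ht.le
          rw [mul_one_div, hC, inv_le_comm₀ (by positivity) (by positivity), inv_div,
            div_le_iff₀ (by positivity)]
          have e : (t ^ 2 + (x - y) ^ 2) * (1 + (δ ^ 2)⁻¹) =
              (x - y) ^ 2 + (x - y) ^ 2 / δ ^ 2 + t ^ 2 * (1 + (δ ^ 2)⁻¹) := by ring
          rw [e]
          have h1 : 1 ≤ (x - y) ^ 2 / δ ^ 2 := by
            rw [one_le_div (by positivity)]; exact hu.le
          have h2 : 0 ≤ t ^ 2 * (1 + (δ ^ 2)⁻¹) := by positivity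
          linarith
      _ ≤ ∫ y, t * (C * (poissonKer 1 (x - y) * ‖g y - g x‖)) :=
          setIntegral_le_integral hint1 (Eventually.of_forall fun y => by
            have := poissonKer_nonneg one_pos (x - y)
            simp only [Pi.zero_apply]
            positivity)
      _ = _ := by rw [integral_const_mul, integral_const_mul]
  rw [Real.dist_eq, sub_zero, abs_of_nonneg (integral_nonneg hnn), ← integral_add_compl hB hint]
  have hlast : ε * Real.pi < η / 2 := by
    rw [hεdef, div_mul_eq_mul_div, div_lt_iff₀ (by have := Real.pi_pos; positivity)]
    nlinarith [Real.pi_pos]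
  linarith

variable [NormedSpace ℝ F] [CompleteSpace F]

theorem integrable_real_smul_of_memLp_two {f : ℝ → ℝ} {g : ℝ → F} (hf : MemLp f 2)
    (hg : MemLp g 2) : Integrable fun x => f x • g x :=
  memLp_one_iff_integrable.1 (MemLp.smul (r := 1) hg hf)

/-- Poisson integrals converge at Lebesgue points. -/
theorem IsLebesguePoint.tendsto_poisson {g : ℝ → F} (hg : MemLp g 2) {x : ℝ}
    (h : IsLebesguePoint g x) :
    Tendsto (fun t => ∫ y, poissonKer t (x - y) • g y) (𝓝[>] 0) (𝓝 (Real.pi • g x)) := by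
  rw [tendsto_iff_norm_sub_tendsto_zero]
  refine squeeze_zero' (Eventually.of_forall fun t => norm_nonneg _) ?_
    (h.tendsto_integral_poissonKer hg)
  filter_upwards [self_mem_nhdsWithin] with t ht
  replace ht : 0 < t := ht
  rw [← integral_poissonKer_sub ht x, ← integral_smul_const, ← integral_sub
    (integrable_real_smul_of_memLp_two (memLp_poissonKer_sub ht x) hg)
    ((integrable_poissonKer_sub ht x).smul_const _)]
  refine (norm_integral_le_integral_norm _).trans (le_of_eq ?_)
  refine integral_congr_ae (Eventually.of_forall fun y => ?_)
  simp only
  rw [← smul_sub, norm_smul, Real.norm_eq_abs, abs_of_nonneg (poissonKer_nonneg ht _)]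

/-- The kernel `u / (t² + u²)`, which is `π` times the conjugate Poisson kernel. -/
def conjPoissonKer (t u : ℝ) : ℝ := u / (t ^ 2 + u ^ 2)

theorem continuous_conjPoissonKer {t : ℝ} (ht : 0 < t) : Continuous (conjPoissonKer t) := by
  unfold conjPoissonKer
  exact continuous_id.div (by fun_prop) fun u => by positivity

theorem measurable_truncated (t : ℝ) :
    Measurable ({u : ℝ | t < |u|}.indicator fun u : ℝ => u⁻¹) :=
  measurable_inv.indicator (measurableSet_lt measurable_const measurable_norm)

/-- For $|u|>t$ the difference is $-t^2/(u(t^2+u^2))$ and $t^2/|u|\le t$; for $|u|\le t$ the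
truncated kernel is $0$ and $|u|\le t$. Thus the error of truncation is controlled by the Poisson
kernel. -/
theorem abs_conjPoissonKer_sub_le {t : ℝ} (ht : 0 < t) (u : ℝ) :
    |conjPoissonKer t u - {u : ℝ | t < |u|}.indicator (fun u => u⁻¹) u| ≤ poissonKer t u := by
  by_cases hu : t < |u|
  · have hu0 : u ≠ 0 := by
      rintro rfl
      simp at hu
      linarith
    rw [indicator_of_mem (by exact hu)]
    have e : conjPoissonKer t u - u⁻¹ = -(t ^ 2 / (u * (t ^ 2 + u ^ 2))) := by
      unfold conjPoissonKer
      field_simp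
      ring
    rw [e, abs_neg, abs_div, abs_mul, abs_of_pos (by positivity : 0 < t ^ 2),
      abs_of_pos (by positivity : 0 < t ^ 2 + u ^ 2), poissonKer, ← div_div]
    gcongr
    rw [div_le_iff₀ (by positivity), sq]
    exact mul_le_mul_of_nonneg_left hu.le ht.le
  · rw [indicator_of_notMem (by exact hu), sub_zero, conjPoissonKer, poissonKer, abs_div,
      abs_of_pos (by positivity : 0 < t ^ 2 + u ^ 2)]
    gcongr
    exact not_lt.1 hu

theorem conjPoissonKer_sub_integrable {t : ℝ} (ht : 0 < t) :
    Integrable fun u => conjPoissonKer t u - {u : ℝ | t < |u|}.indicator (fun u => u⁻¹) u :=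
  (integrable_poissonKer ht).mono'
    ((continuous_conjPoissonKer ht).measurable.sub (measurable_truncated t)).aestronglyMeasurable
    (Eventually.of_forall fun u => abs_conjPoissonKer_sub_le ht u)

theorem integral_conjPoissonKer_sub (t : ℝ) :
    ∫ u, (conjPoissonKer t u - {u : ℝ | t < |u|}.indicator (fun u => u⁻¹) u) = 0 := by
  have h := integral_neg_eq_self
    (fun u => conjPoissonKer t u - {u : ℝ | t < |u|}.indicator (fun u => u⁻¹) u) volume
  have e : ∀ u, conjPoissonKer t (-u) - {u : ℝ | t < |u|}.indicator (fun u => u⁻¹) (-u) =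
      -(conjPoissonKer t u - {u : ℝ | t < |u|}.indicator (fun u => u⁻¹) u) := by
    intro u
    by_cases hu : t < |u| <;> simp [conjPoissonKer, hu, neg_div, inv_neg, indicator]
    ring
  simp only [e, integral_neg] at h
  linarith

/-- When $|u|>\varepsilon$, $u^{-2}\le2/(\varepsilon^2+u^2)$, a multiple of the Poisson kernel at
height $\varepsilon$. -/
theorem memLp_truncated {ε : ℝ} (hε : 0 < ε) (x : ℝ) :
    MemLp (fun y => {u : ℝ | ε < |u|}.indicator (fun u => u⁻¹) (x - y)) 2 := by
  have hm : Measurable fun y => {u : ℝ | ε < |u|}.indicator (fun u => u⁻¹) (x - y) :=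
    (measurable_truncated ε).comp (measurable_const.sub measurable_id)
  refine (memLp_two_iff_integrable_sq hm.aestronglyMeasurable).2
    (((integrable_poissonKer_sub hε x).const_mul (2 * ε⁻¹)).mono' (hm.pow_const 2).aestronglyMeasurable
      (Eventually.of_forall fun y => ?_))
  rw [Real.norm_eq_abs, abs_of_nonneg (by positivity)]
  by_cases hu : ε < |x - y|
  · rw [indicator_of_mem (by exact hu), poissonKer]
    have hu2 : ε ^ 2 < (x - y) ^ 2 := by
      rw [← sq_abs (x - y)]
      exact pow_lt_pow_left₀ hu hε.le two_ne_zero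
    have hp : 0 < (x - y) ^ 2 := (by positivity : 0 < ε ^ 2).trans hu2
    have e : 2 * ε⁻¹ * (ε / (ε ^ 2 + (x - y) ^ 2)) = 2 / (ε ^ 2 + (x - y) ^ 2) := by
      field_simp
    rw [e, inv_pow, inv_eq_one_div, div_le_div_iff₀ hp (by positivity)]
    linarith
  · rw [indicator_of_notMem (by exact hu)]
    have := poissonKer_nonneg hε (x - y)
    rw [zero_pow two_ne_zero]
    positivity

theorem memLp_conjPoissonKer_sub {t : ℝ} (ht : 0 < t) (x : ℝ) :
    MemLp (fun y => conjPoissonKer t (x - y)) 2 := by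
  have hm : Continuous fun y => conjPoissonKer t (x - y) :=
    (continuous_conjPoissonKer ht).comp (continuous_sub_left x)
  refine (memLp_two_iff_integrable_sq hm.aestronglyMeasurable).2
    (((integrable_poissonKer_sub ht x).const_mul t⁻¹).mono' (hm.pow 2).aestronglyMeasurable
      (Eventually.of_forall fun y => ?_))
  rw [Real.norm_eq_abs, abs_of_nonneg (by positivity), conjPoissonKer, poissonKer, div_pow]
  have e : t⁻¹ * (t / (t ^ 2 + (x - y) ^ 2)) =
      (t ^ 2 + (x - y) ^ 2) / (t ^ 2 + (x - y) ^ 2) ^ 2 := by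
    field_simp
  rw [e]
  gcongr
  have := sq_nonneg t
  linarith

/-- At Lebesgue points, principal values are limits of conjugate Poisson integrals. -/
theorem IsLebesguePoint.tendsto_truncated {g : ℝ → F} (hg : MemLp g 2) {x : ℝ}
    (h : IsLebesguePoint g x) {L : F}
    (hL : Tendsto (fun t => ∫ y, conjPoissonKer t (x - y) • g y) (𝓝[>] 0) (𝓝 L)) :
    Tendsto (fun ε => ∫ y, {u : ℝ | ε < |u|}.indicator (fun u => u⁻¹) (x - y) • g y)
      (𝓝[>] 0) (𝓝 L) := by
  have h0 : Tendsto (fun t => (∫ y, conjPoissonKer t (x - y) • g y) -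
      ∫ y, {u : ℝ | t < |u|}.indicator (fun u => u⁻¹) (x - y) • g y) (𝓝[>] 0) (𝓝 0) := by
    refine squeeze_zero_norm' ?_ (h.tendsto_integral_poissonKer hg)
    filter_upwards [self_mem_nhdsWithin] with t ht
    replace ht : 0 < t := ht
    have hd := (conjPoissonKer_sub_integrable ht).comp_sub_left x
    have hz : ∫ y, (conjPoissonKer t (x - y) -
        {u : ℝ | t < |u|}.indicator (fun u => u⁻¹) (x - y)) = 0 := by
      rw [integral_sub_left_eq_self (fun u => conjPoissonKer t u -
        {u : ℝ | t < |u|}.indicator (fun u => u⁻¹) u) volume x, integral_conjPoissonKer_sub]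
    -- The difference of the kernels is odd and integrable, so its integral is $0$ and the constant
    -- `g x` may be subtracted from `g`.
    have e : (∫ y, conjPoissonKer t (x - y) • g y) -
        (∫ y, {u : ℝ | t < |u|}.indicator (fun u => u⁻¹) (x - y) • g y) =
        ∫ y, (conjPoissonKer t (x - y) -
          {u : ℝ | t < |u|}.indicator (fun u => u⁻¹) (x - y)) • (g y - g x) := by
      rw [← integral_sub (integrable_real_smul_of_memLp_two (memLp_conjPoissonKer_sub ht x) hg)
        (integrable_real_smul_of_memLp_two (memLp_truncated ht x) hg)]
      have e2 : (0 : F) = ∫ y, (conjPoissonKer t (x - y) -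
          {u : ℝ | t < |u|}.indicator (fun u => u⁻¹) (x - y)) • g x := by
        rw [integral_smul_const, hz, zero_smul]
      simp only [← sub_smul]
      rw [← sub_zero (∫ y, _), e2, ← integral_sub _ (hd.smul_const _)]
      · simp only [smul_sub]
      · have := ((memLp_conjPoissonKer_sub ht x).sub (memLp_truncated ht x))
        exact integrable_real_smul_of_memLp_two this hg
    rw [e]
    refine norm_integral_le_of_norm_le (integrable_poissonKer_mul_norm_sub hg ht x)
      (Eventually.of_forall fun y => ?_)
    rw [norm_smul]
    exact mul_le_mul_of_nonneg_right (abs_conjPoissonKer_sub_le ht _) (norm_nonneg _)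
  simpa using hL.sub h0

end LebesguePoints

/-! ### $H^1$ functions, reflection and multiplication by sgn. -/

section WeakDerivPairs

/-- `u ∈ H¹(ℝ)` with weak derivative `v`. -/
structure IsH1Pair (u v : ℝ → ℂ) : Prop where
  memLp : MemLp u 2
  memLp_deriv : MemLp v 2
  isWeakDeriv : IsWeakDeriv u v

theorem MemH1.isH1Pair {u : ℝ → ℂ} (h : MemH1 u) : IsH1Pair u (weakDeriv u) :=
  ⟨h.1, h.memLp_weakDeriv, h.isWeakDeriv⟩

namespace IsH1Pair

variable {u v u' v' : ℝ → ℂ}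

theorem memH1 (h : IsH1Pair u v) : MemH1 u := ⟨h.memLp, v, h.memLp_deriv, h.isWeakDeriv⟩

theorem add (h : IsH1Pair u v) (h' : IsH1Pair u' v') : IsH1Pair (u + u') (v + v') :=
  ⟨h.memLp.add h'.memLp, h.memLp_deriv.add h'.memLp_deriv,
    h.isWeakDeriv.add h'.isWeakDeriv h.memLp h'.memLp h.memLp_deriv h'.memLp_deriv⟩

theorem const_smul (h : IsH1Pair u v) (c : ℂ) : IsH1Pair (c • u) (c • v) :=
  ⟨h.memLp.const_smul c, h.memLp_deriv.const_smul c, h.isWeakDeriv.const_smul c⟩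

theorem congr (h : IsH1Pair u v) (hu : u =ᵐ[volume] u') (hv : v =ᵐ[volume] v') :
    IsH1Pair u' v' := by
  refine ⟨h.memLp.ae_eq hu, h.memLp_deriv.ae_eq hv, fun φ hφ hc => ?_⟩
  rw [h.isWeakDeriv.congr hu φ hφ hc]
  congr 1
  exact integral_congr_ae (hv.mono fun x hx => by simp only [hx])

theorem sub (h : IsH1Pair u v) (h' : IsH1Pair u' v') : IsH1Pair (u - u') (v - v') := by
  have := h.add (h'.const_smul (-1))
  simpa [sub_eq_add_neg] using this

theorem _root_.memLp_comp_neg {F : Type*} [NormedAddCommGroup F] {u : ℝ → F} (hu : MemLp u 2) :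
    MemLp (fun x => u (-x)) 2 :=
  hu.comp_measurePreserving (Measure.measurePreserving_neg (volume : Measure ℝ))

theorem comp_neg (h : IsH1Pair u v) : IsH1Pair (fun x => u (-x)) (fun x => -v (-x)) := by
  refine ⟨memLp_comp_neg h.memLp, (memLp_comp_neg h.memLp_deriv).neg, fun φ hφ hc => ?_⟩
  have h1 := h.isWeakDeriv (fun x => φ (-x)) (hφ.comp contDiff_neg)
    (hc.comp_homeomorph (Homeomorph.neg ℝ))
  rw [← integral_neg_eq_self, ← integral_neg_eq_self (fun x => φ x • -v (-x))]
  simp only [neg_neg, deriv_comp_neg, neg_smul, integral_neg, smul_neg] at h1 ⊢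
  exact neg_inj.1 h1

end IsH1Pair

/-- Smooth approximations of the sign function. -/
def smoothSign (ε x : ℝ) : ℝ := x / √(x ^ 2 + ε ^ 2)

theorem contDiff_smoothSign {ε : ℝ} (hε : 0 < ε) : ContDiff ℝ ∞ (smoothSign ε) := by
  unfold smoothSign
  refine contDiff_id.div (ContDiff.sqrt (by fun_prop) fun x => by positivity) fun x => ?_
  positivity

theorem hasDerivAt_smoothSign {ε : ℝ} (hε : 0 < ε) (x : ℝ) :
    HasDerivAt (smoothSign ε) (ε ^ 2 / ((x ^ 2 + ε ^ 2) * √(x ^ 2 + ε ^ 2))) x := by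
  have hp : 0 < x ^ 2 + ε ^ 2 := by positivity
  have h1 : HasDerivAt (fun x : ℝ => x ^ 2 + ε ^ 2) (2 * x) x := by
    simpa using (hasDerivAt_pow 2 x).add_const (ε ^ 2)
  have h2 := (hasDerivAt_id x).div (h1.sqrt hp.ne') (Real.sqrt_pos.2 hp).ne'
  refine h2.congr_deriv ?_
  have hr := (Real.sqrt_pos.2 hp).ne'
  have hs := Real.sq_sqrt hp.le
  set r := √(x ^ 2 + ε ^ 2)
  simp only [id]
  rw [← hs]
  field_simp
  rw [hs]
  ring

theorem abs_le_sqrt_sq_add_sq (ε x : ℝ) : |x| ≤ √(x ^ 2 + ε ^ 2) := by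
  rw [← Real.sqrt_sq_eq_abs]
  exact Real.sqrt_le_sqrt (by have := sq_nonneg ε; linarith)

theorem abs_smoothSign_le (ε x : ℝ) : |smoothSign ε x| ≤ 1 := by
  rw [smoothSign, abs_div, abs_of_nonneg (Real.sqrt_nonneg _)]
  exact div_le_one_of_le₀ (abs_le_sqrt_sq_add_sq ε x) (Real.sqrt_nonneg _)

/-- The derivatives approximate $2\delta_0$; this bound, uniform in `ε`, makes them harmless against
functions that vanish linearly at $0$. -/
theorem abs_deriv_smoothSign_mul_le {ε : ℝ} (hε : 0 < ε) (x : ℝ) :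
    |deriv (smoothSign ε) x| * |x| ≤ 1 := by
  have hp : 0 < x ^ 2 + ε ^ 2 := by positivity
  rw [(hasDerivAt_smoothSign hε x).deriv, abs_of_nonneg (by positivity), div_mul_eq_mul_div]
  refine div_le_one_of_le₀ (mul_le_mul ?_ (abs_le_sqrt_sq_add_sq ε x) (abs_nonneg _) hp.le)
    (by positivity)
  have := sq_nonneg x
  linarith

theorem tendsto_smoothSign {e : ℕ → ℝ} (he : Tendsto e atTop (𝓝 0)) (x : ℝ) :
    Tendsto (fun n => smoothSign (e n) x) atTop (𝓝 (Real.sign x)) := by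
  rcases eq_or_ne x 0 with rfl | hx
  · simp [smoothSign]
  have h1 : Tendsto (fun n => √(x ^ 2 + e n ^ 2)) atTop (𝓝 |x|) := by
    rw [← Real.sqrt_sq_eq_abs]
    refine (Real.continuous_sqrt.tendsto _).comp ?_
    simpa using (he.pow 2).const_add (x ^ 2)
  have h2 := (tendsto_const_nhds (x := x)).div h1 (abs_ne_zero.2 hx)
  have h3 : x / |x| = Real.sign x := by
    rcases lt_or_gt_of_ne hx with h | h
    · rw [abs_of_neg h, Real.sign_of_neg h, div_neg, div_self hx]
    · rw [abs_of_pos h, Real.sign_of_pos h, div_self hx]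
  rwa [h3] at h2

theorem tendsto_deriv_smoothSign {e : ℕ → ℝ} (he : Tendsto e atTop (𝓝 0)) (hpos : ∀ n, 0 < e n)
    {x : ℝ} (hx : x ≠ 0) : Tendsto (fun n => deriv (smoothSign (e n)) x) atTop (𝓝 0) := by
  simp only [fun n => (hasDerivAt_smoothSign (hpos n) x).deriv]
  have h1 : Tendsto (fun n => x ^ 2 + e n ^ 2) atTop (𝓝 (x ^ 2)) := by
    simpa using (he.pow 2).const_add (x ^ 2)
  have h2 := (he.pow 2).div (h1.mul ((Real.continuous_sqrt.tendsto _).comp h1)) (by positivity)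
  rw [zero_pow two_ne_zero, zero_div] at h2
  exact h2

theorem ofReal_sign (x : ℝ) : (Real.sign x : ℂ) = sgn x := rfl

theorem sgn_neg (x : ℝ) : sgn (-x) = -sgn x := by
  simp [sgn, Real.sign_neg]

theorem sgn_mul_self {x : ℝ} (hx : x ≠ 0) : sgn x * sgn x = 1 := by
  rcases lt_or_gt_of_ne hx with h | h
  · simp [sgn_of_neg h]
  · simp [sgn_of_pos h]

/-- Multiplication by `sgn` of a test function vanishing at `0`. -/
theorem IsH1Pair.integral_sgn_of_abs_le {w z : ℝ → ℂ} (h : IsH1Pair w z) {ρ : ℝ → ℝ}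
    (hρ : ContDiff ℝ ∞ ρ) (hc : HasCompactSupport ρ) {C : ℝ} (hC : ∀ x, |ρ x| ≤ C * |x|) :
    ∫ x, deriv ρ x • (sgn x * w x) = -∫ x, ρ x • (sgn x * z x) := by
  let e : ℕ → ℝ := fun n => ((n : ℝ) + 1)⁻¹
  have he : Tendsto e atTop (𝓝 0) := tendsto_inv_atTop_nhds_zero_nat.comp
    (tendsto_add_atTop_nat 1) |>.congr fun n => by simp [e]
  have hpos : ∀ n, 0 < e n := fun n => by positivity
  have hC0 : 0 ≤ C := by
    have := (abs_nonneg _).trans (hC 1)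
    simpa using this
  have hdρ : Continuous (deriv ρ) := hρ.continuous_deriv (by simp)
  have hds : ∀ n, Continuous (deriv (smoothSign (e n))) := fun n =>
    (contDiff_smoothSign (hpos n)).continuous_deriv (by simp)
  have hsρ : ∀ n, ContDiff ℝ ∞ fun x => smoothSign (e n) x * ρ x := fun n =>
    (contDiff_smoothSign (hpos n)).mul hρ
  have hn : ∀ n, (∫ x, (deriv (smoothSign (e n)) x * ρ x) • w x) +
      (∫ x, (smoothSign (e n) x * deriv ρ x) • w x) =
      -∫ x, (smoothSign (e n) x * ρ x) • z x := by
    intro n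
    rw [← h.isWeakDeriv _ (hsρ n) hc.mul_left, ← integral_add]
    · refine integral_congr_ae (Eventually.of_forall fun x => ?_)
      have hd : deriv (fun x => smoothSign (e n) x * ρ x) x =
          deriv (smoothSign (e n)) x * ρ x + smoothSign (e n) x * deriv ρ x :=
        (((contDiff_smoothSign (hpos n)).differentiable (by simp) x).hasDerivAt.mul
          (hρ.differentiable (by simp) x).hasDerivAt).deriv
      simp only [hd, add_smul]
    · exact integrable_test_smul ((hds n).mul hρ.continuous) hc.mul_left h.memLp
    · exact integrable_test_smul ((contDiff_smoothSign (hpos n)).continuous.mul hdρ)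
        hc.deriv.mul_left h.memLp
  -- The term that would produce a point mass at $0$. Since $|\rho|\le C|x|$, the factor in front of
  -- `w` is bounded by `C` on the support of `ρ`, and it tends to $0$ pointwise.
  have l1 : Tendsto (fun n => ∫ x, (deriv (smoothSign (e n)) x * ρ x) • w x) atTop (𝓝 0) := by
    rw [← integral_zero ℝ ℂ (μ := volume)]
    refine tendsto_integral_of_dominated_convergence
      (fun x => (tsupport ρ).indicator (fun x => C * ‖w x‖) x) (fun n => ?_) ?_ (fun n => ?_) ?_
    · exact (integrable_test_smul ((hds n).mul hρ.continuous) hc.mul_left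
        h.memLp).aestronglyMeasurable
    · rw [integrable_indicator_iff (isClosed_tsupport ρ).measurableSet]
      exact (((h.memLp.locallyIntegrable (by norm_num)).integrableOn_isCompact hc).norm).const_mul C
    · refine Eventually.of_forall fun x => ?_
      by_cases hx : x ∈ tsupport ρ
      · rw [indicator_of_mem hx, norm_smul]
        refine mul_le_mul_of_nonneg_right ?_ (norm_nonneg _)
        rw [Real.norm_eq_abs, abs_mul]
        calc _ ≤ |deriv (smoothSign (e n)) x| * (C * |x|) :=
              mul_le_mul_of_nonneg_left (hC x) (abs_nonneg _)
          _ = C * (|deriv (smoothSign (e n)) x| * |x|) := by ring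
          _ ≤ C * 1 := mul_le_mul_of_nonneg_left (abs_deriv_smoothSign_mul_le (hpos n) x) hC0
          _ = C := mul_one C
      · rw [indicator_of_notMem hx, image_eq_zero_of_notMem_tsupport hx]
        simp
    · refine Eventually.of_forall fun x => ?_
      rcases eq_or_ne x 0 with rfl | hx
      · have h0 : ρ 0 = 0 := by simpa using hC 0
        simp [h0]
      · simpa using ((tendsto_deriv_smoothSign he hpos hx).mul_const (ρ x)).smul_const (w x)
  have l2 : Tendsto (fun n => ∫ x, (smoothSign (e n) x * deriv ρ x) • w x) atTop
      (𝓝 (∫ x, deriv ρ x • (sgn x * w x))) := by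
    refine tendsto_integral_of_dominated_convergence
      (fun x => ‖deriv ρ x • w x‖) (fun n => ?_) ?_ (fun n => ?_) ?_
    · exact (integrable_test_smul ((contDiff_smoothSign (hpos n)).continuous.mul hdρ)
        hc.deriv.mul_left h.memLp).aestronglyMeasurable
    · exact (integrable_test_smul hdρ hc.deriv h.memLp).norm
    · refine Eventually.of_forall fun x => ?_
      rw [mul_smul, norm_smul]
      exact mul_le_of_le_one_left (norm_nonneg _) (abs_smoothSign_le _ _)
    · refine Eventually.of_forall fun x => ?_
      have := ((tendsto_smoothSign he x).mul_const (deriv ρ x)).smul_const (w x)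
      convert this using 2
      rw [mul_comm (Real.sign x), mul_smul, Complex.real_smul (x := Real.sign x), ofReal_sign]
  have l3 : Tendsto (fun n => ∫ x, (smoothSign (e n) x * ρ x) • z x) atTop
      (𝓝 (∫ x, ρ x • (sgn x * z x))) := by
    refine tendsto_integral_of_dominated_convergence
      (fun x => ‖ρ x • z x‖) (fun n => ?_) ?_ (fun n => ?_) ?_
    · exact (integrable_test_smul (hsρ n).continuous hc.mul_left
        h.memLp_deriv).aestronglyMeasurable
    · exact (integrable_test_smul hρ.continuous hc h.memLp_deriv).norm
    · refine Eventually.of_forall fun x => ?_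
      rw [mul_smul, norm_smul]
      exact mul_le_of_le_one_left (norm_nonneg _) (abs_smoothSign_le _ _)
    · refine Eventually.of_forall fun x => ?_
      have := ((tendsto_smoothSign he x).mul_const (ρ x)).smul_const (z x)
      convert this using 2
      rw [mul_comm (Real.sign x), mul_smul, Complex.real_smul (x := Real.sign x), ofReal_sign]
  have := l1.add l2
  rw [zero_add] at this
  exact tendsto_nhds_unique (this.congr hn) l3.neg

/-- The product of `sgn` with an odd `H¹` function is in `H¹`. -/
theorem IsH1Pair.sgn_mul_odd {u v : ℝ → ℂ} (h : IsH1Pair u v) :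
    IsH1Pair (fun x => sgn x * (u x - u (-x))) (fun x => sgn x * (v x + v (-x))) := by
  have hp : IsH1Pair (fun x => u x - u (-x)) (fun x => v x + v (-x)) := by
    refine (h.sub h.comp_neg).congr (Eventually.of_forall fun x => rfl)
      (Eventually.of_forall fun x => ?_)
    simp
  refine ⟨memLp_sgn_mul hp.memLp, memLp_sgn_mul hp.memLp_deriv, fun φ hφ hc => ?_⟩
  -- Twice the odd part of `φ`, which vanishes at $0$. As sgn times an odd function is even and
  -- $\mathrm{sgn}(x)(v(x)+v(-x))$ is odd, testing with `ρ` gives exactly twice the result of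
  -- testing with `φ`.
  let ρ : ℝ → ℝ := fun x => φ x - φ (-x)
  have hφ' : ContDiff ℝ ∞ fun x => φ (-x) := hφ.comp contDiff_neg
  have hc' : HasCompactSupport fun x => φ (-x) := hc.comp_homeomorph (Homeomorph.neg ℝ)
  have hρ : ContDiff ℝ ∞ ρ := hφ.sub hφ'
  have hcρ : HasCompactSupport ρ := hc.sub hc'
  have hdρ : ∀ x, deriv ρ x = deriv φ x + deriv φ (-x) := by
    intro x
    have := deriv_sub (hφ.differentiable (by simp) x) (hφ'.differentiable (by simp) x)
    rw [deriv_comp_neg, sub_neg_eq_add] at this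
    exact this
  have hdφ : Continuous (deriv φ) := hφ.continuous_deriv (by simp)
  have hdφ' : Continuous fun x => deriv φ (-x) := hdφ.comp continuous_neg
  have hdc' : HasCompactSupport fun x => deriv φ (-x) :=
    hc.deriv.comp_homeomorph (Homeomorph.neg ℝ)
  obtain ⟨K, hK⟩ := hcρ.deriv.exists_bound_of_continuous (hρ.continuous_deriv (by simp))
  have hCρ : ∀ x, |ρ x| ≤ K * |x| := by
    intro x
    have := Convex.norm_image_sub_le_of_norm_deriv_le (f := ρ) (s := univ) (x := 0) (y := x)
      (fun y _ => hρ.differentiable (by simp) y) (fun y _ => hK y) convex_univ trivial trivial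
    simpa [ρ] using this
  have key := hp.integral_sgn_of_abs_le hρ hcρ hCρ
  have m1 := memLp_sgn_mul hp.memLp
  have m2 := memLp_sgn_mul hp.memLp_deriv
  have e1 : ∫ x, deriv ρ x • (sgn x * (u x - u (-x))) =
      2 * ∫ x, deriv φ x • (sgn x * (u x - u (-x))) := by
    simp only [hdρ, add_smul]
    rw [integral_add (integrable_test_smul hdφ hc.deriv m1)
      (integrable_test_smul hdφ' hdc' m1), two_mul]
    congr 1
    rw [← integral_neg_eq_self]
    refine integral_congr_ae (Eventually.of_forall fun x => ?_)
    simp only [neg_neg, sgn_neg]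
    congr 1
    ring
  have e2 : ∫ x, ρ x • (sgn x * (v x + v (-x))) =
      2 * ∫ x, φ x • (sgn x * (v x + v (-x))) := by
    simp only [ρ, sub_smul]
    rw [integral_sub (integrable_test_smul hφ.continuous hc m2)
      (integrable_test_smul hφ'.continuous hc' m2), two_mul, sub_eq_add_neg]
    congr 1
    rw [← integral_neg, ← integral_neg_eq_self]
    refine integral_congr_ae (Eventually.of_forall fun x => ?_)
    simp only [neg_neg, sgn_neg]
    rw [← smul_neg]
    congr 1
    ring
  rw [e1, e2, ← mul_neg] at key
  exact mul_left_cancel₀ two_ne_zero key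

end WeakDerivPairs

/-! ### The unitary unfolding of $L_2(\mathbf R;\mathbf C^2)$. -/

section Unfolding

theorem ae_comp_neg {p : ℝ → Prop} (h : ∀ᵐ x : ℝ, p x) : ∀ᵐ x : ℝ, p (-x) :=
  (Measure.measurePreserving_neg (volume : Measure ℝ)).quasiMeasurePreserving.ae h

theorem ae_ne_zero : ∀ᵐ x : ℝ, x ≠ 0 := by
  simp [ae_iff]

/-- The phase `(1 - i k sgn x) / √(1 + k²)`. -/
def phase (k x : ℝ) : ℂ := (1 - Complex.I * k * sgn x) / (√(1 + k ^ 2) : ℝ)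

theorem sqrt_one_add_sq_ne_zero (k : ℝ) : ((√(1 + k ^ 2) : ℝ) : ℂ) ≠ 0 := by
  have : 0 < √(1 + k ^ 2) := Real.sqrt_pos.2 (by positivity)
  exact_mod_cast this.ne'

theorem sq_sqrt_one_add_sq (k : ℝ) : ((√(1 + k ^ 2) : ℝ) : ℂ) ^ 2 = 1 + (k : ℂ) ^ 2 := by
  have : √(1 + k ^ 2) ^ 2 = 1 + k ^ 2 := Real.sq_sqrt (by positivity)
  exact_mod_cast this

/-- The origin is excluded because `sgn 0 = 0` makes `phase k 0` equal to $1/\sqrt{1+k^2}$.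
Identities involving the phase therefore hold almost everywhere only. -/
theorem phase_mul_phase_neg (k : ℝ) {x : ℝ} (hx : x ≠ 0) : phase k x * phase k (-x) = 1 := by
  have h0 := sqrt_one_add_sq_ne_zero k
  have h1 := sq_sqrt_one_add_sq k
  have h2 := sgn_mul_self hx
  rw [phase, phase, sgn_neg, div_mul_div_comm, ← sq, h1, div_eq_one_iff_eq (h1 ▸ pow_ne_zero 2 h0)]
  linear_combination (k : ℂ) ^ 2 * h2 - (k : ℂ) ^ 2 * sgn x * sgn x * Complex.I_sq

theorem conj_phase (k x : ℝ) : (starRingEnd ℂ) (phase k x) = phase k (-x) := by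
  rw [phase, phase, sgn_neg]
  simp [sgn]

theorem norm_phase (k : ℝ) {x : ℝ} (hx : x ≠ 0) : ‖phase k x‖ = 1 := by
  have h := phase_mul_phase_neg k hx
  rw [← conj_phase, Complex.mul_conj'] at h
  have : ‖phase k x‖ ^ 2 = 1 := by exact_mod_cast h
  exact (pow_eq_one_iff_of_nonneg (norm_nonneg _) two_ne_zero).1 this

theorem measurable_phase (k : ℝ) : Measurable (phase k) := by
  unfold phase
  exact (measurable_const.sub (measurable_const.mul measurable_sgn)).div_const _

/-- The transformation of `L₂(ℝ; ℂ²)` which turns `T_k` into `-i d/dx`, at the level of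
functions. -/
def unfoldFun (k : ℝ) (f : ℝ → EuclideanSpace ℂ (Fin 2)) (x : ℝ) : EuclideanSpace ℂ (Fin 2) :=
  !₂[phase k x * (f x 0 + Complex.I * f x 1 + (f (-x) 0 - Complex.I * f (-x) 1)) / 2,
    (f x 0 + Complex.I * f x 1 - (f (-x) 0 - Complex.I * f (-x) 1)) / 2]

/-- The inverse of `unfoldFun`. -/
def foldFun (k : ℝ) (h : ℝ → EuclideanSpace ℂ (Fin 2)) (x : ℝ) : EuclideanSpace ℂ (Fin 2) :=
  !₂[(phase k (-x) * h x 0 + h x 1 + phase k x * h (-x) 0 - h (-x) 1) / 2,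
    (phase k (-x) * h x 0 + h x 1 - phase k x * h (-x) 0 + h (-x) 1) / (2 * Complex.I)]

theorem unfoldFun_zero (k : ℝ) (f : ℝ → EuclideanSpace ℂ (Fin 2)) (x : ℝ) :
    unfoldFun k f x 0 =
      phase k x * (f x 0 + Complex.I * f x 1 + (f (-x) 0 - Complex.I * f (-x) 1)) / 2 := rfl

theorem unfoldFun_one (k : ℝ) (f : ℝ → EuclideanSpace ℂ (Fin 2)) (x : ℝ) :
    unfoldFun k f x 1 =
      (f x 0 + Complex.I * f x 1 - (f (-x) 0 - Complex.I * f (-x) 1)) / 2 := rfl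

theorem foldFun_zero (k : ℝ) (h : ℝ → EuclideanSpace ℂ (Fin 2)) (x : ℝ) :
    foldFun k h x 0 =
      (phase k (-x) * h x 0 + h x 1 + phase k x * h (-x) 0 - h (-x) 1) / 2 := rfl

theorem foldFun_one (k : ℝ) (h : ℝ → EuclideanSpace ℂ (Fin 2)) (x : ℝ) :
    foldFun k h x 1 =
      (phase k (-x) * h x 0 + h x 1 - phase k x * h (-x) 0 + h (-x) 1) / (2 * Complex.I) := rfl

theorem unfoldFun_foldFun (k : ℝ) (h : ℝ → EuclideanSpace ℂ (Fin 2)) {x : ℝ} (hx : x ≠ 0) :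
    unfoldFun k (foldFun k h) x = h x := by
  have h1 := phase_mul_phase_neg k hx
  have hI := Complex.I_ne_zero
  ext i
  fin_cases i
  · change unfoldFun k (foldFun k h) x 0 = h x 0
    simp only [unfoldFun_zero, foldFun_zero, foldFun_one, neg_neg]
    field_simp
    linear_combination (4 * h x 0) * h1
  · change unfoldFun k (foldFun k h) x 1 = h x 1
    simp only [unfoldFun_one, foldFun_zero, foldFun_one, neg_neg]
    field_simp
    ring

theorem foldFun_unfoldFun (k : ℝ) (f : ℝ → EuclideanSpace ℂ (Fin 2)) {x : ℝ} (hx : x ≠ 0) :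
    foldFun k (unfoldFun k f) x = f x := by
  have h1 := phase_mul_phase_neg k hx
  have hI := Complex.I_ne_zero
  ext i
  fin_cases i
  · change foldFun k (unfoldFun k f) x 0 = f x 0
    simp only [unfoldFun_zero, unfoldFun_one, foldFun_zero, neg_neg]
    linear_combination (f x 0 + f (-x) 0 + Complex.I * f x 1 - Complex.I * f (-x) 1 +
      f x 0 + f (-x) 0 - Complex.I * f x 1 + Complex.I * f (-x) 1) / 4 * h1
  · change foldFun k (unfoldFun k f) x 1 = f x 1
    simp only [unfoldFun_zero, unfoldFun_one, foldFun_one, neg_neg]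
    field_simp
    linear_combination 2 * Complex.I * (f x 1 - f (-x) 1) * h1

theorem memLp_coord {f : ℝ → EuclideanSpace ℂ (Fin 2)} (hf : MemLp f 2) (i : Fin 2) :
    MemLp (fun x => f x i) 2 :=
  (memLp_piLp_iff.1 hf) i

theorem memLp_phase_mul (k : ℝ) {u : ℝ → ℂ} (hu : MemLp u 2) :
    MemLp (fun x => phase k x * u x) 2 := by
  refine hu.of_le ((measurable_phase k).aestronglyMeasurable.mul hu.1) ?_
  filter_upwards [ae_ne_zero] with x hx
  rw [norm_mul, norm_phase k hx, one_mul]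

theorem memLp_phase_neg_mul (k : ℝ) {u : ℝ → ℂ} (hu : MemLp u 2) :
    MemLp (fun x => phase k (-x) * u x) 2 := by
  refine hu.of_le (((measurable_phase k).comp measurable_neg).aestronglyMeasurable.mul hu.1) ?_
  filter_upwards [ae_ne_zero] with x hx
  rw [norm_mul, norm_phase k (neg_ne_zero.2 hx), one_mul]

theorem memLp_unfoldFun (k : ℝ) {f : ℝ → EuclideanSpace ℂ (Fin 2)} (hf : MemLp f 2) :
    MemLp (unfoldFun k f) 2 := by
  have h0 := memLp_coord hf 0
  have h1 := memLp_coord hf 1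
  have hp := h0.add (h1.const_mul Complex.I)
  have hm := memLp_comp_neg (h0.sub (h1.const_mul Complex.I))
  rw [memLp_piLp_iff]
  intro i
  fin_cases i
  · have := (memLp_phase_mul k (hp.add hm)).const_mul (2⁻¹ : ℂ)
    refine this.ae_eq (Eventually.of_forall fun x => ?_)
    simp [unfoldFun]
    ring
  · have := (hp.sub hm).const_mul (2⁻¹ : ℂ)
    refine this.ae_eq (Eventually.of_forall fun x => ?_)
    simp [unfoldFun]
    ring

theorem memLp_foldFun (k : ℝ) {f : ℝ → EuclideanSpace ℂ (Fin 2)} (hf : MemLp f 2) :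
    MemLp (foldFun k f) 2 := by
  have h0 := memLp_coord hf 0
  have h1 := memLp_coord hf 1
  have a := memLp_phase_neg_mul k h0
  have b := memLp_phase_mul k (memLp_comp_neg h0)
  have c := memLp_comp_neg h1
  rw [memLp_piLp_iff]
  intro i
  fin_cases i
  · have := (((a.add h1).add b).sub c).const_mul (2⁻¹ : ℂ)
    refine this.ae_eq (Eventually.of_forall fun x => ?_)
    simp [foldFun]
    ring
  · have := (((a.add h1).sub b).add c).const_mul ((2 * Complex.I)⁻¹ : ℂ)
    refine this.ae_eq (Eventually.of_forall fun x => ?_)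
    simp [foldFun, div_eq_mul_inv]
    ring

/-- The phase is unimodular and the parallelogram law undoes the sum and difference. After
integration the reflection disappears, which together with `norm_sq_eq_half` makes the unfolding
isometric. -/
theorem norm_sq_unfoldFun (k : ℝ) (f : ℝ → EuclideanSpace ℂ (Fin 2)) {x : ℝ} (hx : x ≠ 0) :
    ‖unfoldFun k f x‖ ^ 2 =
      (‖f x 0 + Complex.I * f x 1‖ ^ 2 + ‖f (-x) 0 - Complex.I * f (-x) 1‖ ^ 2) / 2 := by
  rw [EuclideanSpace.norm_sq_eq, Fin.sum_univ_two, unfoldFun_zero, unfoldFun_one, norm_div,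
    norm_div, norm_mul, norm_phase k hx, one_mul]
  have := parallelogram_law_with_norm ℝ (f x 0 + Complex.I * f x 1)
    (f (-x) 0 - Complex.I * f (-x) 1)
  simp only [RCLike.norm_ofNat]
  linarith

theorem norm_sq_eq_half (v : EuclideanSpace ℂ (Fin 2)) :
    ‖v‖ ^ 2 = (‖v 0 + Complex.I * v 1‖ ^ 2 + ‖v 0 - Complex.I * v 1‖ ^ 2) / 2 := by
  have := parallelogram_law_with_norm ℝ (v 0) (Complex.I * v 1)
  rw [norm_mul, Complex.norm_I, one_mul] at this
  rw [EuclideanSpace.norm_sq_eq, Fin.sum_univ_two]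
  linarith

theorem integral_norm_sq_unfoldFun (k : ℝ) {f : ℝ → EuclideanSpace ℂ (Fin 2)} (hf : MemLp f 2) :
    ∫ x, ‖unfoldFun k f x‖ ^ 2 = ∫ x, ‖f x‖ ^ 2 := by
  have h0 := memLp_coord hf 0
  have h1 := memLp_coord hf 1
  have hp : Integrable fun x => ‖f x 0 + Complex.I * f x 1‖ ^ 2 :=
    (h0.add (h1.const_mul Complex.I)).integrable_norm_pow (by simp)
  have hm : Integrable fun x => ‖f x 0 - Complex.I * f x 1‖ ^ 2 :=
    (h0.sub (h1.const_mul Complex.I)).integrable_norm_pow (by simp)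
  rw [integral_congr_ae (ae_ne_zero.mono fun x hx => norm_sq_unfoldFun k f hx),
    integral_congr_ae (Eventually.of_forall fun x => norm_sq_eq_half (f x)), integral_div,
    integral_div, integral_add hp hm.comp_neg, integral_add hp hm,
    integral_neg_eq_self (fun x => ‖f x 0 - Complex.I * f x 1‖ ^ 2)]

theorem unfoldFun_congr (k : ℝ) {f g : ℝ → EuclideanSpace ℂ (Fin 2)} (h : f =ᵐ[volume] g) :
    unfoldFun k f =ᵐ[volume] unfoldFun k g := by
  filter_upwards [h, ae_comp_neg h] with x h1 h2
  rw [unfoldFun, unfoldFun, h1, h2]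

theorem foldFun_congr (k : ℝ) {f g : ℝ → EuclideanSpace ℂ (Fin 2)} (h : f =ᵐ[volume] g) :
    foldFun k f =ᵐ[volume] foldFun k g := by
  filter_upwards [h, ae_comp_neg h] with x h1 h2
  rw [foldFun, foldFun, h1, h2]

/-- The unitary operator on `L₂(ℝ; ℂ²)` which turns `T_k` into `-i d/dx`. -/
def unfold (k : ℝ) : L2C2 ≃ₗᵢ[ℂ] L2C2 where
  toFun f := (memLp_unfoldFun k (Lp.memLp f)).toLp
  invFun f := (memLp_foldFun k (Lp.memLp f)).toLp
  map_add' f g := by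
    rw [← MemLp.toLp_add, MemLp.toLp_eq_toLp_iff]
    filter_upwards [Lp.coeFn_add f g, ae_comp_neg (Lp.coeFn_add f g)] with x h1 h2
    rw [Pi.add_apply, unfoldFun, h1, h2]
    ext i
    fin_cases i
    · simp [unfoldFun]; ring
    · simp [unfoldFun]; ring
  map_smul' c f := by
    rw [RingHom.id_apply, ← MemLp.toLp_const_smul, MemLp.toLp_eq_toLp_iff]
    filter_upwards [Lp.coeFn_smul c f, ae_comp_neg (Lp.coeFn_smul c f)] with x h1 h2
    rw [Pi.smul_apply, unfoldFun, h1, h2]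
    ext i
    fin_cases i
    · simp [unfoldFun]; ring
    · simp [unfoldFun]; ring
  left_inv f := by
    apply Lp.ext
    filter_upwards [(memLp_foldFun k (Lp.memLp (memLp_unfoldFun k (Lp.memLp f)).toLp)).coeFn_toLp,
      foldFun_congr k (memLp_unfoldFun k (Lp.memLp f)).coeFn_toLp, ae_ne_zero] with x h1 h2 hx
    rw [h1, h2, foldFun_unfoldFun k _ hx]
  right_inv f := by
    apply Lp.ext
    filter_upwards [(memLp_unfoldFun k (Lp.memLp (memLp_foldFun k (Lp.memLp f)).toLp)).coeFn_toLp,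
      unfoldFun_congr k (memLp_foldFun k (Lp.memLp f)).coeFn_toLp, ae_ne_zero] with x h1 h2 hx
    rw [h1, h2, unfoldFun_foldFun k _ hx]
  norm_map' f := by
    rw [← sq_eq_sq₀ (norm_nonneg _) (norm_nonneg _), norm_sq_eq_integral, norm_sq_eq_integral,
      ← integral_norm_sq_unfoldFun k (Lp.memLp f)]
    refine integral_congr_ae ?_
    filter_upwards [(memLp_unfoldFun k (Lp.memLp f)).coeFn_toLp] with x hx
    simp only [LinearEquiv.coe_mk, LinearMap.coe_mk, AddHom.coe_mk, hx]

theorem coeFn_unfold (k : ℝ) (f : L2C2) : unfold k f =ᵐ[volume] unfoldFun k f :=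
  (memLp_unfoldFun k (Lp.memLp f)).coeFn_toLp

theorem coeFn_unfold_symm (k : ℝ) (f : L2C2) : (unfold k).symm f =ᵐ[volume] foldFun k f :=
  (memLp_foldFun k (Lp.memLp f)).coeFn_toLp

end Unfolding

/-! ### $T_k$ corresponds to $-i\,d/dx$; its spectral measure. -/

section OperatorDomain

open SpectralMeasure FourierTransform

theorem isVectorWeakDeriv_iff_coord {h v : ℝ → EuclideanSpace ℂ (Fin 2)} (hh : MemLp h 2)
    (hv : MemLp v 2) :
    IsVectorWeakDeriv h v ↔ ∀ i, IsWeakDeriv (fun x => h x i) (fun x => v x i) := by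
  have key : ∀ {u : ℝ → EuclideanSpace ℂ (Fin 2)} (_ : MemLp u 2) {φ : ℝ → ℝ}
      (_ : Continuous φ) (_ : HasCompactSupport φ) (i : Fin 2),
      (∫ x, φ x • u x) i = ∫ x, φ x • u x i := fun hu φ hφ hc i =>
    ((EuclideanSpace.proj i : EuclideanSpace ℂ (Fin 2) →L[ℂ] ℂ).integral_comp_comm
      (integrable_test_smul hφ hc hu)).symm
  constructor
  · intro H i φ hφ hc
    rw [← key hh (hφ.continuous_deriv (by simp)) hc.deriv, ← key hv hφ.continuous hc,
      H φ hφ hc, PiLp.neg_apply]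
  · intro H φ hφ hc
    ext i
    rw [PiLp.neg_apply, key hh (hφ.continuous_deriv (by simp)) hc.deriv,
      key hv hφ.continuous hc, H i φ hφ hc]

theorem coeFn_opT (k : ℝ) (f : (opT k).domain) : opT k f =ᵐ[volume] opTFun k f :=
  (memLp_opTFun f.2).coeFn_toLp

/-- Write $u=f_0$, $w=f_1-k\,\mathrm{sgn}f_0$. Then $p+Rm=(1+ik\,\mathrm{sgn})(u+Ru)+i(w-Rw)$, and
the factor $1-ik\,\mathrm{sgn}$ turns this into $(1+k^2)(u+Ru)+k\,\mathrm{sgn}\,(w-Rw)+i(w-Rw)$: sgn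
multiplies only an odd function. -/
theorem unfold_opT_zero (k : ℝ) (f : (opT k).domain) :
    IsH1Pair (fun x => unfold k f x 0) (fun x => Complex.I * unfold k (opT k f) x 0) := by
  have pu := f.2.1.isH1Pair
  have pw := f.2.2.isH1Pair
  have pair := ((((pu.add pu.comp_neg).const_smul (1 + (k : ℂ) ^ 2)).add
    (pw.sgn_mul_odd.const_smul k)).add ((pw.sub pw.comp_neg).const_smul Complex.I)).const_smul
    (1 / (2 * (√(1 + k ^ 2) : ℝ)))
  refine pair.congr ?_ ?_
  · filter_upwards [coeFn_unfold k f, ae_ne_zero] with x h1 hx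
    rw [h1, unfoldFun_zero, phase]
    simp only [Pi.smul_apply, Pi.add_apply, Pi.sub_apply, smul_eq_mul, jumpPart, sgn_neg]
    have hs := sgn_mul_self hx
    have hN := sqrt_one_add_sq_ne_zero k
    generalize ((√(1 + k ^ 2) : ℝ) : ℂ) = N at *
    generalize sgn x = s at *
    generalize (f : L2C2) x 0 = a
    generalize (f : L2C2) (-x) 0 = b
    generalize (f : L2C2) x 1 = c
    generalize (f : L2C2) (-x) 1 = d
    field_simp
    linear_combination (-(k : ℂ) ^ 2 * (a + b)) * hs + k * s * (c - d) * Complex.I_sq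
  · filter_upwards [coeFn_unfold k (opT k f), coeFn_opT k f, ae_comp_neg (coeFn_opT k f),
      ae_ne_zero] with x h1 h2 h3 hx
    rw [h1, unfoldFun_zero, phase, h2, h3]
    simp only [Pi.smul_apply, Pi.add_apply, Pi.sub_apply, smul_eq_mul, opTFun, sgn_neg,
      Matrix.cons_val_zero, Matrix.cons_val_one, PiLp.toLp_apply, Matrix.cons_val_fin_one]
    have hs := sgn_mul_self hx
    have hN := sqrt_one_add_sq_ne_zero k
    generalize ((√(1 + k ^ 2) : ℝ) : ℂ) = N at *
    generalize sgn x = s at *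
    generalize weakDeriv (fun y => (f : L2C2) y 0) x = p
    generalize weakDeriv (fun y => (f : L2C2) y 0) (-x) = q
    generalize weakDeriv (jumpPart k f) x = r
    generalize weakDeriv (jumpPart k f) (-x) = m
    field_simp
    linear_combination (-(k : ℂ) ^ 2 * (p - q)) * hs - (Complex.I * k * s * (p - q) - (p - q) -
      (k : ℂ) ^ 2 * s ^ 2 * (p - q) - k * s * (r + m)) * Complex.I_sq

/-- Here $p-Rm=(u-Ru)+i(w+Rw)+ik\,\mathrm{sgn}\,(u-Ru)$, so no phase is needed. -/
theorem unfold_opT_one (k : ℝ) (f : (opT k).domain) :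
    IsH1Pair (fun x => unfold k f x 1) (fun x => Complex.I * unfold k (opT k f) x 1) := by
  have pu := f.2.1.isH1Pair
  have pw := f.2.2.isH1Pair
  have pair := ((pu.sub pu.comp_neg).add (((pw.add pw.comp_neg).add
    (pu.sgn_mul_odd.const_smul k)).const_smul Complex.I)).const_smul (1 / 2 : ℂ)
  refine pair.congr ?_ ?_
  · filter_upwards [coeFn_unfold k f] with x h1
    rw [h1, unfoldFun_one]
    simp only [Pi.smul_apply, Pi.add_apply, Pi.sub_apply, smul_eq_mul, jumpPart, sgn_neg]
    ring
  · filter_upwards [coeFn_unfold k (opT k f), coeFn_opT k f, ae_comp_neg (coeFn_opT k f)]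
      with x h1 h2 h3
    rw [h1, unfoldFun_one, h2, h3]
    simp only [Pi.smul_apply, Pi.add_apply, Pi.sub_apply, smul_eq_mul, opTFun, sgn_neg,
      Matrix.cons_val_zero, Matrix.cons_val_one, PiLp.toLp_apply, Matrix.cons_val_fin_one]
    generalize weakDeriv (fun y => (f : L2C2) y 0) x = p
    generalize weakDeriv (fun y => (f : L2C2) y 0) (-x) = q
    linear_combination ((p + q) / 2) * Complex.I_sq

/-- The operator `unfold k` turns `i T_k` into the weak derivative. -/
theorem isVectorWeakDeriv_unfold_opT (k : ℝ) (f : (opT k).domain) :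
    IsVectorWeakDeriv (unfold k f) ((Complex.I • unfold k (opT k f) : L2C2)) := by
  rw [isVectorWeakDeriv_iff_coord (Lp.memLp _) (Lp.memLp _)]
  have hs : ∀ i, (fun x => Complex.I * unfold k (opT k f) x i) =ᵐ[volume]
      fun x => (Complex.I • unfold k (opT k f) : L2C2) x i := fun i => by
    filter_upwards [Lp.coeFn_smul Complex.I (unfold k (opT k f))] with x hx
    rw [hx]
    rfl
  intro i
  fin_cases i
  · exact ((unfold_opT_zero k f).congr ae_eq_rfl (hs 0)).isWeakDeriv
  · exact ((unfold_opT_one k f).congr ae_eq_rfl (hs 1)).isWeakDeriv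

/-- The converse inclusion of domains: both $f_0$ and $f_1-k\,\mathrm{sgn}f_0$ are recovered from
the unfolded components using only even parts, odd parts, and sgn times odd parts. -/
theorem mem_opTDomain_of_isVectorWeakDeriv (k : ℝ) {f v : L2C2}
    (h : IsVectorWeakDeriv (unfold k f) v) : f ∈ opTDomain k := by
  rw [isVectorWeakDeriv_iff_coord (Lp.memLp _) (Lp.memLp _)] at h
  have p0 : IsH1Pair (fun x => unfold k f x 0) (fun x => v x 0) :=
    ⟨memLp_coord (Lp.memLp _) 0, memLp_coord (Lp.memLp _) 0, h 0⟩
  have p1 : IsH1Pair (fun x => unfold k f x 1) (fun x => v x 1) :=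
    ⟨memLp_coord (Lp.memLp _) 1, memLp_coord (Lp.memLp _) 1, h 1⟩
  have hf : f =ᵐ[volume] foldFun k (unfold k f) := by
    have := coeFn_unfold_symm k (unfold k f)
    rwa [(unfold k).symm_apply_apply] at this
  have hI : ∀ z : ℂ, z / (2 * Complex.I) = -Complex.I / 2 * z := fun z => by
    rw [div_eq_mul_inv, mul_inv, Complex.inv_I]
    ring
  constructor
  · have pair := (((p0.add p0.comp_neg).const_smul (1 / (2 * (√(1 + k ^ 2) : ℝ)))).add
      (p0.sgn_mul_odd.const_smul (Complex.I * k / (2 * (√(1 + k ^ 2) : ℝ))))).add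
      ((p1.sub p1.comp_neg).const_smul (1 / 2))
    refine pair.memH1.congr ?_
    filter_upwards [hf] with x h1
    rw [h1, foldFun_zero, phase, phase, sgn_neg]
    simp only [Pi.smul_apply, Pi.add_apply, Pi.sub_apply, smul_eq_mul]
    have hN := sqrt_one_add_sq_ne_zero k
    generalize ((√(1 + k ^ 2) : ℝ) : ℂ) = N at *
    field_simp
    ring
  -- With $h$ the unfolded function, $f_1$ and $k\,\mathrm{sgn}f_0$ both contain
  -- $\frac{k}{2\sqrt{1+k^2}}\mathrm{sgn}\,(h_0+Rh_0)$, sgn times an even function; this term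
  -- cancels in the difference.
  · have pair := ((((p0.sub p0.comp_neg).const_smul (1 / (√(1 + k ^ 2) : ℝ))).add
      (p1.add p1.comp_neg)).const_smul (-Complex.I / 2)).add
      (((p0.sub p0.comp_neg).const_smul (-(Complex.I * k ^ 2 / (2 * (√(1 + k ^ 2) : ℝ))))).add
      (p1.sgn_mul_odd.const_smul (-(k / 2))))
    refine pair.memH1.congr ?_
    filter_upwards [hf, ae_ne_zero] with x h1 hx
    rw [jumpPart, h1, foldFun_zero, foldFun_one, phase, phase, sgn_neg, hI]
    simp only [Pi.smul_apply, Pi.add_apply, Pi.sub_apply, smul_eq_mul]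
    have hs := sgn_mul_self hx
    have hN := sqrt_one_add_sq_ne_zero k
    generalize ((√(1 + k ^ 2) : ℝ) : ℂ) = N at *
    generalize sgn x = s at *
    generalize unfold k f x 0 = a
    generalize unfold k f (-x) 0 = c
    generalize unfold k f x 1 = b
    generalize unfold k f (-x) 1 = d
    field_simp
    linear_combination (Complex.I * k ^ 2 * (a - c)) * hs + (k * s * (a + c)) * Complex.I_sq

/-- The unitary operator diagonalizing `T_k`. -/
def diagonalization (k : ℝ) : L2C2 ≃ₗᵢ[ℂ] L2C2 :=
  (unfold k).trans (Lp.fourierTransformₗᵢ ℝ (EuclideanSpace ℂ (Fin 2))).symm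

theorem diagonalization_apply (k : ℝ) (f : L2C2) : diagonalization k f = 𝓕⁻ (unfold k f) := rfl

/-- The spectral measure of `T_k`. -/
def opTSpectralMeasure (k : ℝ) : SpectralMeasure L2C2 :=
  mulSpectralMeasure (diagonalization k) (fun ξ => -(2 * Real.pi) * ξ) (measurable_const_mul _)

theorem diagonalization_opT (k : ℝ) (f : (opT k).domain) :
    diagonalization k (opT k f) =ᵐ[volume]
      fun ξ => ((-(2 * Real.pi) * ξ : ℝ) : ℂ) • diagonalization k f ξ := by
  have h := (isVectorWeakDeriv_iff _ _).1 (isVectorWeakDeriv_unfold_opT k f)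
  have e : 𝓕⁻ (Complex.I • unfold k (opT k f) : L2C2) =
      Complex.I • diagonalization k (opT k f) :=
    (Lp.fourierTransformₗᵢ ℝ (EuclideanSpace ℂ (Fin 2))).symm.map_smul _ _
  rw [e] at h
  filter_upwards [h, Lp.coeFn_smul Complex.I (diagonalization k (opT k f))] with ξ h1 h2
  rw [h2, Pi.smul_apply] at h1
  have h3 := congrArg (fun z => (-Complex.I) • z) h1
  simp only [smul_smul] at h3
  rw [neg_mul, Complex.I_mul_I, neg_neg, one_smul] at h3
  rw [h3, ← diagonalization_apply]
  congr 1
  push_cast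
  linear_combination (2 * Real.pi * ξ : ℂ) * Complex.I_sq

/-- Finiteness of the second moment says that $\xi\,\mathcal F^{-1}(\mathrm{unfold}\,f)$ is square
integrable, that is, that the unfolded function has a weak derivative in $L^2$; the preceding lemmas
translate this into membership in the domain. -/
theorem opTSpectralMeasure_isSpectralMeasureOf (k : ℝ) :
    (opTSpectralMeasure k).IsSpectralMeasureOf (opT k) := by
  constructor
  · intro f
    rw [opTSpectralMeasure, integrable_mulSpectralMeasure_iff _ _ _ (b := fun x : ℝ => x ^ 2) (by fun_prop)]
    constructor
    · intro hf
      have h1 := integrable_norm_sq (diagonalization k (opT k ⟨f, hf⟩))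
      refine h1.congr ?_
      filter_upwards [diagonalization_opT k ⟨f, hf⟩] with ξ hξ
      rw [hξ, norm_smul, mul_pow, Complex.norm_real, Real.norm_eq_abs, sq_abs]
    · intro hi
      have hm : MemLp (fun ξ : ℝ => (-(2 * Real.pi * Complex.I * ξ) : ℂ) •
          diagonalization k f ξ) 2 := by
        have hmeas : AEStronglyMeasurable (fun ξ : ℝ => (-(2 * Real.pi * Complex.I * ξ) : ℂ) •
            diagonalization k f ξ) volume :=
          (by fun_prop : Continuous fun ξ : ℝ =>
            (-(2 * Real.pi * Complex.I * ξ) : ℂ)).aestronglyMeasurable.smul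
            (Lp.aestronglyMeasurable _)
        rw [memLp_two_iff_integrable_sq_norm hmeas]
        refine hi.congr (Eventually.of_forall fun ξ => ?_)
        beta_reduce
        rw [norm_smul, mul_pow ‖(-(2 * Real.pi * Complex.I * ξ) : ℂ)‖]
        simp [mul_pow]
      refine mem_opTDomain_of_isVectorWeakDeriv k (v := 𝓕 (hm.toLp)) ?_
      rw [isVectorWeakDeriv_iff, fourierInv_fourier_eq]
      exact hm.coeFn_toLp
  · intro f
    rw [opTSpectralMeasure, integral_mulSpectralMeasure _ _ _ Complex.measurable_ofReal,
      ← (diagonalization k).inner_map_map, L2.inner_def]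
    refine integral_congr_ae ?_
    filter_upwards [diagonalization_opT k f] with ξ hξ
    rw [hξ, inner_smul_right, inner_self_eq_norm_sq_to_K]
    simp

/-- The functional calculus of `T_k` with respect to any of its spectral measures. -/
theorem integral_apply_eq (k : ℝ) {E : SpectralMeasure L2C2} (hE : E.IsSpectralMeasureOf (opT k))
    {b : ℝ → ℂ} (hb : IsBddBorel b) (f : L2C2) :
    E.integral b f = (unfold k).symm (fourierMul b hb (unfold k f)) := by
  obtain ⟨hm, C, hC⟩ := id hb
  have h1 := E.isIntegral_integral b hm C hC
  have h2 : E.IsIntegral b (conjMulOp (diagonalization k) _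
      (IsBddBorel.comp_mul hb (-(2 * Real.pi)))) := by
    intro g
    rw [hE.measure_eq (opTSpectralMeasure_isSpectralMeasureOf k) g]
    exact mulSpectralMeasure_isIntegral (diagonalization k) (measurable_const_mul _) hm
      (IsBddBorel.comp_mul hb (-(2 * Real.pi))) g
  rw [h1.unique E h2]
  rfl

end OperatorDomain

/-! ### Folding back convolutions with even or odd kernels. -/

section KernelAlgebra

theorem phase_mul_phase (k x y : ℝ) : phase k x * phase k y =
    (1 - Complex.I * k * (sgn x + sgn y) - k ^ 2 * sgn x * sgn y) / (1 + k ^ 2) := by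
  rw [phase, phase, div_mul_div_comm, ← sq, sq_sqrt_one_add_sq]
  congr 1
  linear_combination (k : ℂ) ^ 2 * sgn x * sgn y * Complex.I_sq

theorem one_add_sq_ne_zero (k : ℝ) : (1 + (k : ℂ) ^ 2) ≠ 0 := by
  have : (1 + k ^ 2) ≠ 0 := by positivity
  exact_mod_cast this

variable {κ : ℝ → ℝ} {f : ℝ → EuclideanSpace ℂ (Fin 2)}

theorem memLp_kernel_add (hκ : ∀ x, MemLp (fun y => κ (x - y)) 2) (x : ℝ) :
    MemLp (fun y => κ (x + y)) 2 := by
  simpa [Function.comp_def] using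
    (hκ x).comp_measurePreserving (Measure.measurePreserving_neg (volume : Measure ℝ))

theorem memLp_kernel_abs (hκ : ∀ x, MemLp (fun y => κ (x - y)) 2) (x : ℝ) :
    MemLp (fun y => κ (|x| + |y|)) 2 := by
  have h : (fun y => κ (|x| + |y|)) = (Ici (0 : ℝ)).indicator (fun y => κ (|x| + y)) +
      (Iio (0 : ℝ)).indicator (fun y => κ (|x| - y)) := by
    funext y
    rcases le_or_gt 0 y with hy | hy
    · simp [hy, abs_of_nonneg hy, hy.not_gt]
    · simp [hy, abs_of_neg hy, hy.not_ge, sub_eq_add_neg]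
  rw [h]
  exact ((memLp_kernel_add hκ _).indicator measurableSet_Ici).add
    ((hκ _).indicator measurableSet_Iio)

theorem integrable_ofReal_mul_of_memLp_two {u : ℝ → ℝ} {g : ℝ → ℂ} (hu : MemLp u 2)
    (hg : MemLp g 2) : Integrable fun y => (u y : ℂ) * g y := by
  simpa only [Complex.real_smul] using integrable_real_smul_of_memLp_two hu hg

theorem integral_smul_apply (hκ : ∀ x, MemLp (fun y => κ (x - y)) 2) (hf : MemLp f 2) (x : ℝ)
    (i : Fin 2) : (∫ y, κ (x - y) • f y) i = ∫ y, (κ (x - y) : ℂ) * f y i := by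
  have h := (EuclideanSpace.proj i : EuclideanSpace ℂ (Fin 2) →L[ℂ] ℂ).integral_comp_comm
    (integrable_real_smul_of_memLp_two (hκ x) hf)
  exact h.symm.trans (integral_congr_ae (Eventually.of_forall fun y => by simp))

/-- The substitution $y\mapsto-y$ moves the reflection from the function to the kernel; this is the
origin of $\kappa(x+y)$. -/
theorem integral_kernel_mul_add_comp_neg (hκ : ∀ x, MemLp (fun y => κ (x - y)) 2)
    {u v : ℝ → ℂ} (hu : MemLp u 2) (hv : MemLp v 2) (x : ℝ) :
    ∫ y, (κ (x - y) : ℂ) * (u y + v (-y)) =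
      ∫ y, ((κ (x - y) : ℂ) * u y + (κ (x + y) : ℂ) * v y) := by
  have h1 := integrable_ofReal_mul_of_memLp_two (hκ x) hu
  have h2 := integrable_ofReal_mul_of_memLp_two (hκ x) (memLp_comp_neg hv)
  have h3 := integrable_ofReal_mul_of_memLp_two (memLp_kernel_add hκ x) hv
  simp only [mul_add]
  rw [integral_add h1 h2, integral_add h1 h3,
    ← integral_neg_eq_self (fun y => (κ (x + y) : ℂ) * v y)]
  simp only [← sub_eq_add_neg]

theorem HasIntegral.add {u v : ℝ → ℂ} {I J : ℂ} (hu : HasIntegral u I)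
    (hv : HasIntegral v J) : HasIntegral (fun y => u y + v y) (I + J) :=
  ⟨hu.1.add hv.1, by rw [integral_add hu.1 hv.1, hu.2, hv.2]⟩

theorem HasIntegral.sub {u v : ℝ → ℂ} {I J : ℂ} (hu : HasIntegral u I)
    (hv : HasIntegral v J) : HasIntegral (fun y => u y - v y) (I - J) :=
  ⟨hu.1.sub hv.1, by rw [integral_sub hu.1 hv.1, hu.2, hv.2]⟩

theorem HasIntegral.neg {u : ℝ → ℂ} {I : ℂ} (hu : HasIntegral u I) :
    HasIntegral (fun y => -u y) (-I) :=
  ⟨hu.1.neg, by rw [integral_neg, hu.2]⟩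

theorem HasIntegral.const_mul {u : ℝ → ℂ} {I : ℂ} (hu : HasIntegral u I) (c : ℂ) :
    HasIntegral (fun y => c * u y) (c * I) :=
  ⟨hu.1.const_mul c, by rw [integral_const_mul, hu.2]⟩

theorem HasIntegral.congr {u v : ℝ → ℂ} {I : ℂ} (hu : HasIntegral u I)
    (h : ∀ y, y ≠ 0 → u y = v y) : HasIntegral v I := by
  have h' : u =ᵐ[volume] v := ae_ne_zero.mono h
  exact ⟨hu.1.congr h', by rw [← integral_congr_ae h', hu.2]⟩

/-- The components of the convolution of a kernel with an unfolded function. -/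
theorem hasIntegral_kernel_unfoldFun_zero (k : ℝ) (hκ : ∀ x, MemLp (fun y => κ (x - y)) 2)
    (hf : MemLp f 2) (x : ℝ) :
    HasIntegral (fun y => (κ (x - y) : ℂ) * (phase k y * (f y 0 + Complex.I * f y 1) / 2) +
        (κ (x + y) : ℂ) * (phase k (-y) * (f y 0 - Complex.I * f y 1) / 2))
      ((∫ y, κ (x - y) • unfoldFun k f y) 0) := by
  have h0 := memLp_coord hf 0
  have h1 := memLp_coord hf 1
  have hu : MemLp (fun y => phase k y * (f y 0 + Complex.I * f y 1) / 2) 2 := by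
    simpa only [div_eq_mul_inv, Pi.add_apply, mul_comm] using
      (memLp_phase_mul k (h0.add (h1.const_mul Complex.I))).const_mul (2⁻¹ : ℂ)
  have hv : MemLp (fun y => phase k (-y) * (f y 0 - Complex.I * f y 1) / 2) 2 := by
    simpa only [div_eq_mul_inv, Pi.sub_apply, mul_comm] using
      (memLp_phase_neg_mul k (h0.sub (h1.const_mul Complex.I))).const_mul (2⁻¹ : ℂ)
  refine ⟨(integrable_ofReal_mul_of_memLp_two (hκ x) hu).add
    (integrable_ofReal_mul_of_memLp_two (memLp_kernel_add hκ x) hv), ?_⟩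
  rw [integral_smul_apply hκ (memLp_unfoldFun k hf), ← integral_kernel_mul_add_comp_neg hκ hu hv]
  refine integral_congr_ae (Eventually.of_forall fun y => ?_)
  simp only [unfoldFun_zero, neg_neg]
  ring

theorem hasIntegral_kernel_unfoldFun_one (k : ℝ) (hκ : ∀ x, MemLp (fun y => κ (x - y)) 2)
    (hf : MemLp f 2) (x : ℝ) :
    HasIntegral (fun y => (κ (x - y) : ℂ) * ((f y 0 + Complex.I * f y 1) / 2) +
        (κ (x + y) : ℂ) * (-(f y 0 - Complex.I * f y 1) / 2))
      ((∫ y, κ (x - y) • unfoldFun k f y) 1) := by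
  have h0 := memLp_coord hf 0
  have h1 := memLp_coord hf 1
  have hu : MemLp (fun y => (f y 0 + Complex.I * f y 1) / 2) 2 := by
    simpa only [div_eq_mul_inv, Pi.add_apply, mul_comm] using
      (h0.add (h1.const_mul Complex.I)).const_mul (2⁻¹ : ℂ)
  have hv : MemLp (fun y => -(f y 0 - Complex.I * f y 1) / 2) 2 := by
    simpa only [div_eq_mul_inv, Pi.sub_apply, Pi.neg_apply, mul_comm] using
      (h0.sub (h1.const_mul Complex.I)).neg.const_mul (2⁻¹ : ℂ)
  refine ⟨(integrable_ofReal_mul_of_memLp_two (hκ x) hu).add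
    (integrable_ofReal_mul_of_memLp_two (memLp_kernel_add hκ x) hv), ?_⟩
  rw [integral_smul_apply hκ (memLp_unfoldFun k hf), ← integral_kernel_mul_add_comp_neg hκ hu hv]
  refine integral_congr_ae (Eventually.of_forall fun y => ?_)
  simp only [unfoldFun_one]
  ring

theorem eq_sgn_cases {x : ℝ} (hx : x ≠ 0) :
    (sgn x = 1 ∧ |x| = x) ∨ (sgn x = -1 ∧ |x| = -x) := by
  rcases lt_or_gt_of_ne hx with h | h
  · exact Or.inr ⟨sgn_of_neg h, abs_of_neg h⟩
  · exact Or.inl ⟨sgn_of_pos h, abs_of_pos h⟩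

/-- Folding evaluates the convolution at $x$ and $-x$. The parity factor `ε`, which is $1$ or $-1$
in the applications, rewrites $\kappa(-x\mp y)$ as $\varepsilon\kappa(x\pm y)$, leaving two kernels.
-/
theorem hasIntegral_foldFun_zero (k : ℝ) (hκ : ∀ x, MemLp (fun y => κ (x - y)) 2) {ε : ℝ}
    (he : ∀ u, κ (-u) = ε * κ u) (hf : MemLp f 2) (x : ℝ) :
    HasIntegral (fun y => ((κ (x - y) : ℂ) *
        (phase k (-x) * phase k y * (f y 0 + Complex.I * f y 1) + (f y 0 + Complex.I * f y 1) +
          ε * (phase k x * phase k (-y) * (f y 0 - Complex.I * f y 1) +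
            (f y 0 - Complex.I * f y 1))) + (κ (x + y) : ℂ) *
        (phase k (-x) * phase k (-y) * (f y 0 - Complex.I * f y 1) - (f y 0 - Complex.I * f y 1) +
          ε * (phase k x * phase k y * (f y 0 + Complex.I * f y 1) -
            (f y 0 + Complex.I * f y 1)))) / 4)
      (foldFun k (fun x => ∫ y, κ (x - y) • unfoldFun k f y) x 0) := by
  have h := (((((hasIntegral_kernel_unfoldFun_zero k hκ hf x).const_mul (phase k (-x))).add
    (hasIntegral_kernel_unfoldFun_one k hκ hf x)).add
    ((hasIntegral_kernel_unfoldFun_zero k hκ hf (-x)).const_mul (phase k x))).sub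
    (hasIntegral_kernel_unfoldFun_one k hκ hf (-x))).const_mul 2⁻¹
  rw [foldFun_zero, div_eq_inv_mul _ (2 : ℂ)]
  refine h.congr fun y _ => ?_
  have e1 : κ (-x - y) = ε * κ (x + y) := by rw [← he]; congr 1; ring
  have e2 : κ (-x + y) = ε * κ (x - y) := by rw [← he]; congr 1; ring
  rw [e1, e2]
  push_cast
  ring

theorem hasIntegral_foldFun_one (k : ℝ) (hκ : ∀ x, MemLp (fun y => κ (x - y)) 2) {ε : ℝ}
    (he : ∀ u, κ (-u) = ε * κ u) (hf : MemLp f 2) (x : ℝ) :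
    HasIntegral (fun y => ((κ (x - y) : ℂ) *
        (phase k (-x) * phase k y * (f y 0 + Complex.I * f y 1) + (f y 0 + Complex.I * f y 1) -
          ε * (phase k x * phase k (-y) * (f y 0 - Complex.I * f y 1) +
            (f y 0 - Complex.I * f y 1))) + (κ (x + y) : ℂ) *
        (phase k (-x) * phase k (-y) * (f y 0 - Complex.I * f y 1) - (f y 0 - Complex.I * f y 1) -
          ε * (phase k x * phase k y * (f y 0 + Complex.I * f y 1) -
            (f y 0 + Complex.I * f y 1)))) / (4 * Complex.I))
      (foldFun k (fun x => ∫ y, κ (x - y) • unfoldFun k f y) x 1) := by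
  have h := (((((hasIntegral_kernel_unfoldFun_zero k hκ hf x).const_mul (phase k (-x))).add
    (hasIntegral_kernel_unfoldFun_one k hκ hf x)).sub
    ((hasIntegral_kernel_unfoldFun_zero k hκ hf (-x)).const_mul (phase k x))).add
    (hasIntegral_kernel_unfoldFun_one k hκ hf (-x))).const_mul (2 * Complex.I)⁻¹
  rw [foldFun_one, div_eq_inv_mul _ (2 * Complex.I : ℂ)]
  refine h.congr fun y _ => ?_
  have e1 : κ (-x - y) = ε * κ (x + y) := by rw [← he]; congr 1; ring
  have e2 : κ (-x + y) = ε * κ (x - y) := by rw [← he]; congr 1; ring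
  have hI := Complex.I_ne_zero
  rw [e1, e2]
  push_cast
  field_simp
  ring

/-- In each quadrant the kernel at $|x|+|y|$ is, up to the parity factor, one of $\kappa(x\pm y)$;
the explicit formulas become four polynomial identities. -/
theorem apply_abs_add_abs {ε : ℝ} (he : ∀ u, κ (-u) = ε * κ u) (x y : ℝ)
    (hx : x ≠ 0) (hy : y ≠ 0) :
    (sgn x = 1 ∧ sgn y = 1 ∧ κ (|x| + |y|) = κ (x + y)) ∨
    (sgn x = 1 ∧ sgn y = -1 ∧ κ (|x| + |y|) = κ (x - y)) ∨
    (sgn x = -1 ∧ sgn y = 1 ∧ κ (|x| + |y|) = ε * κ (x - y)) ∨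
    (sgn x = -1 ∧ sgn y = -1 ∧ κ (|x| + |y|) = ε * κ (x + y)) := by
  have e1 : ε * κ (x + y) = κ (-x + -y) := by rw [← he]; congr 1; ring
  have e2 : ε * κ (x - y) = κ (-x + y) := by rw [← he]; congr 1; ring
  rw [e1, e2]
  rcases eq_sgn_cases hx with ⟨h1, h2⟩ | ⟨h1, h2⟩ <;>
    rcases eq_sgn_cases hy with ⟨h3, h4⟩ | ⟨h3, h4⟩ <;>
    rw [h1, h2, h3, h4] <;> norm_num [sub_eq_add_neg]

/-- If $x,y$ have the same sign then $\mathrm{phase}(-x)\,\mathrm{phase}(y)=1$, and $\kappa(x-y)$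
gets the coefficient it has for $k=0$. If the signs are opposite, the coefficient of $\kappa(x+y)$
cancels. What remains of the phases is the correction with $\kappa(|x|+|y|)$. -/
theorem hasIntegral_foldFun_even_zero (k : ℝ) (hκ : ∀ x, MemLp (fun y => κ (x - y)) 2)
    (he : ∀ u, κ (-u) = κ u) (hf : MemLp f 2) {x : ℝ} (hx : x ≠ 0) :
    HasIntegral (fun y => (κ (x - y) : ℂ) * f y 0 - (k / (1 + k ^ 2)) *
        ((κ (|x| + |y|) : ℂ) * (k * f y 0 - sgn y * f y 1)))
      (foldFun k (fun x => ∫ y, κ (x - y) • unfoldFun k f y) x 0) := by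
  have he' : ∀ u, κ (-u) = 1 * κ u := fun u => by rw [he, one_mul]
  refine (hasIntegral_foldFun_zero k hκ he' hf x).congr fun y hy => ?_
  have hk := one_add_sq_ne_zero k
  simp only [phase_mul_phase, sgn_neg]
  rcases apply_abs_add_abs he' x y hx hy with h | h | h | h <;>
  · rw [h.1, h.2.1, h.2.2]
    push_cast
    field_simp
    ring_nf
    try simp only [Complex.I_sq]
    try ring

theorem hasIntegral_foldFun_even_one (k : ℝ) (hκ : ∀ x, MemLp (fun y => κ (x - y)) 2)
    (he : ∀ u, κ (-u) = κ u) (hf : MemLp f 2) {x : ℝ} (hx : x ≠ 0) :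
    HasIntegral (fun y => (κ (x - y) : ℂ) * f y 1 + (k / (1 + k ^ 2)) * (sgn x *
        ((κ (|x| + |y|) : ℂ) * (f y 0 + k * sgn y * f y 1))))
      (foldFun k (fun x => ∫ y, κ (x - y) • unfoldFun k f y) x 1) := by
  have he' : ∀ u, κ (-u) = 1 * κ u := fun u => by rw [he, one_mul]
  refine (hasIntegral_foldFun_one k hκ he' hf x).congr fun y hy => ?_
  have hk := one_add_sq_ne_zero k
  have hI := Complex.I_ne_zero
  simp only [phase_mul_phase, sgn_neg]
  rcases apply_abs_add_abs he' x y hx hy with h | h | h | h <;>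
  · rw [h.1, h.2.1, h.2.2]
    push_cast
    field_simp
    ring_nf
    try simp only [Complex.I_sq]
    try ring

theorem hasIntegral_foldFun_odd_zero (k : ℝ) (hκ : ∀ x, MemLp (fun y => κ (x - y)) 2)
    (he : ∀ u, κ (-u) = -κ u) (hf : MemLp f 2) {x : ℝ} (hx : x ≠ 0) :
    HasIntegral (fun y => Complex.I * ((κ (x - y) : ℂ) * f y 1 + (k / (1 + k ^ 2)) *
        ((κ (|x| + |y|) : ℂ) * (f y 0 + k * sgn y * f y 1))))
      (foldFun k (fun x => ∫ y, κ (x - y) • unfoldFun k f y) x 0) := by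
  have he' : ∀ u, κ (-u) = (-1) * κ u := fun u => by rw [he, neg_one_mul]
  refine (hasIntegral_foldFun_zero k hκ he' hf x).congr fun y hy => ?_
  have hk := one_add_sq_ne_zero k
  simp only [phase_mul_phase, sgn_neg]
  rcases apply_abs_add_abs he' x y hx hy with h | h | h | h <;>
  · rw [h.1, h.2.1, h.2.2]
    push_cast
    field_simp
    ring_nf
    try simp only [Complex.I_sq]
    try ring

theorem hasIntegral_foldFun_odd_one (k : ℝ) (hκ : ∀ x, MemLp (fun y => κ (x - y)) 2)
    (he : ∀ u, κ (-u) = -κ u) (hf : MemLp f 2) {x : ℝ} (hx : x ≠ 0) :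
    HasIntegral (fun y => Complex.I * (-((κ (x - y) : ℂ) * f y 0) + (k / (1 + k ^ 2)) * (sgn x *
        ((κ (|x| + |y|) : ℂ) * (k * f y 0 - sgn y * f y 1)))))
      (foldFun k (fun x => ∫ y, κ (x - y) • unfoldFun k f y) x 1) := by
  have he' : ∀ u, κ (-u) = (-1) * κ u := fun u => by rw [he, neg_one_mul]
  refine (hasIntegral_foldFun_one k hκ he' hf x).congr fun y hy => ?_
  have hk := one_add_sq_ne_zero k
  have hI := Complex.I_ne_zero
  simp only [phase_mul_phase, sgn_neg]
  rcases apply_abs_add_abs he' x y hx hy with h | h | h | h <;>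
  · rw [h.1, h.2.1, h.2.2]
    push_cast
    field_simp
    ring_nf
    try simp only [Complex.I_sq]
    try ring

end KernelAlgebra

/-! ### Existence of the principal values, and limits of the conjugate Poisson integrals. -/

section PrincipalValues

open SpectralMeasure

theorem hasPV_of_tendsto {u : ℝ → ℂ} (hu : MemLp u 2) {x : ℝ} {L : ℂ}
    (h : Tendsto (fun ε => ∫ y, (({v : ℝ | ε < |v|}.indicator (fun v => v⁻¹) (x - y) : ℝ) : ℂ) * u y)
      (𝓝[>] 0) (𝓝 L)) : HasPV u x L := by
  have hs : ∀ ε : ℝ, MeasurableSet {y : ℝ | ε < |x - y|} := fun ε =>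
    measurableSet_lt measurable_const (measurable_const.sub measurable_id).norm
  have e : ∀ ε : ℝ, (fun y => (({v : ℝ | ε < |v|}.indicator (fun v => v⁻¹) (x - y) : ℝ) : ℂ) * u y) =
      {y : ℝ | ε < |x - y|}.indicator (fun y => u y / (x - y)) := by
    intro ε
    funext y
    by_cases hy : ε < |x - y|
    · rw [indicator_of_mem (show x - y ∈ {v : ℝ | ε < |v|} from hy),
        indicator_of_mem (show y ∈ {y : ℝ | ε < |x - y|} from hy)]
      push_cast
      rw [div_eq_inv_mul]
    · rw [indicator_of_notMem (show x - y ∉ {v : ℝ | ε < |v|} from hy),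
        indicator_of_notMem (show y ∉ {y : ℝ | ε < |x - y|} from hy)]
      simp
  refine ⟨fun ε hε => ?_, h.congr fun ε => ?_⟩
  · rw [← integrable_indicator_iff (hs ε), ← e]
    exact integrable_ofReal_mul_of_memLp_two (memLp_truncated hε x) hu
  · rw [e, integral_indicator (hs ε)]

theorem invFourierKernel_poissonSymbol_smul {t : ℝ} (ht : 0 < t) (z : ℝ)
    (v : EuclideanSpace ℂ (Fin 2)) :
    invFourierKernel (poissonSymbol t) z • v = (1 / Real.pi : ℂ) • poissonKer t z • v := by
  rw [invFourierKernel_poissonSymbol ht, mul_smul, Complex.coe_smul]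
  rfl

theorem invFourierKernel_poissonSymbol_mul_sgn_smul {t : ℝ} (ht : 0 < t) (z : ℝ)
    (v : EuclideanSpace ℂ (Fin 2)) :
    invFourierKernel (poissonSymbol t * sgn) z • v =
      (1 / Real.pi : ℂ) • Complex.I • conjPoissonKer t z • v := by
  rw [invFourierKernel_poissonSymbol_mul_sgn ht, mul_smul, Complex.coe_smul, smul_smul _ Complex.I,
    one_div_mul_eq_div]
  rfl

/-- The integral of `f` against the conjugate Poisson kernel is a Poisson integral of
`sgn(-i d/dx) f`. -/
theorem integral_conjPoissonKer_smul {t : ℝ} (ht : 0 < t) (f : L2C2) (x : ℝ) :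
    Complex.I • ∫ y, conjPoissonKer t (x - y) • f y =
      ∫ y, poissonKer t (x - y) • fourierMul sgn isBddBorel_sgn f y := by
  have h := integral_invFourierKernel_mul_smul (isBddBorel_poissonSymbol ht)
    (integrable_poissonSymbol ht) isBddBorel_sgn f x
  have hpi : (1 / Real.pi : ℂ) ≠ 0 := by simp [Real.pi_ne_zero]
  simp only [invFourierKernel_poissonSymbol_smul ht, invFourierKernel_poissonSymbol_mul_sgn_smul ht,
    integral_smul] at h
  exact smul_right_injective _ hpi h

/-- By `integral_conjPoissonKer_smul` this is convergence of Poisson integrals at Lebesgue points of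
the transformed function, so no maximal inequality for singular integrals is needed. -/
theorem ae_exists_tendsto_conjPoissonKer (f : L2C2) : ∀ᵐ x : ℝ,
    Tendsto (fun t => Complex.I • ∫ y, conjPoissonKer t (x - y) • f y) (𝓝[>] 0)
      (𝓝 (Real.pi • fourierMul sgn isBddBorel_sgn f x)) := by
  have hS := Lp.memLp (fourierMul sgn isBddBorel_sgn f)
  filter_upwards [ae_isLebesguePoint (hS.locallyIntegrable (by norm_num))] with x hx
  refine (hx.tendsto_poisson hS).congr' ?_
  filter_upwards [self_mem_nhdsWithin] with t ht
  exact (integral_conjPoissonKer_smul ht f x).symm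

/-- The principal value integrals exist, and can be computed with conjugate Poisson kernels. -/
theorem ae_exists_hasPV (f : L2C2) : ∀ᵐ x : ℝ, ∃ L : EuclideanSpace ℂ (Fin 2),
    (∀ i, HasPV (fun y => f y i) x (L i)) ∧
    Tendsto (fun t => ∫ y, conjPoissonKer t (x - y) • f y) (𝓝[>] 0) (𝓝 L) := by
  filter_upwards [ae_exists_tendsto_conjPoissonKer f,
    ae_isLebesguePoint ((Lp.memLp f).locallyIntegrable (by norm_num))] with x hx hL
  have h := hx.const_smul (-Complex.I)
  simp only [smul_smul, neg_mul, Complex.I_mul_I, neg_neg, one_smul] at h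
  refine ⟨_, fun i => hasPV_of_tendsto (memLp_coord (Lp.memLp f) i) ?_, h⟩
  have h2 := ((EuclideanSpace.proj i : EuclideanSpace ℂ (Fin 2) →L[ℂ] ℂ).continuous.tendsto _).comp
    (hL.tendsto_truncated (Lp.memLp f) h)
  refine h2.congr' ?_
  filter_upwards [self_mem_nhdsWithin] with ε hε
  exact integral_smul_apply (κ := {v : ℝ | ε < |v|}.indicator fun v => v⁻¹)
    (memLp_truncated hε) (Lp.memLp f) x i

/-- Since $|x|+|y|>|x|/2$, truncating $1/u$ at $|x|/2$ changes nothing, and the truncated kernel is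
square integrable. -/
theorem memLp_inv_abs_add_abs {x : ℝ} (hx : x ≠ 0) : MemLp (fun y => (|x| + |y|)⁻¹) 2 := by
  have hx' : 0 < |x| := abs_pos.2 hx
  refine (memLp_kernel_abs (κ := {u : ℝ | |x| / 2 < |u|}.indicator fun u => u⁻¹)
    (memLp_truncated (half_pos hx')) x).ae_eq
    (Eventually.of_forall fun y => ?_)
  have := abs_nonneg y
  refine indicator_of_mem (s := {u : ℝ | |x| / 2 < |u|}) (f := fun u : ℝ => u⁻¹) ?_
  change |x| / 2 < |(|x| + |y|)|
  rw [abs_of_pos (a := |x| + |y|) (by positivity)]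
  linarith

theorem integrable_div_abs_add_abs {u : ℝ → ℂ} (hu : MemLp u 2) {x : ℝ} (hx : x ≠ 0) :
    Integrable fun y => u y / ((|x| + |y| : ℝ) : ℂ) := by
  refine (integrable_ofReal_mul_of_memLp_two (memLp_inv_abs_add_abs hx) hu).congr
    (Eventually.of_forall fun y => ?_)
  beta_reduce
  rw [Complex.ofReal_inv, div_eq_inv_mul]

/-- The kernel is not singular for $x\ne0$ and is dominated by $(|x|+|y|)^{-1}$, so the limit is an
absolutely convergent integral. -/
theorem tendsto_integral_conjPoissonKer_abs {u : ℝ → ℂ} (hu : MemLp u 2) {x : ℝ} (hx : x ≠ 0) :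
    Tendsto (fun t => ∫ y, (conjPoissonKer t (|x| + |y|) : ℂ) * u y) (𝓝[>] 0)
      (𝓝 (∫ y, u y / ((|x| + |y| : ℝ) : ℂ))) := by
  have hpos : ∀ y, 0 < |x| + |y| := fun y => by
    have := abs_pos.2 hx
    positivity
  refine tendsto_integral_filter_of_dominated_convergence _ ?_ ?_
    (integrable_div_abs_add_abs hu hx).norm ?_
  · filter_upwards [self_mem_nhdsWithin] with t ht
    exact (integrable_ofReal_mul_of_memLp_two
      (memLp_kernel_abs (memLp_conjPoissonKer_sub ht) x) hu).1
  · filter_upwards [self_mem_nhdsWithin] with t ht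
    refine Eventually.of_forall fun y => ?_
    have h := hpos y
    rw [norm_mul, norm_div, Complex.norm_real, Complex.norm_real, div_eq_inv_mul]
    refine mul_le_mul_of_nonneg_right ?_ (norm_nonneg _)
    rw [Real.norm_of_nonneg (by unfold conjPoissonKer; positivity), Real.norm_of_nonneg h.le,
      conjPoissonKer, div_le_iff₀ (by positivity)]
    have : (|x| + |y|)⁻¹ * (t ^ 2 + (|x| + |y|) ^ 2) = (|x| + |y|)⁻¹ * t ^ 2 + (|x| + |y|) := by
      field_simp
    rw [this]
    have : 0 ≤ (|x| + |y|)⁻¹ * t ^ 2 := by positivity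
    linarith
  · refine Eventually.of_forall fun y => ?_
    have h := (hpos y).ne'
    have hc : Tendsto (fun t : ℝ => conjPoissonKer t (|x| + |y|)) (𝓝[>] 0)
        (𝓝 (conjPoissonKer 0 (|x| + |y|))) := by
      refine (ContinuousAt.tendsto ?_).mono_left nhdsWithin_le_nhds
      unfold conjPoissonKer
      exact continuousAt_const.div (by fun_prop) (by positivity)
    have e : conjPoissonKer 0 (|x| + |y|) = (|x| + |y|)⁻¹ := by
      unfold conjPoissonKer
      field_simp
      simp
    rw [e] at hc
    have h2 := ((Complex.continuous_ofReal.tendsto _).comp hc).mul_const (u y)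
    rwa [Complex.ofReal_inv, ← div_eq_inv_mul] at h2

end PrincipalValues

/-! ### The explicit formulas for $T_k$. -/

section SpectralProjections

open SpectralMeasure

theorem integral_kernel_unfold (k : ℝ) (κ : ℝ → ℝ) (f : L2C2) (x : ℝ) :
    ∫ y, κ (x - y) • unfold k f y = ∫ y, κ (x - y) • unfoldFun k f y :=
  integral_congr_ae ((coeFn_unfold k f).mono fun y hy => by simp only [hy])

theorem conjPoissonKer_neg (t u : ℝ) : conjPoissonKer t (-u) = -conjPoissonKer t u := by
  simp [conjPoissonKer, neg_div]

theorem poissonKer_neg (t u : ℝ) : poissonKer t (-u) = poissonKer t u := by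
  simp [poissonKer]

/-- The explicit form of `sgn(T_k)`. -/
theorem ae_sgn_opT (k : ℝ) {E : SpectralMeasure L2C2} (hE : E.IsSpectralMeasureOf (opT k))
    (f : L2C2) : ∀ᵐ x : ℝ, ∃ p₀ p₁ I₀ I₁ : ℂ,
      HasPV (fun y => f y 0) x p₀ ∧
      HasPV (fun y => f y 1) x p₁ ∧
      HasIntegral (fun y => (f y 0 + k * sgn y * f y 1) / (|x| + |y| : ℝ)) I₀ ∧
      HasIntegral (fun y => (k * f y 0 - sgn y * f y 1) / (|x| + |y| : ℝ)) I₁ ∧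
      E.integral sgn f x =
        (1 / Real.pi : ℂ) • !₂[-p₁, p₀] -
        (1 / Real.pi * (k / (1 + k ^ 2)) : ℂ) • !₂[I₀, sgn x * I₁] := by
  have hS := ae_exists_tendsto_conjPoissonKer (unfold k f)
  have h0 := memLp_coord (Lp.memLp f) 0
  have h1 := memLp_coord (Lp.memLp f) 1
  have hw0 : MemLp (fun y => f y 0 + k * sgn y * f y 1) 2 := by
    refine (h0.add ((memLp_sgn_mul h1).const_mul (k : ℂ))).ae_eq (Eventually.of_forall fun y => ?_)
    simp [mul_assoc]
  have hw1 : MemLp (fun y => k * f y 0 - sgn y * f y 1) 2 :=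
    (h0.const_mul (k : ℂ)).sub (memLp_sgn_mul h1)
  -- Convergence is required at both $x$ and $-x$, because folding evaluates the unfolded function
  -- at both points.
  filter_upwards [hS, ae_comp_neg hS, ae_exists_hasPV f, ae_ne_zero,
    coeFn_unfold_symm k (fourierMul sgn isBddBorel_sgn (unfold k f))] with x hx hnx hpv hx0 hfold
  obtain ⟨L, hL, hLt⟩ := hpv
  obtain ⟨I₀, hI₀⟩ : ∃ I, HasIntegral
    (fun y => (f y 0 + k * sgn y * f y 1) / (|x| + |y| : ℝ)) I :=
    ⟨_, integrable_div_abs_add_abs hw0 hx0, rfl⟩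
  obtain ⟨I₁, hI₁⟩ : ∃ I, HasIntegral
    (fun y => (k * f y 0 - sgn y * f y 1) / (|x| + |y| : ℝ)) I :=
    ⟨_, integrable_div_abs_add_abs hw1 hx0, rfl⟩
  refine ⟨L 0, L 1, I₀, I₁, hL 0, hL 1, hI₀, hI₁, ?_⟩
  rw [integral_apply_eq k hE isBddBorel_sgn, hfold]
  have hpi : (Real.pi : ℂ) ≠ 0 := by exact_mod_cast Real.pi_ne_zero
  have hcoord : ∀ i : Fin 2, Tendsto (fun t => ∫ y, (conjPoissonKer t (x - y) : ℂ) * f y i)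
      (𝓝[>] 0) (𝓝 (L i)) := by
    intro i
    refine (((EuclideanSpace.proj i : EuclideanSpace ℂ (Fin 2) →L[ℂ] ℂ).continuous.tendsto
      _).comp hLt).congr' ?_
    filter_upwards [self_mem_nhdsWithin] with t ht
    exact integral_smul_apply (memLp_conjPoissonKer_sub ht) (Lp.memLp f) x i
  have c0 := tendsto_integral_conjPoissonKer_abs hw0 hx0
  rw [hI₀.2] at c0
  have c1 := tendsto_integral_conjPoissonKer_abs hw1 hx0
  rw [hI₁.2] at c1
  have hc : ∀ {z : ℝ} {V : EuclideanSpace ℂ (Fin 2)},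
      Tendsto (fun t => Complex.I • ∫ y, conjPoissonKer t (z - y) • unfold k f y) (𝓝[>] 0)
        (𝓝 (Real.pi • V)) → ∀ i : Fin 2,
      Tendsto (fun t => Complex.I / Real.pi * (∫ y, conjPoissonKer t (z - y) • unfoldFun k f y) i)
        (𝓝[>] 0) (𝓝 (V i)) := by
    intro z V h i
    have h2 := (((EuclideanSpace.proj i : EuclideanSpace ℂ (Fin 2) →L[ℂ] ℂ).continuous.tendsto
      _).comp h).const_mul (Real.pi⁻¹ : ℂ)
    have e : (Real.pi⁻¹ : ℂ) * (EuclideanSpace.proj i : EuclideanSpace ℂ (Fin 2) →L[ℂ] ℂ)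
        (Real.pi • V) = V i := by
      change (Real.pi⁻¹ : ℂ) * (Real.pi • V i) = V i
      rw [Complex.real_smul, inv_mul_cancel_left₀ hpi]
    rw [e] at h2
    refine h2.congr fun t => ?_
    rw [← integral_kernel_unfold]
    change (Real.pi⁻¹ : ℂ) * (Complex.I * (∫ y, conjPoissonKer t (z - y) • unfold k f y) i) = _
    ring
  ext i
  fin_cases i
  · have a := ((((hc hx 0).const_mul (phase k (-x))).add (hc hx 1)).add
      ((hc hnx 0).const_mul (phase k x))).sub (hc hnx 1)
    have b := (((hcoord 1).add (c0.const_mul (k / (1 + k ^ 2) : ℂ))).const_mul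
      Complex.I).const_mul (Complex.I / Real.pi)
    -- For each $t>0$ the folded conjugate Poisson integrals equal the explicit kernel integrals;
    -- `a` and `b` are the limits of the two sides, and the prefactor $i\cdot i/\pi$ gives the sign.
    have e := tendsto_nhds_unique ((a.div_const 2).congr' (by
      filter_upwards [self_mem_nhdsWithin] with t ht
      have h := hasIntegral_foldFun_odd_zero k (memLp_conjPoissonKer_sub ht)
        (conjPoissonKer_neg t) (Lp.memLp f) hx0
      have g : HasIntegral (fun y => (conjPoissonKer t (x - y) : ℂ) * f y 1) _ :=
        ⟨integrable_ofReal_mul_of_memLp_two (memLp_conjPoissonKer_sub ht x) h1, rfl⟩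
      have g' : HasIntegral (fun y => (conjPoissonKer t (|x| + |y|) : ℂ) *
          (f y 0 + k * sgn y * f y 1)) _ :=
        ⟨integrable_ofReal_mul_of_memLp_two
          (memLp_kernel_abs (memLp_conjPoissonKer_sub ht) x) hw0, rfl⟩
      have e := h.2.symm.trans ((g.add (g'.const_mul (k / (1 + k ^ 2)))).const_mul Complex.I).2
      rw [← e, foldFun_zero]
      ring)) b
    change foldFun k _ x 0 = (1 / Real.pi : ℂ) * (-L 1) - (1 / Real.pi * (k / (1 + k ^ 2))) * I₀
    rw [foldFun_zero]
    linear_combination e + (L 1 + k / (1 + k ^ 2) * I₀) / Real.pi * Complex.I_sq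
  · have a := ((((hc hx 0).const_mul (phase k (-x))).add (hc hx 1)).sub
      ((hc hnx 0).const_mul (phase k x))).add (hc hnx 1)
    have b := (((hcoord 0).neg.add ((c1.const_mul (sgn x)).const_mul
      (k / (1 + k ^ 2) : ℂ))).const_mul Complex.I).const_mul (Complex.I / Real.pi)
    have e := tendsto_nhds_unique ((a.div_const (2 * Complex.I)).congr' (by
      filter_upwards [self_mem_nhdsWithin] with t ht
      have h := hasIntegral_foldFun_odd_one k (memLp_conjPoissonKer_sub ht)
        (conjPoissonKer_neg t) (Lp.memLp f) hx0
      have g : HasIntegral (fun y => (conjPoissonKer t (x - y) : ℂ) * f y 0) _ :=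
        ⟨integrable_ofReal_mul_of_memLp_two (memLp_conjPoissonKer_sub ht x) h0, rfl⟩
      have g' : HasIntegral (fun y => (conjPoissonKer t (|x| + |y|) : ℂ) *
          (k * f y 0 - sgn y * f y 1)) _ :=
        ⟨integrable_ofReal_mul_of_memLp_two
          (memLp_kernel_abs (memLp_conjPoissonKer_sub ht) x) hw1, rfl⟩
      have e := h.2.symm.trans ((g.neg.add ((g'.const_mul (sgn x)).const_mul
        (k / (1 + k ^ 2)))).const_mul Complex.I).2
      rw [← e, foldFun_one]
      ring)) b
    change foldFun k _ x 1 = (1 / Real.pi : ℂ) * L 0 -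
      (1 / Real.pi * (k / (1 + k ^ 2))) * (sgn x * I₁)
    rw [foldFun_one]
    linear_combination e + (-L 0 + k / (1 + k ^ 2) * (sgn x * I₁)) / Real.pi * Complex.I_sq

theorem isBddBorel_poissonSymbol_mul_chiPlus {t : ℝ} (ht : 0 < t) :
    IsBddBorel fun s => poissonSymbol t s * chiPlus s := by
  have h := (isBddBorel_poissonSymbol ht).mul
    ((IsBddBorel.const 1).indicator (measurableSet_Ioi (a := (0 : ℝ))))
  exact h

/-- $\chi_+=(1+\mathrm{sgn})/2$ except at $s=0$, a null set. -/
theorem invFourierKernel_poissonSymbol_mul_chiPlus {t : ℝ} (ht : 0 < t) (z : ℝ) :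
    invFourierKernel (fun s => poissonSymbol t s * chiPlus s) z =
      (invFourierKernel (poissonSymbol t) z + invFourierKernel (poissonSymbol t * sgn) z) / 2 := by
  have hi := integrable_poissonSymbol_mul_exp ht z
  have hi' := integrable_poissonSymbol_mul_sgn_mul_exp ht z
  rw [invFourierKernel, invFourierKernel, invFourierKernel, ← mul_add, mul_div_assoc]
  congr 1
  rw [← integral_add hi hi', ← integral_div]
  refine integral_congr_ae (ae_ne_zero.mono fun s hs => ?_)
  rcases lt_or_gt_of_ne hs with h | h
  · simp [chiPlus, sgn_of_neg h, h.le]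
  · simp [chiPlus, sgn_of_pos h, h]

/-- The explicit form of `e^{-t|T_k|} χ₊(T_k)`. -/
theorem ae_exp_mul_chiPlus_opT (k : ℝ) {E : SpectralMeasure L2C2}
    (hE : E.IsSpectralMeasureOf (opT k)) (f : L2C2) {t : ℝ} (ht : 0 < t) :
    ∀ᵐ x : ℝ, ∃ P₀ P₁ J₀ J₁ : ℂ,
      HasIntegral (fun y => (t * f y 0 - (x - y) * f y 1) / (t ^ 2 + (x - y) ^ 2)) P₀ ∧
      HasIntegral (fun y => (t * f y 1 + (x - y) * f y 0) / (t ^ 2 + (x - y) ^ 2)) P₁ ∧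
      HasIntegral (fun y => (t * (k * f y 0 - sgn y * f y 1) +
        (|x| + |y| : ℝ) * (f y 0 + k * sgn y * f y 1)) /
          (t ^ 2 + (|x| + |y| : ℝ) ^ 2)) J₀ ∧
      HasIntegral (fun y => (t * (f y 0 + k * sgn y * f y 1) +
        (|x| + |y| : ℝ) * (-k * f y 0 + sgn y * f y 1)) /
          (t ^ 2 + (|x| + |y| : ℝ) ^ 2)) J₁ ∧
      E.integral (fun s => (Real.exp (-t * |s|) : ℂ) * chiPlus s) f x =
        (1 / (2 * Real.pi) : ℂ) • !₂[P₀, P₁] +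
        (1 / (2 * Real.pi) * (k / (1 + k ^ 2)) : ℂ) • !₂[-J₀, sgn x * J₁] := by
  have hb := isBddBorel_poissonSymbol_mul_chiPlus ht
  have hi : Integrable fun s => poissonSymbol t s * chiPlus s := by
    refine (integrable_poissonSymbol ht).mono hb.1.aestronglyMeasurable
      (Eventually.of_forall fun s => ?_)
    rw [norm_mul]
    refine mul_le_of_le_one_right (norm_nonneg _) ?_
    rw [chiPlus]
    exact (norm_indicator_le_norm_self _ _).trans (by simp)
  have h0 := memLp_coord (Lp.memLp f) 0
  have h1 := memLp_coord (Lp.memLp f) 1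
  have hw0 : MemLp (fun y => f y 0 + k * sgn y * f y 1) 2 := by
    refine (h0.add ((memLp_sgn_mul h1).const_mul (k : ℂ))).ae_eq (Eventually.of_forall fun y => ?_)
    simp [mul_assoc]
  have hw1 : MemLp (fun y => k * f y 0 - sgn y * f y 1) 2 :=
    (h0.const_mul (k : ℂ)).sub (memLp_sgn_mul h1)
  have hp := memLp_poissonKer_sub ht
  have hc := memLp_conjPoissonKer_sub ht
  have hN : ∀ x, ∫ y, invFourierKernel (fun s => poissonSymbol t s * chiPlus s) (x - y) •
      -- The symbol is integrable, so no limit is taken: the even Poisson kernel and $i$ times the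
      -- odd conjugate kernel are folded separately.
      unfold k f y = (1 / (2 * Real.pi) : ℂ) • ((∫ y, poissonKer t (x - y) • unfoldFun k f y) +
        Complex.I • ∫ y, conjPoissonKer t (x - y) • unfoldFun k f y) := by
    intro x
    rw [← integral_kernel_unfold, ← integral_kernel_unfold, ← integral_smul Complex.I,
      ← integral_add (integrable_real_smul_of_memLp_two (hp x) (Lp.memLp _))
        (Integrable.fun_smul Complex.I (integrable_real_smul_of_memLp_two (hc x) (Lp.memLp _))),
      ← integral_smul]
    refine integral_congr_ae (Eventually.of_forall fun y => ?_)
    beta_reduce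
    rw [invFourierKernel_poissonSymbol_mul_chiPlus ht, div_eq_inv_mul, mul_smul, add_smul,
      invFourierKernel_poissonSymbol_smul ht, invFourierKernel_poissonSymbol_mul_sgn_smul ht,
      ← smul_add, smul_smul]
    congr 1
    ring
  have hfourier := fourierMul_ae_eq hb hi (unfold k f)
  simp only [hN] at hfourier
  filter_upwards [ae_ne_zero, foldFun_congr k hfourier,
    coeFn_unfold_symm k (fourierMul _ hb (unfold k f))] with x hx hx1 hx2
  have hpa := memLp_kernel_abs hp x
  have hca := memLp_kernel_abs hc x
  have p0 := integrable_ofReal_mul_of_memLp_two (hp x) h0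
  have p1 := integrable_ofReal_mul_of_memLp_two (hp x) h1
  have c0 := integrable_ofReal_mul_of_memLp_two (hc x) h0
  have c1 := integrable_ofReal_mul_of_memLp_two (hc x) h1
  have pa0 := integrable_ofReal_mul_of_memLp_two hpa hw0
  have pa1 := integrable_ofReal_mul_of_memLp_two hpa hw1
  have ca0 := integrable_ofReal_mul_of_memLp_two hca hw0
  have ca1 := integrable_ofReal_mul_of_memLp_two hca hw1
  have P0 : HasIntegral (fun y => (t * f y 0 - (x - y) * f y 1) / (t ^ 2 + (x - y) ^ 2)) _ :=
    ⟨(p0.sub c1).congr (Eventually.of_forall fun y => by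
      simp only [Pi.sub_apply, poissonKer, conjPoissonKer]; push_cast; ring), rfl⟩
  have P1 : HasIntegral (fun y => (t * f y 1 + (x - y) * f y 0) / (t ^ 2 + (x - y) ^ 2)) _ :=
    ⟨(p1.add c0).congr (Eventually.of_forall fun y => by
      simp only [Pi.add_apply, poissonKer, conjPoissonKer]; push_cast; ring), rfl⟩
  have J0 : HasIntegral (fun y => (t * (k * f y 0 - sgn y * f y 1) +
        (|x| + |y| : ℝ) * (f y 0 + k * sgn y * f y 1)) / (t ^ 2 + (|x| + |y| : ℝ) ^ 2)) _ :=
    ⟨(pa1.add ca0).congr (Eventually.of_forall fun y => by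
      simp only [Pi.add_apply, poissonKer, conjPoissonKer]; push_cast; ring), rfl⟩
  have J1 : HasIntegral (fun y => (t * (f y 0 + k * sgn y * f y 1) +
        (|x| + |y| : ℝ) * (-k * f y 0 + sgn y * f y 1)) / (t ^ 2 + (|x| + |y| : ℝ) ^ 2)) _ :=
    ⟨(pa0.sub ca1).congr (Eventually.of_forall fun y => by
      simp only [Pi.sub_apply, poissonKer, conjPoissonKer]; push_cast; ring), rfl⟩
  refine ⟨_, _, _, _, P0, P1, J0, J1, ?_⟩
  change E.integral (fun s => poissonSymbol t s * chiPlus s) f x = _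
  rw [integral_apply_eq k hE hb, hx2, hx1]
  have fold : ∀ i, foldFun k (fun x => (1 / (2 * Real.pi) : ℂ) •
      ((∫ y, poissonKer t (x - y) • unfoldFun k f y) +
        Complex.I • ∫ y, conjPoissonKer t (x - y) • unfoldFun k f y)) x i =
      (1 / (2 * Real.pi) : ℂ) * (foldFun k (fun x => ∫ y, poissonKer t (x - y) • unfoldFun k f y)
        x i + Complex.I * foldFun k (fun x => ∫ y, conjPoissonKer t (x - y) • unfoldFun k f y)
        x i) := by
    intro i
    fin_cases i
    · simp only [Fin.zero_eta, foldFun_zero, PiLp.smul_apply, PiLp.add_apply, smul_eq_mul]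
      ring
    · simp only [Fin.mk_one, foldFun_one, PiLp.smul_apply, PiLp.add_apply, smul_eq_mul]
      ring
  ext i
  rw [fold i]
  fin_cases i
  · have a := (hasIntegral_foldFun_even_zero k hp (poissonKer_neg t) (Lp.memLp f) hx).add
      ((hasIntegral_foldFun_odd_zero k hc (conjPoissonKer_neg t) (Lp.memLp f) hx).const_mul
        Complex.I)
    have b := P0.sub (J0.const_mul (k / (1 + k ^ 2)))
    refine (congrArg _ (a.2.symm.trans ((integral_congr_ae (Eventually.of_forall fun y => ?_)).trans
      b.2))).trans ?_
    · simp only [poissonKer, conjPoissonKer]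
      push_cast
      linear_combination ((x - y) / (t ^ 2 + (x - y) ^ 2) * f y 1 + k / (1 + k ^ 2) *
        ((|x| + |y|) / (t ^ 2 + (|x| + |y|) ^ 2) * (f y 0 + k * sgn y * f y 1)) : ℂ) *
        Complex.I_sq
    · simp only [Fin.zero_eta, PiLp.add_apply, PiLp.smul_apply, smul_eq_mul,
        Matrix.cons_val_zero]
      ring
  · have a := (hasIntegral_foldFun_even_one k hp (poissonKer_neg t) (Lp.memLp f) hx).add
      ((hasIntegral_foldFun_odd_one k hc (conjPoissonKer_neg t) (Lp.memLp f) hx).const_mul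
        Complex.I)
    have b := P1.add ((J1.const_mul (sgn x)).const_mul (k / (1 + k ^ 2)))
    refine (congrArg _ (a.2.symm.trans ((integral_congr_ae (Eventually.of_forall fun y => ?_)).trans
      b.2))).trans ?_
    · simp only [poissonKer, conjPoissonKer]
      push_cast
      linear_combination (-((x - y) / (t ^ 2 + (x - y) ^ 2) * f y 0) + k / (1 + k ^ 2) * (sgn x *
        ((|x| + |y|) / (t ^ 2 + (|x| + |y|) ^ 2) * (k * f y 0 - sgn y * f y 1))) : ℂ) *
        Complex.I_sq
    · simp only [Fin.mk_one, PiLp.add_apply, PiLp.smul_apply, smul_eq_mul,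
        Matrix.cons_val_one, Matrix.cons_val_fin_one]
      ring

end SpectralProjections

end

theorem theorem2p1 (k : ℝ) :
    IsSelfAdjoint (opT k) ∧
    (∃ E : SpectralMeasure L2C2, E.IsSpectralMeasureOf (opT k)) ∧
    ∀ E : SpectralMeasure L2C2, E.IsSpectralMeasureOf (opT k) → ∀ f : L2C2,
      (∀ᵐ x : ℝ, ∃ p₀ p₁ I₀ I₁ : ℂ,
        HasPV (fun y => f y 0) x p₀ ∧
        HasPV (fun y => f y 1) x p₁ ∧
        HasIntegral (fun y => (f y 0 + k * sgn y * f y 1) / (|x| + |y| : ℝ)) I₀ ∧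
        HasIntegral (fun y => (k * f y 0 - sgn y * f y 1) / (|x| + |y| : ℝ)) I₁ ∧
        E.integral sgn f x =
          (1 / Real.pi : ℂ) • !₂[-p₁, p₀] -
          (1 / Real.pi * (k / (1 + k ^ 2)) : ℂ) • !₂[I₀, sgn x * I₁]) ∧
      ∀ t : ℝ, 0 < t → ∀ᵐ x : ℝ, ∃ P₀ P₁ J₀ J₁ : ℂ,
        HasIntegral (fun y => (t * f y 0 - (x - y) * f y 1) / (t ^ 2 + (x - y) ^ 2)) P₀ ∧
        HasIntegral (fun y => (t * f y 1 + (x - y) * f y 0) / (t ^ 2 + (x - y) ^ 2)) P₁ ∧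
        HasIntegral (fun y => (t * (k * f y 0 - sgn y * f y 1) +
          (|x| + |y| : ℝ) * (f y 0 + k * sgn y * f y 1)) /
            (t ^ 2 + (|x| + |y| : ℝ) ^ 2)) J₀ ∧
        HasIntegral (fun y => (t * (f y 0 + k * sgn y * f y 1) +
          (|x| + |y| : ℝ) * (-k * f y 0 + sgn y * f y 1)) /
            (t ^ 2 + (|x| + |y| : ℝ) ^ 2)) J₁ ∧
        E.integral (fun s => (Real.exp (-t * |s|) : ℂ) * chiPlus s) f x =
          (1 / (2 * Real.pi) : ℂ) • !₂[P₀, P₁] +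
          (1 / (2 * Real.pi) * (k / (1 + k ^ 2)) : ℂ) • !₂[-J₀, sgn x * J₁] := by
  have h := opTSpectralMeasure_isSpectralMeasureOf k
  exact ⟨h.isSelfAdjoint, ⟨_, h⟩, fun E hE f => ⟨ae_sgn_opT k hE f, fun t ht =>
    ae_exp_mul_chiPlus_opT k hE f ht⟩⟩
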